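/- Let $P_k=\mathbb F_2[x_1,\dots,x_k]$, each $x_j$ of degree $1$, with its standard module structure over the mod-2 Steenrod algebra $\mathcal A$: the linear operations $Sq^i$ ($i\ge 0$) satisfy $Sq^0x_j=x_j$, $Sq^1x_j=x_j^2$, $Sq^ix_j=0$ for $i>1$, and the Cartan formula $Sq^m(fg)=\sum_{i=0}^m Sq^i(f)Sq^{m-i}(g)$. Let $\mathcal A^+P_k=\sum_{i>0}Sq^i(P_k)$. A set $S$ of homogeneous polynomials of degree $n$ in $P_k$ is a *set of generators of the $\mathcal A$-module $P_k$ in degree $n$* if every homogeneous polynomial of degree $n$ is an $\mathbb F_2$-linear combination of elements of $S$ modulo $\mathcal A^+P_k$; it is *minimal* if no proper subset of $S$ has this property. Let $\mathcal N_k$ be the set of pairs $(i;I)$ with $I=(i_1,\dots,i_r)$, $0\le r<k$, $1\le i<i_1<\dots<i_r\le k$; write $r=\ell(I)$. Let $f_i:P_{k-1}\to P_k$ be the algebra homomorphism with $f_i(x_j)=x_j$ for $j<i$ and $f_i(x_j)=x_{j+1}$ for $i\le j<k$. For a monomial $x$ let $\nu_j(x)$ be the exponent of $x_j$ in $x$,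 and let $\alpha_s(a)$ be the coefficient of $2^s$ in the binary expansion of $a$. For $1\le u\le r$, a monomial $x\in P_{k-1}$ is *$u$-compatible* with $(i;I)$ if (i) $\nu_{i_t-1}(x)=2^r-1$ for $1\le t<u$; (ii) $\nu_{i_u-1}(x)>2^r-1$; (iii) $\alpha_{r-t}(\nu_{i_u-1}(x))=1$ for $1\le t\le u$; (iv) $\alpha_{r-t}(\nu_{i_t-1}(x))=1$ for $u<t\le r$. This holds for at most one $u$. Let $\phi_{(i;I)}:P_{k-1}\to P_k$ be the $\mathbb F_2$-linear map given on monomials as follows: $\phi_{(i;\emptyset)}(x)=f_i(x)$; and, for $r>0$, $$\phi_{(i;I)}(x)=\frac{x_i^{2^r-1}f_i(x)}{x_{i_u}^{2^{r-1}+\dots+2^{r-u}}\prod_{u<t\le r}x_{i_t}^{2^{r-t}}}$$ if $x$ is $u$-compatible with $(i;I)$ for some $u$, and $\phi_{(i;I)}(x)=0$ otherwise. Let $P_k^0$ be the span of the monomials of $P_k$ in which some variable does not occur. For a set $B\subset P_{k-1}$ put $$\Phi(B)=\Big(\bigcup_{1\le i\le k}\phi_{(i;\emptyset)}(B)\Big)\cup\Big(\bigcup_{(i;I)\in\mathcal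 N_k,\ \ell(I)>0}\phi_{(i;I)}(B)\setminus P_k^0\Big).$$ **Proposition.** Let $k-1\ge 3$ and $n=\sum_{1\le i\le k-1}(2^{d_i}-1)$ with integers $d_1>d_2>\dots>d_{k-2}\ge d_{k-1}\ge k-1$. If $B=B_{k-1}(n)$ is a minimal set of generators of the $\mathcal A$-module $P_{k-1}$ in degree $n$, then $\Phi(B)$ is a minimal set of generators of the $\mathcal A$-module $P_k$ in degree $n$. Moreover $\Phi(B)=\bigcup_{(i;I)\in\mathcal N_k}\phi_{(i;I)}(B)$, the sets $\phi_{(i;I)}(B)$ for different $(i;I)\in\mathcal N_k$ are pairwise disjoint, each of them has the same cardinality as $B$, and $|\mathcal N_k|=2^k-1$. -/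

import Mathlib

/-! The hit problem for the polynomial algebra over the mod-2 Steenrod algebra. -/

namespace HitProblem

noncomputable section

/-- The polynomial algebra `P_k = 𝔽₂[x_1, …, x_k]`; the variable `x_j` is `X (j - 1)`, i.e. the
variables are indexed from `0` here. -/
abbrev P (k : ℕ) : Type := MvPolynomial (Fin k) (ZMod 2)

/-- The total Steenrod square `Sq = ∑ Sq^i T^i`, the algebra homomorphism `P_k → P_k[T]` with
`x_j ↦ x_j + x_j² T`. -/
def totalSq (k : ℕ) : P k →ₐ[ZMod 2] Polynomial (P k) :=
  MvPolynomial.aeval fun j : Fin k =>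
    Polynomial.C (MvPolynomial.X j) + Polynomial.C (MvPolynomial.X j ^ 2) * Polynomial.X

/-- The Steenrod square `Sq^i : P_k → P_k`, the coefficient of `T^i` in the total square. -/
def Sq (k i : ℕ) : P k →ₗ[ZMod 2] P k :=
  ((Polynomial.lcoeff (P k) i).restrictScalars (ZMod 2)).comp (totalSq k).toLinearMap

theorem Sq_apply (k i : ℕ) (f : P k) : Sq k i f = (totalSq k f).coeff i := rfl

/-- The defining values: `Sq^0 x_j = x_j`, `Sq^1 x_j = x_j²`, `Sq^i x_j = 0` for `i > 1`. -/
theorem Sq_X (k i : ℕ) (j : Fin k) :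
    Sq k i (MvPolynomial.X j) =
      if i = 0 then MvPolynomial.X j else if i = 1 then MvPolynomial.X j ^ 2 else 0 := by
  rw [Sq_apply, totalSq, MvPolynomial.aeval_X, Polynomial.coeff_add, Polynomial.coeff_C,
    Polynomial.coeff_C_mul, Polynomial.coeff_X]
  rcases i with _ | _ | i <;> simp

/-- `Sq^0 1 = 1` and `Sq^i 1 = 0` for `i > 0`. -/
theorem Sq_one (k i : ℕ) : Sq k i 1 = if i = 0 then 1 else 0 := by
  rw [Sq_apply, map_one, Polynomial.coeff_one]

/-- The Cartan formula. -/
theorem Sq_mul (k m : ℕ) (f g : P k) :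
    Sq k m (f * g) = ∑ i ∈ Finset.range (m + 1), Sq k i f * Sq k (m - i) g := by
  rw [Sq_apply, map_mul, Polynomial.coeff_mul,
    Finset.Nat.sum_antidiagonal_eq_sum_range_succ_mk]
  rfl

/-- `𝒜⁺P_k`, the space of hit polynomials: finite sums `∑_{i > 0} Sq^i(f_i)`. -/
def hit (k : ℕ) : Submodule (ZMod 2) (P k) :=
  ⨆ i : {i : ℕ // 0 < i}, LinearMap.range (Sq k i)

/-- `S` is a set of generators for the `𝒜`-module `P_k` in degree `n`: it consists of homogeneous
polynomials of degree `n`, and every polynomial in `(P_k)_n` is an `𝔽₂`-linear combination of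
elements of `S` modulo hit polynomials, i.e. the classes of the elements of `S` span `(QP_k)_n`. -/
def IsGeneratingSet (k n : ℕ) (S : Set (P k)) : Prop :=
  S ⊆ MvPolynomial.homogeneousSubmodule (Fin k) (ZMod 2) n ∧
    MvPolynomial.homogeneousSubmodule (Fin k) (ZMod 2) n ≤
      Submodule.span (ZMod 2) S ⊔ hit k

/-- `S` is a minimal set of generators for the `𝒜`-module `P_k` in degree `n`: no proper subset of
`S` is a set of generators in degree `n`. -/
def IsMinimalGeneratingSet (k n : ℕ) (S : Set (P k)) : Prop :=
  Minimal (IsGeneratingSet k n) S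

/-- The set `𝒩_k` of pairs `(i; I)` with `I = (i_1 < … < i_r)` and `i < i_1`. The increasing
sequence `I` is given by the set of its entries. -/
@[ext]
structure Idx (k : ℕ) where
  i : Fin k
  I : Finset (Fin k)
  lt : ∀ j ∈ I, i < j

variable {l : ℕ}

/-- The length `r = ℓ(I)`. -/
def Idx.r (p : Idx (l + 1)) : ℕ := p.I.card

/-- The entry `i_t` of `I`, where `t` runs from `0` to `r - 1` instead of from `1` to `r`. -/
def Idx.entry (p : Idx (l + 1)) (t : Fin p.r) : Fin (l + 1) := p.I.orderEmbOfFin rfl t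

theorem Idx.entry_ne_zero (p : Idx (l + 1)) (t : Fin p.r) : p.entry t ≠ 0 :=
  Fin.ne_zero_of_lt (p.lt _ (Finset.orderEmbOfFin_mem p.I rfl t))

/-- The index `i_t - 1` of a variable of `P_{k-1}`. -/
def Idx.entryPred (p : Idx (l + 1)) (t : Fin p.r) : Fin l := (p.entry t).pred (p.entry_ne_zero t)

/-- `f_i : P_{k-1} → P_k` is the algebra homomorphism with `x_j ↦ x_j` for `j < i` and
`x_j ↦ x_{j+1}` for `j ≥ i`. Here and below `k = l + 1`. -/
def f (i : Fin (l + 1)) : P l →ₐ[ZMod 2] P (l + 1) := MvPolynomial.rename i.succAbove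

/-- The monomial of `P_{k-1}` with exponents `a` is `(u + 1)`-compatible with `(i; I)`, for
`I ≠ ∅` and `0 ≤ u < r`. Since `t` starts from `0`, the binary digit `α_{r-t}` of the usual
convention becomes the digit at position `r - 1 - t`. -/
structure Compatible (p : Idx (l + 1)) (a : Fin l →₀ ℕ) (u : Fin p.r) : Prop where
  eq_of_lt : ∀ t, t < u → a (p.entryPred t) = 2 ^ p.r - 1
  lt_at : 2 ^ p.r - 1 < a (p.entryPred u)
  digit_at : ∀ t, t ≤ u → (a (p.entryPred u)).testBit (p.r - 1 - t) = true
  digit_of_gt : ∀ t, u < t → (a (p.entryPred t)).testBit (p.r - 1 - t) = true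

/-- A monomial is `u`-compatible with a given `(i; I)` for at most one `u`. -/
theorem Compatible.unique {p : Idx (l + 1)} {a : Fin l →₀ ℕ} {u v : Fin p.r}
    (hu : Compatible p a u) (hv : Compatible p a v) : u = v := by
  rcases lt_trichotomy u v with h | h | h
  · exact absurd (hv.eq_of_lt u h) hu.lt_at.ne'
  · exact h
  · exact absurd (hu.eq_of_lt v h) hv.lt_at.ne'

/-- The exponents of the monomial
`x_{(I,u)} = x_{i_u}^{2^{r-1} + … + 2^{r-u}} ∏_{u < t ≤ r} x_{i_t}^{2^{r-t}}`. -/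
def divisorExp (p : Idx (l + 1)) (u : Fin p.r) : Fin (l + 1) →₀ ℕ :=
  Finsupp.single (p.entry u) (∑ t ∈ Finset.Iic u, 2 ^ (p.r - 1 - (t : ℕ))) +
    ∑ t ∈ Finset.Ioi u, Finsupp.single (p.entry t) (2 ^ (p.r - 1 - (t : ℕ)))

open Classical in
/-- The value of `φ_{(i;I)}` on the monomial with exponents `a`. It is `f_i(x)` if `I = ∅`, it is
`x_i^{2^r-1} f_i(x) / x_{(I,u)}` if `x` is `u`-compatible with `(i; I)`, and otherwise it is `0`. -/
def phiMonomial (p : Idx (l + 1)) (a : Fin l →₀ ℕ) : P (l + 1) :=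
  if p.I = ∅ then f p.i (MvPolynomial.monomial a 1)
  else if h : ∃ u, Compatible p a u then
    (MvPolynomial.X p.i ^ (2 ^ p.r - 1) * f p.i (MvPolynomial.monomial a 1)).divMonomial
      (divisorExp p h.choose)
  else 0

/-- The `𝔽₂`-linear map `φ_{(i;I)} : P_{k-1} → P_k`. -/
def phi (p : Idx (l + 1)) : P l →ₗ[ZMod 2] P (l + 1) :=
  (MvPolynomial.basisMonomials (Fin l) (ZMod 2)).constr (ZMod 2) (phiMonomial p)

/-- `P_k^0`, the span of the monomials in which some variable does not occur. -/
def PZero (k : ℕ) : Submodule (ZMod 2) (P k) :=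
  Submodule.span (ZMod 2)
    {x | ∃ a : Fin k →₀ ℕ, (∃ j, a j = 0) ∧ x = MvPolynomial.monomial a 1}

/-- `Φ⁰(B) = ⋃_i φ_{(i;∅)}(B) = ⋃_i f_i(B)`. -/
def PhiZero (B : Set (P l)) : Set (P (l + 1)) :=
  ⋃ i : Fin (l + 1), f i '' B

/-- `Φ⁺(B) = ⋃_{ℓ(I) > 0} φ_{(i;I)}(B) \ P_k^0`. -/
def PhiPlus (B : Set (P l)) : Set (P (l + 1)) :=
  (⋃ (p : Idx (l + 1)) (_ : 0 < p.r), phi p '' B) \ PZero (l + 1)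

/-- `Φ(B) = Φ⁰(B) ∪ Φ⁺(B)`. -/
def Phi (B : Set (P l)) : Set (P (l + 1)) := PhiZero B ∪ PhiPlus B

end

end HitProblem

open HitProblem

namespace HitProblem
open MvPolynomial

/-! Put $k=l+1$ and $N_e=\sum_i(2^{d_i-d_l+e}-1)$, so that $n=N_d$ with $d=d_l$, and
$N_{e+1}=2N_e+l$. The χ-trick and a count of binary digits show that a monomial of degree $N_{e+1}$
with fewer than $l$ odd exponents is hit (`degreeSeq_of_exponents`). Hence, modulo hits, only those
monomials of degree $n$ in $P_k$ matter for which each of the lowest $d$ binary columns of the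
exponents misses exactly one variable. Such a monomial is a word of length $d$ in the operations
`kapE z`, applied to a monomial of degree $N_0$. Relations coming from $Sq^1$ show that the class of
a word depends only on its length and its set of letters (`op_eq_of_toFinset`). On $P_{k-1}$, where
the columns are full, $\phi_{(i;I)}$ becomes $f_i$ followed by a word with letters $\{i\}\cup I$
(`exists_word_of_lt`); in the extreme case $\ell(I)=d=l$ the letters are instead a final segment of
the variables that depends on the monomial (`exists_word_of_eq`).

Spanning. Let $D_S(y)$ be the class of a word with letter set $S$ applied to $y$. Then $\sum_j
D_{S\cup j}(x_jw)=0$. Summing over $S\supseteq T$ in characteristic 2 shows that $\sum_{S\supseteq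
T}D_S$ vanishes on multiples of $\sum_{j\in T}x_j$. So $x_{\min T}$ can be eliminated, and
descending induction on $T$ leaves the values $D_T(f_{\min T}(y))$, which are values of $\phi$
(`mem_of_family`). If $d=l$, no word has all $k$ letters; $D$ of the full set is then adjoined
formally (`fullClass`) and traded for final segments (`mem_of_tails`).

Independence. The substitution `proj p`, $x_i\mapsto\sum_{s\in I}x_{s-1}$, sends a word with letter
set $S$ to 0 modulo hits unless $S\subseteq\{i\}\cup I$, a triangular pattern (`mk_proj_op`).
Therefore the joint map `evalMap` reaches every coordinate copy of $(QP_{k-1})_n$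
(`single_mem_map_evalMap`), and a dimension count makes the spanning classes $\phi_{(i;I)}(b)$
independent. Minimality, disjointness, the cardinalities and the fact that no $\phi_{(i;I)}(b)$ with
$I\neq\emptyset$ lies in $P_k^0$ all follow. -/

/-! ### Steenrod squares of $x_Jv^2$ and homogeneity -/

/-- The squarefree monomial `∏_{j ∈ J} x_j`. -/
noncomputable def mon {k : ℕ} (J : Finset (Fin k)) : P k := ∏ j ∈ J, X j

theorem mem_of_isHomogeneous {k n : ℕ} {V : Submodule (ZMod 2) (P k)}
    (h : ∀ a : Fin k →₀ ℕ, a.degree = n → monomial a 1 ∈ V) {w : P k} (hw : w.IsHomogeneous n) :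
    w ∈ V := by
  rw [w.as_sum]
  refine V.sum_mem fun a ha => ?_
  have : monomial a (coeff a w) = (coeff a w) • (monomial a 1 : P k) := by
    rw [smul_monomial, smul_eq_mul, mul_one]
  rw [this]
  exact V.smul_mem _ (h a (hw.degree_eq_sum_deg_support ha).symm)

theorem mem_of_monomials {k : ℕ} {V : Submodule (ZMod 2) (P k)}
    (h : ∀ a : Fin k →₀ ℕ, monomial a 1 ∈ V) (w : P k) : w ∈ V := by
  rw [w.as_sum]
  refine V.sum_mem fun a ha => ?_
  have : monomial a (coeff a w) = (coeff a w) • (monomial a 1 : P k) := by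
    rw [smul_monomial, smul_eq_mul, mul_one]
  rw [this]
  exact V.smul_mem _ (h a)

theorem mon_isHomogeneous {k : ℕ} (J : Finset (Fin k)) : (mon J).IsHomogeneous J.card := by
  have := IsHomogeneous.prod J (fun j => (X j : P k)) (fun _ => 1) (fun j _ => isHomogeneous_X _ j)
  simpa [mon] using this

/-- The total square is a ring map, and squaring in $P_k[T]$ is Frobenius on coefficients together
with $T\mapsto T^2$. -/
theorem Sq_sq (k i : ℕ) (v : P k) :
    Sq k i (v ^ 2) = if Even i then (Sq k (i / 2) v) ^ 2 else 0 := by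
  rw [Sq_apply, map_pow, ← Polynomial.map_frobenius_expand, Polynomial.coeff_map,
    Polynomial.coeff_expand two_pos]
  simp only [even_iff_two_dvd]
  split_ifs
  · rw [frobenius_def, Sq_apply]
  · simp

theorem mon_mul_mon {k : ℕ} {J C : Finset (Fin k)} (h : C ⊆ J) :
    mon J * mon C = mon (J \ C) * mon C ^ 2 := by
  have : mon J = mon (J \ C) * mon C := (Finset.prod_sdiff h).symm
  rw [this]; ring

/-- Factor $x_j+x_j^2T=x_j(1+x_jT)$ and expand the product; $C$ is the set of variables that get
squared. -/
theorem totalSq_mon {k : ℕ} (J : Finset (Fin k)) :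
    totalSq k (mon J) = ∑ C ∈ J.powerset, Polynomial.C (mon (J \ C) * mon C ^ 2) *
      Polynomial.X ^ C.card := by
  have h1 : totalSq k (mon J) = Polynomial.C (mon J) *
      ∏ j ∈ J, (1 + Polynomial.C (X j) * Polynomial.X) := by
    rw [mon, map_prod, map_prod, ← Finset.prod_mul_distrib]
    refine Finset.prod_congr rfl fun j _ => ?_
    rw [totalSq, aeval_X, map_pow]; ring
  rw [h1, Finset.prod_one_add, Finset.mul_sum]
  refine Finset.sum_congr rfl fun C hC => ?_
  rw [← mon_mul_mon (Finset.mem_powerset.1 hC), Finset.prod_mul_distrib, Finset.prod_const,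
    map_mul]
  rw [mon, mon, map_prod, map_prod]; ring

theorem Sq_mon_mul_sq {k : ℕ} (i : ℕ) (J : Finset (Fin k)) (v : P k) :
    Sq k i (mon J * v ^ 2) = ∑ C ∈ J.powerset with C.card ≤ i ∧ Even (i - C.card),
      mon (J \ C) * (mon C * Sq k ((i - C.card) / 2) v) ^ 2 := by
  rw [Sq_apply, map_mul, totalSq_mon, Finset.sum_mul, Polynomial.finsetSum_coeff,
    Finset.sum_filter]
  refine Finset.sum_congr rfl fun C _ => ?_
  rw [mul_assoc, Polynomial.coeff_C_mul, Polynomial.coeff_X_pow_mul', ← Sq_apply, Sq_sq]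
  by_cases h : C.card ≤ i <;> by_cases h' : Even (i - C.card) <;> simp [h, h']
  ring

theorem Sq_zero (k : ℕ) (v : P k) : Sq k 0 v = v := by
  have : ((Polynomial.aeval (0 : P k)).restrictScalars (ZMod 2)).comp (totalSq k) =
      AlgHom.id (ZMod 2) (P k) := by
    ext j
    simp [totalSq]
  have h := DFunLike.congr_fun this v
  simpa [Sq_apply, Polynomial.coeff_zero_eq_aeval_zero] using h

theorem Sq_one_mul {k : ℕ} (v w : P k) : Sq k 1 (v * w) = v * Sq k 1 w + Sq k 1 v * w := by
  simp [Sq_mul, Finset.sum_range_succ, Sq_zero]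

theorem Sq_mem_hit {k i : ℕ} (hi : 0 < i) (v : P k) : Sq k i v ∈ hit k :=
  Submodule.mem_iSup_of_mem (⟨i, hi⟩ : {i : ℕ // 0 < i}) ⟨v, rfl⟩

theorem Sq_monomial_isHomogeneous {k : ℕ} (a : Fin k →₀ ℕ) (i : ℕ) :
    (Sq k i (monomial a 1)).IsHomogeneous (a.degree + i) := by
  classical
  induction a using Finsupp.induction_linear generalizing i with
  | zero =>
    have : (monomial 0 1 : P k) = 1 := rfl
    rw [this, Sq_one]
    split_ifs with h
    · simpa [h] using isHomogeneous_one _ _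
    · exact isHomogeneous_zero _ _ _
  | add a b iha ihb =>
    have : (monomial (a + b) 1 : P k) = monomial a 1 * monomial b 1 := by
      rw [monomial_mul, one_mul]
    rw [this, Sq_mul]
    refine IsHomogeneous.sum _ _ _ fun c hc => ?_
    have h := (iha c).mul (ihb (i - c))
    have hc' : c ≤ i := Nat.lt_succ_iff.1 (Finset.mem_range.1 hc)
    convert h using 1
    rw [map_add]; omega
  | single j m =>
    induction m generalizing i with
    | zero =>
      have : (monomial (Finsupp.single j 0) 1 : P k) = 1 := by simp
      rw [this, Sq_one]
      split_ifs with h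
      · simpa [h] using isHomogeneous_one _ _
      · exact isHomogeneous_zero _ _ _
    | succ m ih =>
      have : (monomial (Finsupp.single j (m + 1)) 1 : P k) =
          monomial (Finsupp.single j m) 1 * X j := by
        rw [X, monomial_mul, one_mul, Finsupp.single_add]
      rw [this, Sq_mul]
      refine IsHomogeneous.sum _ _ _ fun c hc => ?_
      have hc' : c ≤ i := Nat.lt_succ_iff.1 (Finset.mem_range.1 hc)
      have hX : (Sq k (i - c) (X j)).IsHomogeneous (1 + (i - c)) := by
        rw [Sq_X]
        split_ifs with h1 h2
        · rw [h1]; exact isHomogeneous_X _ _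
        · rw [h2]; exact isHomogeneous_X_pow _ _
        · exact isHomogeneous_zero _ _ _
      convert (ih c).mul hX using 1
      simp only [Finsupp.degree_single]; omega

theorem Sq_isHomogeneous {k n : ℕ} (i : ℕ) {w : P k} (hw : w.IsHomogeneous n) :
    (Sq k i w).IsHomogeneous (n + i) := by
  have : w ∈ (homogeneousSubmodule (Fin k) (ZMod 2) (n + i)).comap (Sq k i) :=
    mem_of_isHomogeneous (fun a ha => by
      simpa [ha] using Sq_monomial_isHomogeneous a i) hw
  exact this

theorem homogeneousComponent_monomial {k : ℕ} (n : ℕ) (a : Fin k →₀ ℕ) :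
    homogeneousComponent n (monomial a 1 : P k) = if a.degree = n then monomial a 1 else 0 :=
  by
  have h : (monomial a 1 : P k) ∈ homogeneousSubmodule (Fin k) (ZMod 2) a.degree :=
    isHomogeneous_monomial _ rfl
  rw [homogeneousComponent_of_mem h]
  simp only [eq_comm]

theorem homogeneousComponent_Sq {k n i : ℕ} (a : Fin k →₀ ℕ) :
    homogeneousComponent n (Sq k i (monomial a 1)) =
      if a.degree + i = n then Sq k i (monomial a 1) else 0 := by
  have h : Sq k i (monomial a 1) ∈ homogeneousSubmodule (Fin k) (ZMod 2) (a.degree + i) :=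
    Sq_monomial_isHomogeneous a i
  rw [homogeneousComponent_of_mem h]
  simp only [eq_comm]

/-- The homogeneous hit polynomials of degree `n` are spanned by the `Sq^i` of monomials. -/
theorem homogeneousComponent_mem_of_hit {k n : ℕ} {V : Submodule (ZMod 2) (P k)}
    (h : ∀ (i : ℕ) (a : Fin k →₀ ℕ), 0 < i → a.degree + i = n → Sq k i (monomial a 1) ∈ V)
    {w : P k} (hw : w ∈ hit k) : homogeneousComponent n w ∈ V := by
  have : hit k ≤ V.comap (homogeneousComponent n) := by
    refine iSup_le fun i => ?_
    rintro _ ⟨v, rfl⟩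
    have : v ∈ (V.comap (homogeneousComponent n)).comap (Sq k i) := by
      refine mem_of_monomials (fun a => ?_) v
      rw [Submodule.mem_comap, Submodule.mem_comap, homogeneousComponent_Sq]
      split_ifs with h'
      · exact h _ _ i.2 h'
      · exact V.zero_mem
    exact this
  exact this hw

theorem mem_of_hit {k n : ℕ} {V : Submodule (ZMod 2) (P k)}
    (h : ∀ (i : ℕ) (a : Fin k →₀ ℕ), 0 < i → a.degree + i = n → Sq k i (monomial a 1) ∈ V)
    {w : P k} (hw : w ∈ hit k) (hn : w.IsHomogeneous n) : w ∈ V := by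
  rw [← homogeneousComponent_eq_self hn]
  exact homogeneousComponent_mem_of_hit h hw

theorem homogeneousComponent_mem_hit {k n : ℕ} {w : P k} (hw : w ∈ hit k) :
    homogeneousComponent n w ∈ hit k :=
  homogeneousComponent_mem_of_hit (fun _ _ hi _ => Sq_mem_hit hi _) hw

theorem homogeneousComponent_X_mul {k n : ℕ} (j : Fin k) (w : P k) :
    homogeneousComponent (n + 1) (X j * w) = X j * homogeneousComponent n w := by
  have : w ∈ LinearMap.eqLocus
      ((homogeneousComponent (n + 1)).comp (LinearMap.mulLeft (ZMod 2) (X j)))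
      ((LinearMap.mulLeft (ZMod 2) (X j : P k)).comp (homogeneousComponent n)) := by
    refine mem_of_monomials (fun a => ?_) w
    have h : (X j * monomial a 1 : P k) = monomial (Finsupp.single j 1 + a) 1 := by
      rw [X, monomial_mul, one_mul]
    simp only [LinearMap.mem_eqLocus, LinearMap.comp_apply, LinearMap.mulLeft_apply]
    rw [h, homogeneousComponent_monomial, homogeneousComponent_monomial, map_add]
    simp only [Finsupp.degree_single, add_comm 1, add_left_inj]
    split_ifs
    · rw [← h]
    · simp
  exact this

/-! ### Linear substitutions -/

theorem Sq_comm_algHom {k k' : ℕ} (g : P k →ₐ[ZMod 2] P k')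
    (hg : ∀ j, totalSq k' (g (X j)) =
      Polynomial.C (g (X j)) + Polynomial.C (g (X j) ^ 2) * Polynomial.X) (i : ℕ) (w : P k) :
    g (Sq k i w) = Sq k' i (g w) := by
  have : (Polynomial.mapAlgHom g).comp (totalSq k) = (totalSq k').comp g := by
    ext1 j
    rw [AlgHom.comp_apply, AlgHom.comp_apply, hg]
    simp [totalSq]
  have h := congrArg (fun q => Polynomial.coeff q i) (DFunLike.congr_fun this w)
  simpa [Sq_apply] using h

theorem totalSq_sum_X {k : ℕ} (A : Finset (Fin k)) :
    totalSq k (∑ j ∈ A, X j) = Polynomial.C (∑ j ∈ A, X j) +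
      Polynomial.C ((∑ j ∈ A, X j) ^ 2) * Polynomial.X := by
  rw [map_sum, sum_pow_char]
  simp only [totalSq, aeval_X, map_sum, Finset.sum_add_distrib, Finset.sum_mul]

/-- A substitution of the variables by sums of variables commutes with the Steenrod squares. -/
theorem Sq_comm_of_linear {k k' : ℕ} (g : P k →ₐ[ZMod 2] P k')
    (hg : ∀ j, ∃ A : Finset (Fin k'), g (X j) = ∑ s ∈ A, X s) (i : ℕ) (w : P k) :
    g (Sq k i w) = Sq k' i (g w) :=
  Sq_comm_algHom g (fun j => by obtain ⟨A, hA⟩ := hg j; rw [hA, totalSq_sum_X]) i w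

theorem hit_of_linear {k k' : ℕ} (g : P k →ₐ[ZMod 2] P k')
    (hg : ∀ j, ∃ A : Finset (Fin k'), g (X j) = ∑ s ∈ A, X s) {w : P k} (hw : w ∈ hit k) :
    g w ∈ hit k' := by
  have : hit k ≤ (hit k').comap g.toLinearMap := by
    refine iSup_le fun i => ?_
    rintro _ ⟨v, rfl⟩
    rw [Submodule.mem_comap, AlgHom.toLinearMap_apply, Sq_comm_of_linear g hg]
    exact Sq_mem_hit i.2 _
  exact this hw

theorem isHomogeneous_of_linear {k k' n : ℕ} (g : P k →ₐ[ZMod 2] P k')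
    (hg : ∀ j, ∃ A : Finset (Fin k'), g (X j) = ∑ s ∈ A, X s) {w : P k}
    (hw : w.IsHomogeneous n) : (g w).IsHomogeneous n := by
  have h : g = aeval fun j => g (X j) := by ext1 j; simp
  rw [h]
  have := hw.aeval (fun j => g (X j)) (n := 1) (fun j => by
    obtain ⟨A, hA⟩ := hg j
    rw [hA]
    exact IsHomogeneous.sum _ _ _ fun s _ => isHomogeneous_X _ _)
  simpa using this

/-! ### The top square and the χ-trick -/

theorem totalSq_monomial_top {k : ℕ} (a : Fin k →₀ ℕ) :
    (totalSq k (monomial a 1)).natDegree ≤ a.degree ∧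
      Sq k a.degree (monomial a 1) = (monomial a 1) ^ 2 := by
  induction a using Finsupp.induction_linear with
  | zero =>
    have : (monomial 0 1 : P k) = 1 := rfl
    rw [this, Sq_one]; simp
  | add a b iha ihb =>
    have : (monomial (a + b) 1 : P k) = monomial a 1 * monomial b 1 := by
      rw [monomial_mul, one_mul]
    rw [this, map_mul, map_add]
    refine ⟨Polynomial.natDegree_mul_le.trans (add_le_add iha.1 ihb.1), ?_⟩
    rw [Sq_apply, map_mul, Polynomial.coeff_mul_add_eq_of_natDegree_le iha.1 ihb.1, ← Sq_apply,
      ← Sq_apply, iha.2, ihb.2, mul_pow]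
  | single j m =>
    have h : totalSq k (monomial (Finsupp.single j m) 1) =
        (Polynomial.C (X j ^ 2) * Polynomial.X + Polynomial.C (X j)) ^ m := by
      rw [← X_pow_eq_monomial, map_pow, totalSq, aeval_X, add_comm]
    have h1 : (Polynomial.C (X j ^ 2 : P k) * Polynomial.X + Polynomial.C (X j)).natDegree ≤ 1 :=
      Polynomial.natDegree_linear_le
    rw [Finsupp.degree_single, Sq_apply, h]
    refine ⟨(Polynomial.natDegree_pow_le_of_le m h1).trans (by simp), ?_⟩
    have := Polynomial.coeff_pow_of_natDegree_le (m := m) h1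
    rw [mul_one] at this
    rw [this]
    have hX : (monomial (Finsupp.single j m) 1 : P k) = X j ^ m := by
      rw [X_pow_eq_monomial]
    rw [hX]
    rw [Polynomial.coeff_add, Polynomial.coeff_C_mul, Polynomial.coeff_X_one, mul_one,
      Polynomial.coeff_C_succ, add_zero, ← pow_mul, ← pow_mul, mul_comm]

/-- Squaring, as a linear map over `𝔽₂`. -/
noncomputable def sqLin (k : ℕ) : P k →ₗ[ZMod 2] P k where
  toFun w := w ^ 2
  map_add' v w := by rw [CharTwo.add_sq]
  map_smul' c w := by
    have : c ^ 2 = c := by revert c; decide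
    rw [smul_pow, this, RingHom.id_apply]

theorem Sq_top {k g : ℕ} {w : P k} (hw : w.IsHomogeneous g) : Sq k g w = w ^ 2 := by
  have : w ∈ LinearMap.eqLocus (Sq k g) (sqLin k) :=
    mem_of_isHomogeneous (fun a ha => by
      rw [LinearMap.mem_eqLocus, ← ha]; exact (totalSq_monomial_top a).2) hw
  exact this

/-- The `T`-linear extension of the total square to `P_k[T]`. -/
noncomputable def totalSqExt (k : ℕ) : Polynomial (P k) →+* Polynomial (P k) :=
  Polynomial.eval₂RingHom (totalSq k).toRingHom Polynomial.X

/-- A term $aT^m$ contributes $Sq^{g-m}a$ to the coefficient of $T^g$, and this is hit unless $m=g$.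
-/
theorem coeff_totalSqExt_sub_mem_hit {k : ℕ} (g : ℕ) (q : Polynomial (P k)) :
    (totalSqExt k q).coeff g - q.coeff g ∈ hit k := by
  induction q using Polynomial.induction_on' with
  | add p q hp hq =>
    rw [map_add, Polynomial.coeff_add, Polynomial.coeff_add, add_sub_add_comm]
    exact add_mem hp hq
  | monomial n a =>
    have : totalSqExt k (Polynomial.monomial n a) = totalSq k a * Polynomial.X ^ n := by
      simp [totalSqExt, Polynomial.eval₂_monomial]
    rw [this, Polynomial.coeff_mul_X_pow', Polynomial.coeff_monomial]
    rcases lt_trichotomy n g with h | h | h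
    · rw [if_pos h.le, if_neg h.ne, sub_zero]
      exact Sq_mem_hit (Nat.sub_pos_of_lt h) a
    · rw [if_pos h.le, if_pos h, h, Nat.sub_self, ← Sq_apply, Sq_zero, sub_self]
      exact zero_mem _
    · rw [if_neg h.not_ge, if_neg h.ne', sub_zero]
      exact zero_mem _

/-- The truncated conjugate total square of a variable. -/
noncomputable def conjSqX {k : ℕ} (C : ℕ) (j : Fin k) : Polynomial (P k) :=
  ∑ c ∈ Finset.range C, Polynomial.C (X j ^ 2 ^ c) * Polynomial.X ^ (2 ^ c - 1)

/-- Each summand maps to itself plus the next one, so in characteristic 2 the sum telescopes: up to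
a high power of $T$, the total square inverts the conjugate one. -/
theorem totalSqExt_conjSqX {k : ℕ} (C : ℕ) (j : Fin k) :
    totalSqExt k (conjSqX (C + 1) j) = Polynomial.C (X j) +
      Polynomial.C (X j ^ 2 ^ (C + 1)) * Polynomial.X ^ (2 ^ (C + 1) - 1) := by
  have key : ∀ c, totalSqExt k (Polynomial.C (X j ^ 2 ^ c) * Polynomial.X ^ (2 ^ c - 1)) =
      Polynomial.C (X j ^ 2 ^ c) * Polynomial.X ^ (2 ^ c - 1) +
        Polynomial.C (X j ^ 2 ^ (c + 1)) * Polynomial.X ^ (2 ^ (c + 1) - 1) := by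
    intro c
    have h1 : totalSqExt k (Polynomial.C (X j ^ 2 ^ c) * Polynomial.X ^ (2 ^ c - 1)) =
        (Polynomial.C (X j) + Polynomial.C (X j ^ 2) * Polynomial.X) ^ 2 ^ c *
          Polynomial.X ^ (2 ^ c - 1) := by
      have hX : totalSqExt k (Polynomial.C (X j)) =
          Polynomial.C (X j) + Polynomial.C (X j ^ 2) * Polynomial.X := by
        simp [totalSqExt, totalSq]
      have hT : totalSqExt k Polynomial.X = Polynomial.X := by simp [totalSqExt]
      rw [map_mul, Polynomial.C_pow, map_pow, map_pow, hX, hT]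
    rw [h1, add_pow_char_pow, mul_pow, add_mul, ← map_pow, ← map_pow, mul_assoc, ← pow_add,
      ← pow_mul, pow_succ']
    congr 4
    have := Nat.one_le_two_pow (n := c)
    omega
  induction C with
  | zero =>
    rw [conjSqX, Finset.sum_range_one, key]
    simp
  | succ C ih =>
    rw [conjSqX, Finset.sum_range_succ, map_add, ← conjSqX, ih, key, add_assoc,
      ← add_assoc (Polynomial.C (X j ^ 2 ^ (C + 1)) * _), CharTwo.add_self_eq_zero, zero_add]

theorem X_pow_dvd_prod_add_sub {R ι : Type*} [CommRing R] (J : Finset ι) (a b : ι → R) (t : R) :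
    t ∣ ∏ j ∈ J, (a j + b j * t) - ∏ j ∈ J, a j := by
  classical
  induction J using Finset.induction_on with
  | empty => simp
  | insert j J hj ih =>
    obtain ⟨r, hr⟩ := ih
    rw [Finset.prod_insert hj, Finset.prod_insert hj, eq_add_of_sub_eq hr]
    exact ⟨a j * r + b j * (t * r + ∏ j ∈ J, a j), by ring⟩

theorem exists_of_coeff_prod_conjSqX_ne_zero {k C : ℕ} (J : Finset (Fin k)) {g : ℕ}
    (h : (∏ j ∈ J, conjSqX C j).coeff g ≠ 0) : ∃ c : Fin k → ℕ, ∑ j ∈ J, (2 ^ c j - 1) = g := by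
  induction J using Finset.induction_on generalizing g with
  | empty =>
    refine ⟨fun _ => 0, ?_⟩
    by_contra hg
    exact h (by rw [Finset.prod_empty, Polynomial.coeff_one, if_neg (by simpa using Ne.symm hg)])
  | insert j J hj ih =>
    rw [Finset.prod_insert hj, Polynomial.coeff_mul] at h
    obtain ⟨⟨m, n⟩, hmn, hne⟩ := Finset.exists_ne_zero_of_sum_ne_zero h
    obtain ⟨c, hc⟩ := ih (right_ne_zero_of_mul hne)
    have hm := left_ne_zero_of_mul hne
    rw [conjSqX, Polynomial.finsetSum_coeff] at hm
    obtain ⟨e, -, he⟩ := Finset.exists_ne_zero_of_sum_ne_zero hm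
    rw [Polynomial.coeff_C_mul, Polynomial.coeff_X_pow] at he
    have hme : m = 2 ^ e - 1 := by
      by_contra h'
      simp [h'] at he
    refine ⟨Function.update c j e, ?_⟩
    rw [Finset.sum_insert hj, Function.update_self, ← hme, ← Finset.HasAntidiagonal.mem_antidiagonal.1 hmn,
      ← hc]
    congr 1
    refine Finset.sum_congr rfl fun i hi => ?_
    rw [Function.update_of_ne (by rintro rfl; exact hj hi)]

/-- Hit criterion from the `χ`-trick: `x_J w²` is hit unless `deg w` is a sum of `|J|` numbers of
the form `2^c - 1`. -/
theorem mon_mul_sq_mem_hit {k g : ℕ} (J : Finset (Fin k)) {w : P k} (hw : w.IsHomogeneous g)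
    (hg : ∀ c : Fin k → ℕ, ∑ j ∈ J, (2 ^ c j - 1) ≠ g) : mon J * w ^ 2 ∈ hit k := by
  -- Modulo $T^{2^{g+1}-1}$, a power beyond $T^g$, the total square of $\chi$ is $x_J$. So the
  -- coefficient of $T^g$ in the total square of $\chi w$ is $x_JSq^g(w)=x_Jw^2$, whereas modulo
  -- hits it equals that of $\chi w$, which is zero.
  set χ : Polynomial (P k) := ∏ j ∈ J, conjSqX (g + 1) j
  have hχ : χ.coeff g = 0 := by
    by_contra h
    obtain ⟨c, hc⟩ := exists_of_coeff_prod_conjSqX_ne_zero J h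
    exact hg c hc
  have h1 := coeff_totalSqExt_sub_mem_hit g (χ * Polynomial.C w)
  rw [Polynomial.coeff_mul_C, hχ, zero_mul, sub_zero, map_mul] at h1
  have h2 : totalSqExt k (Polynomial.C w) = totalSq k w := by simp [totalSqExt]
  obtain ⟨r, hr⟩ := X_pow_dvd_prod_add_sub J (fun j => Polynomial.C (X j : P k))
    (fun j => Polynomial.C (X j ^ 2 ^ (g + 1))) (Polynomial.X ^ (2 ^ (g + 1) - 1))
  have h3 : totalSqExt k χ = Polynomial.C (mon J) + Polynomial.X ^ (2 ^ (g + 1) - 1) * r := by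
    rw [map_prod]
    simp only [totalSqExt_conjSqX]
    rw [eq_add_of_sub_eq' hr, mon, map_prod]
  rw [h2, h3, add_mul, Polynomial.coeff_add, Polynomial.coeff_C_mul, ← Sq_apply, Sq_top hw,
    mul_assoc, Polynomial.coeff_X_pow_mul', if_neg, add_zero] at h1
  · exact h1
  · have := Nat.lt_two_pow_self (n := g + 1)
    omega

/-! ### Binary digit counts and the arithmetic of the degrees -/

/-- The number of binary digits `1`. -/
def popCount (n : ℕ) : ℕ := n.bitIndices.length

theorem popCount_two_mul (n : ℕ) : popCount (2 * n) = popCount n := by simp [popCount]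

theorem popCount_two_mul_add_one (n : ℕ) : popCount (2 * n + 1) = popCount n + 1 := by
  simp [popCount]

theorem popCount_add_le (a b : ℕ) : popCount (a + b) ≤ popCount a + popCount b := by
  induction h : a + b using Nat.strong_induction_on generalizing a b with
  | _ n ih =>
    subst h
    rcases Nat.eq_zero_or_pos a with rfl | ha
    · simp [popCount]
    rcases Nat.eq_zero_or_pos b with rfl | hb
    · simp [popCount]
    obtain ⟨a', rfl | rfl⟩ := Nat.even_or_odd' a <;> obtain ⟨b', rfl | rfl⟩ := Nat.even_or_odd' b
    · rw [← mul_add, popCount_two_mul, popCount_two_mul, popCount_two_mul]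
      exact ih _ (by omega) _ _ rfl
    · rw [← add_assoc, ← mul_add, popCount_two_mul, popCount_two_mul_add_one,
        popCount_two_mul_add_one]
      have := ih (a' + b') (by omega) _ _ rfl
      omega
    · rw [show 2 * a' + 1 + 2 * b' = 2 * (a' + b') + 1 by ring, popCount_two_mul,
        popCount_two_mul_add_one, popCount_two_mul_add_one]
      have := ih (a' + b') (by omega) _ _ rfl
      omega
    · rw [show 2 * a' + 1 + (2 * b' + 1) = 2 * (a' + b' + 1) by ring, popCount_two_mul,
        popCount_two_mul_add_one, popCount_two_mul_add_one]
      have h1 := ih (a' + b' + 1) (by omega) (a' + b') 1 rfl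
      have h2 := ih (a' + b') (by omega) _ _ rfl
      have h3 : popCount 1 = 1 := by simp [popCount]
      omega

theorem popCount_le (n : ℕ) : popCount n ≤ n := by
  induction n with
  | zero => simp [popCount]
  | succ n ih =>
    have := popCount_add_le n 1
    have h3 : popCount 1 = 1 := by simp [popCount]
    omega

theorem popCount_sum_le {ι : Type*} (J : Finset ι) (c : ι → ℕ) :
    popCount (∑ j ∈ J, 2 ^ c j) ≤ J.card := by
  classical
  induction J using Finset.induction_on with
  | empty => simp [popCount]
  | insert j J hj ih =>
    rw [Finset.sum_insert hj, Finset.card_insert_of_notMem hj]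
    have := popCount_add_le (2 ^ c j) (∑ j ∈ J, 2 ^ c j)
    have h1 : popCount (2 ^ c j) = 1 := by simp [popCount]
    omega

theorem popCount_sum_eq (s : Finset ℕ) : popCount (∑ i ∈ s, 2 ^ i) = s.card := by
  have h := Finset.toFinset_bitIndices_sum_two_pow s
  rw [popCount, ← List.toFinset_card_of_nodup Nat.bitIndices_nodup, h]

/-- Compare numbers of binary ones. If $c<2^D$, then $\sum_s2^i+(2^D-c)$ has disjoint digits, hence
more than $|s|\ge|J|$ ones. If $c\ge2^D$, then $\sum_s2^i=\sum_J2^{e_j}+(c-2^D)$ would have at most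
$|J|+c-2^D=|s|+1-2^D<|s|$ ones. -/
theorem sum_two_pow_ne {ι : Type*} {s : Finset ℕ} {D c : ℕ} (hD : 1 ≤ D) (hs : ∀ i ∈ s, D ≤ i)
    (J : Finset ι) (e : ι → ℕ) (hc : 1 ≤ c) (hcard : J.card + c = s.card + 1) :
    ∑ i ∈ s, 2 ^ i + 2 ^ D ≠ ∑ j ∈ J, 2 ^ e j + c := by
  intro h
  have h2 : 2 ≤ 2 ^ D := le_self_pow₀ (by norm_num) (by omega)
  have hJ := popCount_sum_le J e
  rcases lt_or_ge c (2 ^ D) with hlt | hge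
  · set r := 2 ^ D - c
    have hr : ∑ i ∈ r.bitIndices.toFinset, 2 ^ i = r := Finset.sum_toFinset_bitIndices_two_pow r
    have hdisj : Disjoint s r.bitIndices.toFinset := by
      rw [Finset.disjoint_left]
      intro i hi hi'
      have h1 := Nat.two_pow_le_of_mem_bitIndices (List.mem_toFinset.1 hi')
      have h3 : 2 ^ D ≤ 2 ^ i := Nat.pow_le_pow_right two_pos (hs i hi)
      omega
    have h4 : ∑ j ∈ J, 2 ^ e j = ∑ i ∈ s ∪ r.bitIndices.toFinset, 2 ^ i := by
      rw [Finset.sum_union hdisj, hr]; omega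
    rw [h4, popCount_sum_eq, Finset.card_union_of_disjoint hdisj] at hJ
    have h5 : r.bitIndices.toFinset.card ≠ 0 := by
      intro h0
      rw [Finset.card_eq_zero] at h0
      rw [h0, Finset.sum_empty] at hr
      omega
    omega
  · have h3 : ∑ i ∈ s, 2 ^ i = ∑ j ∈ J, 2 ^ e j + (c - 2 ^ D) := by omega
    have h4 := popCount_sum_eq s
    have h5 := popCount_add_le (∑ j ∈ J, 2 ^ e j) (c - 2 ^ D)
    have h6 := popCount_le (c - 2 ^ D)
    rw [← h3] at h5
    omega

/-- The hypothesis on the degrees `N 0, N 1, …` under which the hit problem is compared in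
consecutive degrees: `N (e + 1) = 2 N e + l`, and in degree `N (e + 1)` every monomial with fewer
than `l` odd exponents is hit. -/
structure DegreeSeq (l : ℕ) (N : ℕ → ℕ) : Prop where
  succ : ∀ e, N (e + 1) = 2 * N e + l
  low : ∀ {k e g : ℕ} (J : Finset (Fin k)) {w : P k}, w.IsHomogeneous g → J.card < l →
    J.card + 2 * g = N (e + 1) → mon J * w ^ 2 ∈ hit k

/-- If the χ-criterion failed, $N_{e+1}+|J|$ would be a sum of $|J|$ powers of 2. The exponents
$d_1,\dots,d_{l-1}$ are distinct, and the remaining one gives the summand $2^{e+1}$, so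
`sum_two_pow_ne` applies with $c=l-|J|$. -/
theorem degreeSeq_of_exponents {l : ℕ} (hl : 3 ≤ l) {d : ℕ → ℕ}
    (hdec : ∀ i, 1 ≤ i → i + 1 ≤ l - 1 → d (i + 1) < d i) (hlast : d l ≤ d (l - 1)) :
    DegreeSeq l (fun e => ∑ i ∈ Finset.Icc 1 l, (2 ^ (d i - d l + e) - 1)) := by
  have hstrict : ∀ i j, 1 ≤ i → i < j → j ≤ l - 1 → d j < d i := by
    intro i j hi hij
    induction j, hij using Nat.le_induction with
    | base => intro h; exact hdec i hi h
    | succ j hj ih =>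
      intro h
      exact (hdec j (by omega) h).trans (ih (by omega))
  have hge : ∀ i, 1 ≤ i → i ≤ l - 1 → d l ≤ d i := by
    intro i hi hil
    rcases hil.lt_or_eq with h | h
    · exact hlast.trans (hstrict i _ hi h le_rfl).le
    · rw [h]; exact hlast
  refine ⟨fun e => ?_, ?_⟩
  · have : ∀ i ∈ Finset.Icc 1 l, 2 ^ (d i - d l + (e + 1)) - 1 =
        2 * (2 ^ (d i - d l + e) - 1) + 1 := by
      intro i _
      have := Nat.one_le_two_pow (n := d i - d l + e)
      rw [← add_assoc, pow_succ]; omega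
    rw [Finset.sum_congr rfl this, Finset.sum_add_distrib, ← Finset.mul_sum]
    simp
  · intro k e g J w hw hJ hdeg
    refine mon_mul_sq_mem_hit J hw fun c hc => ?_
    have h1 : ∑ i ∈ Finset.Icc 1 l, (2 ^ (d i - d l + (e + 1)) - 1) + l =
        ∑ i ∈ Finset.Icc 1 l, 2 ^ (d i - d l + (e + 1)) := by
      have : l = ∑ i ∈ Finset.Icc 1 l, 1 := by simp
      conv_lhs => rw [add_comm]; arg 1; rw [this]
      rw [← Finset.sum_add_distrib]
      refine Finset.sum_congr rfl fun i _ => ?_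
      have := Nat.one_le_two_pow (n := d i - d l + (e + 1))
      omega
    have h2 : Finset.Icc 1 l = insert l (Finset.Icc 1 (l - 1)) := by
      ext i; simp only [Finset.mem_Icc, Finset.mem_insert]; omega
    have h1' : ∑ i ∈ Finset.Icc 1 l, 2 ^ (d i - d l + (e + 1)) =
        2 ^ (e + 1) + ∑ i ∈ Finset.Icc 1 (l - 1), 2 ^ (d i - d l + (e + 1)) := by
      rw [h2, Finset.sum_insert (by simp; omega), Nat.sub_self, zero_add]
    have hinj : Set.InjOn (fun i => d i - d l + (e + 1)) (Finset.Icc 1 (l - 1) : Finset ℕ) := by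
      intro i hi j hj hij
      rw [Finset.mem_coe, Finset.mem_Icc] at hi hj
      have hi' := hge i hi.1 hi.2
      have hj' := hge j hj.1 hj.2
      simp only at hij
      rcases lt_trichotomy i j with h | h | h
      · have := hstrict i j hi.1 h hj.2; omega
      · exact h
      · have := hstrict j i hj.1 h hi.2; omega
    have h3 : ∑ i ∈ (Finset.Icc 1 (l - 1)).image (fun i => d i - d l + (e + 1)), 2 ^ i =
        ∑ i ∈ Finset.Icc 1 (l - 1), 2 ^ (d i - d l + (e + 1)) := Finset.sum_image hinj
    have hcard : ((Finset.Icc 1 (l - 1)).image (fun i => d i - d l + (e + 1))).card = l - 1 := by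
      rw [Finset.card_image_of_injOn hinj]; simp
    have h4 : ∑ j ∈ J, 2 ^ (c j + 1) = 2 * g + 2 * J.card := by
      rw [← hc, mul_comm 2 J.card, ← smul_eq_mul J.card, ← Finset.sum_const, Finset.mul_sum,
        ← Finset.sum_add_distrib]
      refine Finset.sum_congr rfl fun j _ => ?_
      have := Nat.one_le_two_pow (n := c j)
      rw [pow_succ]; omega
    refine sum_two_pow_ne (s := (Finset.Icc 1 (l - 1)).image (fun i => d i - d l + (e + 1)))
      (D := e + 1) (c := l - J.card) (by omega) ?_ J (fun j => c j + 1) (by omega)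
      (by rw [hcard]; omega) ?_
    · intro i hi
      obtain ⟨i', -, rfl⟩ := Finset.mem_image.1 hi
      omega
    · rw [h3, h4]; omega

/-! ### The operations $w\mapsto x_Jw^2$ and words in them -/

/-- The class of a polynomial modulo the hit polynomials. -/
noncomputable abbrev mk (k : ℕ) : P k →ₗ[ZMod 2] P k ⧸ hit k := (hit k).mkQ

theorem mk_eq_zero {k : ℕ} {w : P k} : mk k w = 0 ↔ w ∈ hit k := by
  rw [mk, Submodule.mkQ_apply, Submodule.Quotient.mk_eq_zero]

theorem mk_eq_mk {k : ℕ} {v w : P k} : mk k v = mk k w ↔ v - w ∈ hit k := by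
  rw [mk, Submodule.mkQ_apply, Submodule.mkQ_apply, Submodule.Quotient.eq]

/-- The map `w ↦ x_J w²`. -/
noncomputable def kap {k : ℕ} (J : Finset (Fin k)) : P k →ₗ[ZMod 2] P k :=
  (LinearMap.mulLeft (ZMod 2) (mon J)).comp (sqLin k)

theorem kap_apply {k : ℕ} (J : Finset (Fin k)) (w : P k) : kap J w = mon J * w ^ 2 := rfl

theorem kap_isHomogeneous {k g : ℕ} (J : Finset (Fin k)) {w : P k} (hw : w.IsHomogeneous g) :
    (kap J w).IsHomogeneous (J.card + g * 2) :=
  (mon_isHomogeneous J).mul (hw.pow 2)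

variable {l : ℕ} {N : ℕ → ℕ}

/-- In $Sq^{2i}(x_Ja^2)$ the term $C=\emptyset$ is $x_J(Sq^ia)^2$; all others have fewer than $l$
odd exponents and are hit by the degree condition. -/
theorem kap_mem_hit (hN : DegreeSeq l N) {k e : ℕ} {J : Finset (Fin k)} (hJ : J.card = l)
    {w : P k} (hw : w ∈ hit k) (hd : w.IsHomogeneous (N e)) : kap J w ∈ hit k := by
  refine mem_of_hit (V := (hit k).comap (kap J)) (fun i a hi ha => ?_) hw hd
  rw [Submodule.mem_comap]
  have h := Sq_mon_mul_sq (2 * i) J (monomial a 1)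
  have h0 : ∅ ∈ ({C ∈ J.powerset | C.card ≤ 2 * i ∧ Even (2 * i - C.card)}) := by simp
  rw [← Finset.add_sum_erase _ _ h0] at h
  have h1 : mon (J \ ∅) * (mon ∅ * Sq k ((2 * i - (∅ : Finset (Fin k)).card) / 2) (monomial a 1)) ^ 2
      = kap J (Sq k i (monomial a 1)) := by
    simp [kap_apply, mon]
  rw [h1] at h
  rw [← sub_eq_iff_eq_add] at h
  rw [← h]
  refine sub_mem (Sq_mem_hit (by omega) _) (Submodule.sum_mem _ fun C hC => ?_)
  simp only [Finset.mem_erase, Finset.mem_filter, Finset.mem_powerset] at hC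
  obtain ⟨hC0, hCJ, hCi, hev⟩ := hC
  have hpos := Finset.card_pos.2 (Finset.nonempty_iff_ne_empty.2 hC0)
  have hcard := Finset.card_sdiff_add_card_eq_card hCJ
  refine hN.low (e := e) (J \ C) ((mon_isHomogeneous C).mul (Sq_isHomogeneous _
    (isHomogeneous_monomial _ rfl))) (by omega) ?_
  rw [hN.succ]
  obtain ⟨m, hm⟩ := hev
  omega

theorem kap_congr (hN : DegreeSeq l N) {k e : ℕ} {J : Finset (Fin k)} (hJ : J.card = l)
    {v w : P k} (h : mk k v = mk k w) (hv : v.IsHomogeneous (N e)) (hw : w.IsHomogeneous (N e)) :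
    mk k (kap J v) = mk k (kap J w) := by
  rw [mk_eq_mk] at h ⊢
  rw [← map_sub]
  exact kap_mem_hit hN hJ h (hv.sub hw)

theorem kap_isHomogeneous_succ (hN : DegreeSeq l N) {k e : ℕ} {J : Finset (Fin k)}
    (hJ : J.card = l) {w : P k} (hw : w.IsHomogeneous (N e)) :
    (kap J w).IsHomogeneous (N (e + 1)) := by
  have := kap_isHomogeneous J hw
  rwa [hJ, add_comm, mul_comm, ← hN.succ] at this

/-- The operation `w ↦ x_1 ⋯ x̂_z ⋯ x_k w²`. -/
noncomputable abbrev kapE (z : Fin (l + 1)) : P (l + 1) →ₗ[ZMod 2] P (l + 1) :=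
  kap (Finset.univ.erase z)

theorem card_univ_erase (z : Fin (l + 1)) : (Finset.univ.erase z).card = l := by simp

/-- The composition of the operations `kapE z` along a word. -/
noncomputable def op : List (Fin (l + 1)) → (P (l + 1) →ₗ[ZMod 2] P (l + 1))
  | [] => LinearMap.id
  | z :: L => (kapE z).comp (op L)

@[simp] theorem op_nil (w : P (l + 1)) : op [] w = w := rfl

@[simp] theorem op_cons (z : Fin (l + 1)) (L : List (Fin (l + 1))) (w : P (l + 1)) :
    op (z :: L) w = kapE z (op L w) := rfl

theorem op_append (L L' : List (Fin (l + 1))) (w : P (l + 1)) :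
    op (L ++ L') w = op L (op L' w) := by
  induction L with
  | nil => rfl
  | cons z L ih => rw [List.cons_append, op_cons, op_cons, ih]

theorem op_isHomogeneous (hN : DegreeSeq l N) {e : ℕ} (L : List (Fin (l + 1))) {w : P (l + 1)}
    (hw : w.IsHomogeneous (N e)) : (op L w).IsHomogeneous (N (e + L.length)) := by
  induction L with
  | nil => exact hw
  | cons z L ih =>
    rw [op_cons, List.length_cons, ← add_assoc]
    exact kap_isHomogeneous_succ hN (card_univ_erase z) ih

theorem op_mem_hit (hN : DegreeSeq l N) {e : ℕ} (L : List (Fin (l + 1))) {w : P (l + 1)}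
    (h : w ∈ hit (l + 1)) (hw : w.IsHomogeneous (N e)) : op L w ∈ hit (l + 1) := by
  induction L with
  | nil => exact h
  | cons z L ih =>
    rw [op_cons]
    exact kap_mem_hit hN (card_univ_erase z) ih (op_isHomogeneous hN L hw)

theorem X_mul_mon_erase {k : ℕ} {J : Finset (Fin k)} {j : Fin k} (hj : j ∈ J) :
    X j * mon (J.erase j) = mon J :=
  Finset.mul_prod_erase J (fun j => (X j : P k)) hj

theorem X_mul_mon_univ_mul_sq (j : Fin (l + 1)) (v : P (l + 1)) :
    X j * (mon Finset.univ * v ^ 2) = kapE j (X j * v) := by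
  rw [← X_mul_mon_erase (Finset.mem_univ j), kap_apply]; ring

/-- The sum is $Sq^1(x_1\cdots x_kw^2)$. -/
theorem sum_kapE_X_mul_mem_hit (w : P (l + 1)) : ∑ j, kapE j (X j * w) ∈ hit (l + 1) := by
  have h := Sq_mon_mul_sq 1 Finset.univ w
  have h1 : ({C ∈ (Finset.univ : Finset (Fin (l + 1))).powerset |
      C.card ≤ 1 ∧ Even (1 - C.card)}) = Finset.powersetCard 1 Finset.univ := by
    ext C
    simp only [Finset.mem_filter, Finset.mem_powerset, Finset.mem_powersetCard]
    refine and_congr_right fun _ => ⟨fun ⟨h1, h2⟩ => ?_, fun h => by simp [h]⟩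
    interval_cases h : C.card
    · simp at h2
    · rfl
  rw [h1, Finset.powersetCard_one, Finset.sum_map] at h
  have h2 : ∑ j, kapE j (X j * w) = Sq (l + 1) 1 (mon Finset.univ * w ^ 2) := by
    rw [h]
    refine Finset.sum_congr rfl fun j _ => ?_
    simp [mon, kap_apply, Sq_zero, Finset.sdiff_singleton_eq_erase]
  rw [h2]
  exact Sq_mem_hit one_pos _

/-- The operation `kapE j` sends $x_jv$ to $x_j\cdot(x_1\cdots x_kv^2)$, and the cofactor does not
depend on $j$; iterating reduces to words of length one. -/
theorem sum_op_replicate_mem_hit (c : ℕ) (w : P (l + 1)) :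
    ∑ j, op (List.replicate (c + 1) j) (X j * w) ∈ hit (l + 1) := by
  have h : ∃ v, ∀ j, X j * v = op (List.replicate c j) (X j * w) := by
    induction c with
    | zero => exact ⟨w, fun j => rfl⟩
    | succ c ih =>
      obtain ⟨v, hv⟩ := ih
      refine ⟨mon Finset.univ * v ^ 2, fun j => ?_⟩
      rw [X_mul_mon_univ_mul_sq, hv, List.replicate_succ, op_cons]
  obtain ⟨v, hv⟩ := h
  have := sum_kapE_X_mul_mem_hit v
  simpa only [hv, List.replicate_succ, op_cons] using this

/-- Take $v=\prod_{j\ne p,q}x_j\cdot w^2$. Multiplying by a third variable leaves only $l-2$ odd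
exponents, so in the relations above only the terms $p$ and $q$ survive. -/
theorem exists_two_missing (hN : DegreeSeq l N) (hl : 2 ≤ l) {e : ℕ} {p q : Fin (l + 1)}
    (hpq : p ≠ q) {w : P (l + 1)} (hw : w.IsHomogeneous (N e)) :
    ∃ v : P (l + 1), X p * v = kapE q w ∧ X q * v = kapE p w ∧ ∀ j, j ≠ p → j ≠ q →
      X j * v ∈ hit (l + 1) ∧ (X j * v).IsHomogeneous (N (e + 1)) := by
  have hp : p ∈ (Finset.univ.erase q : Finset (Fin (l + 1))) := by simp [hpq]
  have hq : q ∈ (Finset.univ.erase p : Finset (Fin (l + 1))) := by simp [hpq.symm]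
  refine ⟨mon ((Finset.univ.erase q).erase p) * w ^ 2, ?_, ?_, fun j hjp hjq => ?_⟩
  · rw [← mul_assoc, X_mul_mon_erase hp, kap_apply]
  · rw [Finset.erase_right_comm, ← mul_assoc, X_mul_mon_erase hq, kap_apply]
  · have hj : j ∈ (Finset.univ.erase q).erase p := by simp [hjp, hjq]
    have hX : X j * (mon ((Finset.univ.erase q).erase p) * w ^ 2) =
        mon (((Finset.univ.erase q).erase p).erase j) * (X j * w) ^ 2 := by
      rw [← X_mul_mon_erase hj]; ring
    have hdeg : (X j * w : P (l + 1)).IsHomogeneous (1 + N e) := (isHomogeneous_X _ j).mul hw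
    have hcard : (((Finset.univ.erase q).erase p).erase j).card = l - 2 := by
      rw [Finset.card_erase_of_mem hj, Finset.card_erase_of_mem hp, card_univ_erase]; omega
    rw [hX]
    constructor
    · exact hN.low (e := e) _ hdeg (by omega) (by rw [hcard, hN.succ]; omega)
    · have := kap_isHomogeneous (((Finset.univ.erase q).erase p).erase j) hdeg
      rwa [hcard, show l - 2 + (1 + N e) * 2 = N (e + 1) by rw [hN.succ]; omega] at this

theorem sum_eq_two {M : Type*} [AddCommMonoid M] {p q : Fin (l + 1)} (hpq : p ≠ q)
    (F : Fin (l + 1) → M) (h : ∀ j, j ≠ p → j ≠ q → F j = 0) : ∑ j, F j = F p + F q := by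
  rw [← Finset.sum_pair hpq]
  symm
  refine Finset.sum_subset (Finset.subset_univ _) fun j _ hj => ?_
  simp only [Finset.mem_insert, Finset.mem_singleton, not_or] at hj
  exact h j hj.1 hj.2

theorem ZModModule_eq_of_add_eq_zero {M : Type*} [AddCommGroup M] [Module (ZMod 2) M] {a b : M}
    (h : a + b = 0) : a = b := by
  have h2 : b + b = 0 := by
    rw [← two_smul (ZMod 2) b, show (2 : ZMod 2) = 0 from rfl, zero_smul]
  rw [eq_neg_of_add_eq_zero_left h, ← eq_neg_of_add_eq_zero_left h2]

/-- This is the relation for words of length one at the $v$ of `exists_two_missing`. -/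
theorem kapE_swap (hN : DegreeSeq l N) (hl : 2 ≤ l) {e : ℕ} (p q : Fin (l + 1)) {w : P (l + 1)}
    (hw : w.IsHomogeneous (N e)) : mk _ (kapE p (kapE q w)) = mk _ (kapE q (kapE p w)) := by
  rcases eq_or_ne p q with rfl | hpq
  · rfl
  obtain ⟨v, hp, hq, hj⟩ := exists_two_missing hN hl hpq hw
  have h := mk_eq_zero.2 (sum_kapE_X_mul_mem_hit v)
  rw [map_sum, sum_eq_two hpq, hp, hq] at h
  · exact ZModModule_eq_of_add_eq_zero h
  · intro j hjp hjq
    exact mk_eq_zero.2 (kap_mem_hit hN (card_univ_erase j) (hj j hjp hjq).1 (hj j hjp hjq).2)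

/-- This is the relation for words $jj$ at the same $v$. -/
theorem kapE_replace (hN : DegreeSeq l N) (hl : 2 ≤ l) {e : ℕ} (p q : Fin (l + 1)) {w : P (l + 1)}
    (hw : w.IsHomogeneous (N e)) :
    mk _ (kapE p (kapE p (kapE q w))) = mk _ (kapE q (kapE q (kapE p w))) := by
  rcases eq_or_ne p q with rfl | hpq
  · rfl
  obtain ⟨v, hp, hq, hj⟩ := exists_two_missing hN hl hpq hw
  have h := mk_eq_zero.2 (sum_op_replicate_mem_hit 1 v)
  rw [map_sum, sum_eq_two hpq, hp, hq] at h
  · exact ZModModule_eq_of_add_eq_zero h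
  · intro j hjp hjq
    exact mk_eq_zero.2 (op_mem_hit hN _ (hj j hjp hjq).1 (hj j hjp hjq).2)

theorem op_perm (hN : DegreeSeq l N) (hl : 2 ≤ l) {e : ℕ} {L L' : List (Fin (l + 1))}
    (h : L.Perm L') {w : P (l + 1)} (hw : w.IsHomogeneous (N e)) :
    mk _ (op L w) = mk _ (op L' w) := by
  induction h with
  | nil => rfl
  | @cons z L L' hL ih =>
    have h2 := op_isHomogeneous hN L' hw
    rw [← hL.length_eq] at h2
    rw [op_cons, op_cons]
    exact kap_congr hN (card_univ_erase z) ih (op_isHomogeneous hN L hw) h2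
  | swap p q L =>
    simp only [op_cons]
    exact kapE_swap hN hl q p (op_isHomogeneous hN L hw)
  | trans _ _ ih1 ih2 => exact ih1.trans ih2

/-- Permuting brings the words to the form $ppq\cdots$ and $qqp\cdots$, which `kapE_replace`
identifies. -/
theorem op_replace (hN : DegreeSeq l N) (hl : 2 ≤ l) {e : ℕ} {L : List (Fin (l + 1))}
    {p q : Fin (l + 1)} (hp : p ∈ L) (hq : q ∈ L) {w : P (l + 1)} (hw : w.IsHomogeneous (N e)) :
    mk _ (op (p :: L) w) = mk _ (op (q :: L) w) := by
  rcases eq_or_ne p q with rfl | hpq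
  · rfl
  have h1 : L.Perm (p :: q :: (L.erase p).erase q) :=
    (List.perm_cons_erase hp).trans
      ((List.perm_cons_erase ((List.mem_erase_of_ne hpq.symm).2 hq)).cons p)
  set M := (L.erase p).erase q
  have hM := op_isHomogeneous hN M hw
  rw [op_perm hN hl (h1.cons p) hw, op_perm hN hl ((h1.trans (List.Perm.swap q p M)).cons q) hw]
  simp only [op_cons]
  exact kapE_replace hN hl p q hM

theorem op_append_replace (hN : DegreeSeq l N) (hl : 2 ≤ l) {e : ℕ} {E D : List (Fin (l + 1))}
    {i : Fin (l + 1)} (hi : i ∈ D) (hE : ∀ z ∈ E, z ∈ D) {w : P (l + 1)}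
    (hw : w.IsHomogeneous (N e)) :
    mk _ (op (E ++ D) w) = mk _ (op (List.replicate E.length i ++ D) w) := by
  induction E with
  | nil => rfl
  | cons z E ih =>
    have ih := ih fun y hy => hE y (List.mem_cons_of_mem z hy)
    have h1 := op_isHomogeneous hN (E ++ D) hw
    have h2 := op_isHomogeneous hN (List.replicate E.length i ++ D) hw
    rw [List.length_append] at h1
    rw [List.length_append, List.length_replicate] at h2
    have h3 : mk _ (op (z :: (E ++ D)) w) =
        mk _ (op (z :: (List.replicate E.length i ++ D)) w) := by
      rw [op_cons, op_cons]
      exact kap_congr hN (card_univ_erase z) ih h1 h2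
    rw [List.cons_append, h3, List.length_cons, List.replicate_succ, List.cons_append]
    exact op_replace hN hl (List.mem_append_right _ (hE z List.mem_cons_self))
      (List.mem_append_right _ hi) hw

/-- The class of `op L w` depends only on the length and on the set of letters of the word. -/
theorem op_eq_of_toFinset (hN : DegreeSeq l N) (hl : 2 ≤ l) {e : ℕ} {L L' : List (Fin (l + 1))}
    (hlen : L.length = L'.length) (h : L.toFinset = L'.toFinset) {w : P (l + 1)}
    (hw : w.IsHomogeneous (N e)) : mk _ (op L w) = mk _ (op L' w) := by
  rcases L.eq_nil_or_concat' with rfl | ⟨_, i, rfl⟩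
  · rw [List.length_nil, eq_comm, List.length_eq_zero_iff] at hlen
    rw [hlen]
  generalize hL : _ ++ [i] = L at *
  have hiL : i ∈ L := by simp [← hL]
  -- Normal form of a word: every letter once, padded by copies of one fixed letter $i$.
  have key : ∀ M : List (Fin (l + 1)), M.toFinset = L.toFinset → mk _ (op M w) =
      mk _ (op (List.replicate (M.length - L.dedup.length) i ++ L.dedup) w) := by
    intro M hM
    obtain ⟨E, hE⟩ := (List.dedup_sublist M).exists_perm_append
    have hD : M.dedup.Perm L.dedup := by
      rw [List.perm_ext_iff_of_nodup (List.nodup_dedup M) (List.nodup_dedup L)]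
      intro a
      rw [List.mem_dedup, List.mem_dedup, ← List.mem_toFinset, hM, List.mem_toFinset]
    have h1 : M.Perm (E ++ L.dedup) :=
      hE.trans ((hD.append_right E).trans List.perm_append_comm)
    have h2 : E.length = M.length - L.dedup.length := by
      rw [h1.length_eq, List.length_append]; omega
    rw [op_perm hN hl h1 hw, ← h2]
    refine op_append_replace hN hl (List.mem_dedup.2 hiL) (fun z hz => ?_) hw
    rw [List.mem_dedup, ← List.mem_toFinset, ← hM, List.mem_toFinset]
    exact h1.mem_iff.2 (List.mem_append_left _ hz)
  rw [key L rfl, key L' h.symm, hlen]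

/-! ### Binary columns of exponent vectors -/

/-- The number of ones in the `b`-th binary column of an exponent vector. -/
def col {k : ℕ} (c : Fin k →₀ ℕ) (b : ℕ) : ℕ := ({j | (c j).testBit b} : Finset (Fin k)).card

/-- The exponents divided by two. -/
noncomputable def half {k : ℕ} (c : Fin k →₀ ℕ) : Fin k →₀ ℕ := c.mapRange (· / 2) rfl

theorem half_apply {k : ℕ} (c : Fin k →₀ ℕ) (j : Fin k) : half c j = c j / 2 := rfl

theorem col_succ {k : ℕ} (c : Fin k →₀ ℕ) (b : ℕ) : col c (b + 1) = col (half c) b := by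
  unfold col
  congr 1
  ext j
  rw [Finset.mem_filter, Finset.mem_filter, half_apply, Nat.testBit_succ]

theorem mon_eq_monomial {k : ℕ} (J : Finset (Fin k)) :
    mon J = monomial (∑ j ∈ J, Finsupp.single j 1) 1 := by
  rw [monomial_sum_one]; rfl

theorem add_two_half {k : ℕ} (c : Fin k →₀ ℕ) :
    (∑ j ∈ ({j | (c j).testBit 0} : Finset (Fin k)), Finsupp.single j 1) + 2 • half c = c := by
  ext j
  rw [Finsupp.add_apply, Finsupp.finsetSum_apply, Finsupp.smul_apply, half_apply]
  simp only [Finsupp.single_apply, Finset.sum_ite_eq', Finset.mem_filter, Finset.mem_univ,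
    true_and, Nat.testBit_zero, decide_eq_true_eq, smul_eq_mul]
  split_ifs <;> omega

theorem monomial_eq_kap {k : ℕ} (c : Fin k →₀ ℕ) :
    (monomial c 1 : P k) = kap ({j | (c j).testBit 0} : Finset (Fin k)) (monomial (half c) 1) := by
  rw [kap_apply, mon_eq_monomial, monomial_pow, monomial_mul, one_pow, one_mul, add_two_half]

theorem degree_eq_col_add {k : ℕ} (c : Fin k →₀ ℕ) :
    c.degree = col c 0 + 2 * (half c).degree := by
  conv_lhs => rw [← add_two_half c]
  simp [col]

theorem col_le {k : ℕ} (c : Fin k →₀ ℕ) (b : ℕ) : col c b ≤ k := by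
  exact (Finset.card_le_univ _).trans_eq (Fintype.card_fin k)

/-- In at most `l + 1` variables, a monomial of degree `N e` is hit if one of its first `e` binary
columns does not have exactly `l` ones. -/
theorem monomial_mem_hit_of_col (hN : DegreeSeq l N) {k : ℕ} (hk : k ≤ l + 1) {b e : ℕ}
    (hb : b < e) {c : Fin k →₀ ℕ} (hc : c.degree = N e) (hcol : col c b ≠ l) :
    monomial c 1 ∈ hit k := by
  obtain ⟨e, rfl⟩ : ∃ e', e = e' + 1 := ⟨e - 1, by omega⟩
  have h1 := degree_eq_col_add c
  have h2 := col_le c 0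
  rw [hc, hN.succ] at h1
  rw [monomial_eq_kap]
  have hlow : col c 0 < l → kap ({j | (c j).testBit 0} : Finset (Fin k)) (monomial (half c) 1) ∈
      hit k := fun h => hN.low (e := e) _ (isHomogeneous_monomial _ rfl) h (by
        rw [hN.succ, h1]; rfl)
  induction b generalizing c e with
  -- The column has at most $l+1$ ones and the parity of $l$, so being different from $l$ means
  -- being smaller.
  | zero => exact hlow (by omega)
  | succ b ih =>
    rcases lt_or_ge (col c 0) l with h | h
    · exact hlow h
    have h3 : (half c).degree = N e := by omega
    obtain ⟨e, rfl⟩ : ∃ e', e = e' + 1 := ⟨e - 1, by omega⟩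
    have h4 := degree_eq_col_add (half c)
    rw [h3, hN.succ] at h4
    refine kap_mem_hit hN (e := e + 1) (by change col c 0 = l; omega) ?_
      (isHomogeneous_monomial _ h3)
    rw [monomial_eq_kap]
    refine ih (by rwa [← col_succ]) e (by omega) h3 h4 (col_le _ _) fun h =>
      hN.low (e := e) _ (isHomogeneous_monomial _ rfl) h (by rw [hN.succ, h4]; rfl)

/-- The iterates of `w ↦ x_1 ⋯ x_l w²`. -/
noncomputable def kapU (l : ℕ) : ℕ → (P l →ₗ[ZMod 2] P l)
  | 0 => LinearMap.id
  | e + 1 => (kap Finset.univ).comp (kapU l e)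

@[simp] theorem kapU_zero (w : P l) : kapU l 0 w = w := rfl

theorem kapU_succ (e : ℕ) (w : P l) : kapU l (e + 1) w = kap Finset.univ (kapU l e w) := rfl

theorem kapU_isHomogeneous (hN : DegreeSeq l N) (e : ℕ) {w : P l} (hw : w.IsHomogeneous (N 0)) :
    (kapU l e w).IsHomogeneous (N e) := by
  induction e with
  | zero => exact hw
  | succ e ih =>
    rw [kapU_succ]
    exact kap_isHomogeneous_succ hN (by simp) ih

theorem col_ne_or_eq_kapU (hN : DegreeSeq l N) (e : ℕ) {c : Fin l →₀ ℕ} (hc : c.degree = N e) :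
    (∃ b < e, col c b ≠ l) ∨ ∃ c' : Fin l →₀ ℕ, c'.degree = N 0 ∧
      (∀ j, c j = 2 ^ e * c' j + (2 ^ e - 1)) ∧ (monomial c 1 : P l) = kapU l e (monomial c' 1) := by
  induction e generalizing c with
  | zero => exact Or.inr ⟨c, hc, by simp, rfl⟩
  | succ e ih =>
    by_cases h0 : col c 0 = l
    · have h1 := degree_eq_col_add c
      rw [hc, hN.succ, h0] at h1
      have huniv : ({j | (c j).testBit 0} : Finset (Fin l)) = Finset.univ := by
        rw [← Finset.card_eq_iff_eq_univ, Fintype.card_fin]; exact h0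
      rcases ih (c := half c) (by omega) with ⟨b, hb, h⟩ | ⟨c', hc', hj, h⟩
      · exact Or.inl ⟨b + 1, by omega, by rwa [col_succ]⟩
      · refine Or.inr ⟨c', hc', fun j => ?_, ?_⟩
        · have h2 : j ∈ ({j | (c j).testBit 0} : Finset (Fin l)) := by rw [huniv]; simp
          simp only [Finset.mem_filter, Finset.mem_univ, true_and, Nat.testBit_zero,
            decide_eq_true_eq] at h2
          have h3 := hj j
          rw [half_apply] at h3
          have := Nat.one_le_two_pow (n := e)
          rw [pow_succ]
          have : 2 ^ e * 2 * c' j = 2 * (2 ^ e * c' j) := by ring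
          omega
        · rw [monomial_eq_kap, huniv, h, kapU_succ]
    · exact Or.inl ⟨0, by omega, h0⟩

/-- A column with $l$ ones among $l+1$ variables misses one variable, which becomes the letter of
the word in that position. -/
theorem col_ne_or_eq_op (hN : DegreeSeq l N) (e : ℕ) {c : Fin (l + 1) →₀ ℕ}
    (hc : c.degree = N e) :
    (∃ b < e, col c b ≠ l) ∨ ∃ (L : List (Fin (l + 1))) (c' : Fin (l + 1) →₀ ℕ),
      L.length = e ∧ c'.degree = N 0 ∧ (monomial c 1 : P (l + 1)) = op L (monomial c' 1) := by
  induction e generalizing c with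
  | zero => exact Or.inr ⟨[], c, rfl, hc, rfl⟩
  | succ e ih =>
    by_cases h0 : col c 0 = l
    · have h1 := degree_eq_col_add c
      rw [hc, hN.succ, h0] at h1
      have h2 : ({j | (c j).testBit 0} : Finset (Fin (l + 1)))ᶜ.card = 1 := by
        rw [Finset.card_compl, Fintype.card_fin]
        change l + 1 - col c 0 = 1
        omega
      obtain ⟨z, hz⟩ := Finset.card_eq_one.1 h2
      have hJ : ({j | (c j).testBit 0} : Finset (Fin (l + 1))) = Finset.univ.erase z := by
        rw [← compl_compl ({j | (c j).testBit 0} : Finset (Fin (l + 1))), hz,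
          Finset.compl_singleton]
      rcases ih (c := half c) (by omega) with ⟨b, hb, h⟩ | ⟨L, c', hL, hc', h⟩
      · exact Or.inl ⟨b + 1, by omega, by rwa [col_succ]⟩
      · refine Or.inr ⟨z :: L, c', by simp [hL], hc', ?_⟩
        rw [monomial_eq_kap, hJ, h, op_cons]
    · exact Or.inl ⟨0, by omega, h0⟩

/-! ### The substitutions `proj` and their effect on words -/

/-- The set of entries of `i` and `I`. -/
def Idx.supp {k : ℕ} (p : Idx k) : Finset (Fin k) := insert p.i p.I

/-- The substitution `x_i ↦ ∑_{s ∈ I} x_{s - 1}` which is left inverse to `f_i`. -/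
noncomputable def proj (p : Idx (l + 1)) : P (l + 1) →ₐ[ZMod 2] P l :=
  aeval (Fin.insertNth (α := fun _ => P l) p.i
    (∑ s ∈ ({s | p.i.succAbove s ∈ p.I} : Finset (Fin l)), X s) fun s => X s)

theorem proj_X_self (p : Idx (l + 1)) :
    proj p (X p.i) = ∑ s ∈ ({s | p.i.succAbove s ∈ p.I} : Finset (Fin l)), X s := by
  rw [proj, aeval_X, Fin.insertNth_apply_same]

theorem proj_X_succAbove (p : Idx (l + 1)) (s : Fin l) : proj p (X (p.i.succAbove s)) = X s := by
  rw [proj, aeval_X, Fin.insertNth_apply_succAbove]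

theorem proj_linear (p : Idx (l + 1)) (j : Fin (l + 1)) :
    ∃ A : Finset (Fin l), proj p (X j) = ∑ s ∈ A, X s := by
  rcases Fin.eq_self_or_eq_succAbove p.i j with rfl | ⟨s, rfl⟩
  · exact ⟨_, proj_X_self p⟩
  · exact ⟨{s}, by rw [proj_X_succAbove, Finset.sum_singleton]⟩

theorem f_X (i : Fin (l + 1)) (s : Fin l) : f i (X s) = X (i.succAbove s) := rename_X _ _

theorem f_linear (i : Fin (l + 1)) (s : Fin l) :
    ∃ A : Finset (Fin (l + 1)), f i (X s) = ∑ s ∈ A, X s :=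
  ⟨{i.succAbove s}, by rw [f_X, Finset.sum_singleton]⟩

theorem proj_f (p : Idx (l + 1)) (y : P l) : proj p (f p.i y) = y := by
  have : (proj p).comp (f p.i) = AlgHom.id _ _ := by
    ext1 s
    rw [AlgHom.comp_apply, f_X, proj_X_succAbove, AlgHom.id_apply]
  exact DFunLike.congr_fun this y

theorem f_mon (i : Fin (l + 1)) (J : Finset (Fin l)) :
    f i (mon J) = mon (J.map i.succAboveEmb) := by
  rw [mon, mon, map_prod, Finset.prod_map]
  exact Finset.prod_congr rfl fun s _ => f_X i s

theorem f_mon_univ (i : Fin (l + 1)) : f i (mon Finset.univ) = mon (Finset.univ.erase i) := by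
  rw [f_mon]
  congr 1
  ext j
  simp [Fin.exists_succAbove_eq_iff]

/-- For $z=i$ the product of the other variables maps to $x_1\cdots x_l$. Otherwise $x_i$ divides it
and becomes $\sum_{t\in I}x_{t-1}$: the summand $t=z$ restores the missing variable, and every other
one repeats a variable, leaving $l-2$ odd exponents and thus a hit. -/
theorem mk_proj_kapE (hN : DegreeSeq l N) (hl : 2 ≤ l) {e : ℕ} (p : Idx (l + 1)) (z : Fin (l + 1))
    {w : P (l + 1)} (hw : w.IsHomogeneous (N e)) :
    mk l (proj p (kapE z w)) =
      if z ∈ p.supp then mk l (kap Finset.univ (proj p w)) else 0 := by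
  have hu := isHomogeneous_of_linear (proj p) (proj_linear p) hw
  rw [kap_apply, map_mul, map_pow, kap_apply]
  generalize proj p w = u at *
  rcases Fin.eq_self_or_eq_succAbove p.i z with rfl | ⟨s, rfl⟩
  · rw [← f_mon_univ, proj_f, if_pos (show p.i ∈ p.supp from Finset.mem_insert_self p.i p.I)]
  · have h1 : mon (Finset.univ.erase (p.i.succAbove s)) =
        X p.i * f p.i (mon (Finset.univ.erase s)) := by
      have hi : p.i ∈ (Finset.univ.erase (p.i.succAbove s)) := by
        simp
      rw [f_mon, ← X_mul_mon_erase hi]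
      congr 2
      ext j
      rcases Fin.eq_self_or_eq_succAbove p.i j with rfl | ⟨t, rfl⟩ <;> simp
    have h2 : p.i.succAbove s ∈ p.supp ↔ s ∈ ({s | p.i.succAbove s ∈ p.I} : Finset (Fin l)) := by
      simp [Idx.supp]
    rw [h1, map_mul (proj p), proj_f, proj_X_self, Finset.sum_mul, Finset.sum_mul, map_sum]
    simp only [h2]
    have h3 : ∀ t, mk l (X t * mon (Finset.univ.erase s) * u ^ 2) =
        if s = t then mk l (mon Finset.univ * u ^ 2) else 0 := by
      intro t
      split_ifs with h
      · rw [← h, X_mul_mon_erase (Finset.mem_univ s)]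
      · rw [mk_eq_zero]
        have ht : t ∈ (Finset.univ.erase s) := by simp [Ne.symm h]
        have hX : X t * mon (Finset.univ.erase s) * u ^ 2 =
            mon ((Finset.univ.erase s).erase t) * (X t * u) ^ 2 := by
          rw [← X_mul_mon_erase ht]; ring
        have hcard : ((Finset.univ.erase s).erase t).card = l - 2 := by
          rw [Finset.card_erase_of_mem ht, Finset.card_erase_of_mem (Finset.mem_univ s)]
          simp; omega
        rw [hX]
        exact hN.low (e := e) _ ((isHomogeneous_X _ t).mul hu) (by omega)
          (by rw [hcard, hN.succ]; omega)
    rw [Finset.sum_congr rfl fun t _ => h3 t, Finset.sum_ite_eq]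

theorem mk_proj_op (hN : DegreeSeq l N) (hl : 2 ≤ l) (p : Idx (l + 1)) (L : List (Fin (l + 1)))
    {w : P (l + 1)} (hw : w.IsHomogeneous (N 0)) :
    mk l (proj p (op L w)) =
      if L.toFinset ⊆ p.supp then mk l (kapU l L.length (proj p w)) else 0 := by
  have hu := isHomogeneous_of_linear (proj p) (proj_linear p) hw
  induction L with
  | nil => simp
  | cons z L ih =>
    have hL := op_isHomogeneous hN L hw
    have hL' := isHomogeneous_of_linear (proj p) (proj_linear p) hL
    rw [zero_add] at hL'
    rw [op_cons, mk_proj_kapE hN hl p z hL, List.toFinset_cons, List.length_cons, kapU_succ]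
    simp only [Finset.insert_subset_iff]
    by_cases hz : z ∈ p.supp
    · simp only [hz, if_true, true_and]
      split_ifs with h
      · rw [if_pos h] at ih
        exact kap_congr hN (by simp) ih hL' (kapU_isHomogeneous hN _ hu)
      · rw [if_neg h] at ih
        exact mk_eq_zero.2 (kap_mem_hit hN (by simp) (mk_eq_zero.1 ih) hL')
    · simp [hz]

/-! ### Kameko's map and regular monomials in $l$ variables -/

theorem testBit_add_two_mul_zero {k : ℕ} (J : Finset (Fin k)) (a : Fin k →₀ ℕ) (j : Fin k) :
    ((∑ j ∈ J, Finsupp.single j 1 + 2 • a : Fin k →₀ ℕ) j).testBit 0 = true ↔ j ∈ J := by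
  rw [Finsupp.add_apply, Finsupp.finsetSum_apply, Finsupp.smul_apply]
  simp only [Finsupp.single_apply, Finset.sum_ite_eq', Nat.testBit_zero, decide_eq_true_eq,
    smul_eq_mul]
  split_ifs with h <;> simp [h]

/-- Kameko's map, `x_1 ⋯ x_k w² ↦ w`, which vanishes on the other monomials. -/
noncomputable def kameko (k : ℕ) : P k →ₗ[ZMod 2] P k :=
  (basisMonomials (Fin k) (ZMod 2)).constr (ZMod 2) fun c =>
    if ∀ j, (c j).testBit 0 = true then monomial (half c) 1 else 0

theorem kameko_monomial {k : ℕ} (c : Fin k →₀ ℕ) : kameko k (monomial c 1) =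
    if ∀ j, (c j).testBit 0 = true then monomial (half c) 1 else 0 := by
  rw [kameko, ← congrFun (coe_basisMonomials (Fin k) (ZMod 2)) c, Module.Basis.constr_basis]

theorem kameko_kap {k : ℕ} (J : Finset (Fin k)) (v : P k) :
    kameko k (kap J v) = if J = Finset.univ then v else 0 := by
  have : v ∈ LinearMap.eqLocus ((kameko k).comp (kap J))
      (if J = Finset.univ then LinearMap.id else 0) := by
    refine mem_of_monomials (fun a => ?_) v
    rw [LinearMap.mem_eqLocus, LinearMap.comp_apply, kap_apply, mon_eq_monomial, monomial_pow,
      monomial_mul, one_pow, one_mul, kameko_monomial]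
    simp only [testBit_add_two_mul_zero, ← Finset.eq_univ_iff_forall]
    split_ifs with h
    · have ha : half ((∑ j ∈ J, Finsupp.single j 1) + 2 • a) = a := by
        ext j
        rw [half_apply, Finsupp.add_apply, Finsupp.finsetSum_apply, Finsupp.smul_apply, h]
        simp only [Finsupp.single_apply, Finset.sum_ite_eq', smul_eq_mul, Finset.mem_univ, if_true]
        omega
      rw [ha, LinearMap.id_apply]
    · rfl
  have h := LinearMap.mem_eqLocus.1 this
  rw [LinearMap.comp_apply] at h
  rw [h]
  split_ifs <;> rfl

/-- In $Sq^i(x_Jv^2)$ a term has all exponents odd only if $C=\emptyset$ and $J$ is everything; that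
term yields $Sq^{i/2}v$ with $i$ even and positive. -/
theorem kameko_mem_hit {k : ℕ} {w : P k} (hw : w ∈ hit k) : kameko k w ∈ hit k := by
  have : hit k ≤ (hit k).comap (kameko k) := by
    refine iSup_le fun i => ?_
    rintro _ ⟨v, rfl⟩
    refine mem_of_monomials (V := ((hit k).comap (kameko k)).comap (Sq k i)) (fun c => ?_) v
    rw [Submodule.mem_comap, Submodule.mem_comap, monomial_eq_kap, kap_apply, Sq_mon_mul_sq,
      map_sum]
    refine Submodule.sum_mem _ fun C hC => ?_
    rw [← kap_apply, kameko_kap]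
    simp only [Finset.mem_filter, Finset.mem_powerset] at hC
    split_ifs with h
    · have hC0 : C = ∅ := by
        rw [Finset.eq_empty_iff_forall_notMem]
        intro j hj
        have := Finset.mem_univ j
        rw [← h, Finset.mem_sdiff] at this
        exact this.2 hj
      subst hC0
      have hi := i.2
      obtain ⟨m, hm⟩ := hC.2.2
      rw [mon, Finset.prod_empty, one_mul]
      exact Sq_mem_hit (by simp at hm ⊢; omega) _
    · exact zero_mem _
  exact this hw

theorem mem_hit_of_kapU {e : ℕ} {w : P l} (hw : kapU l e w ∈ hit l) : w ∈ hit l := by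
  induction e with
  | zero => exact hw
  | succ e ih =>
    have := kameko_mem_hit hw
    rw [kapU_succ, kameko_kap, if_pos rfl] at this
    exact ih this

/-- The span of the monomials of degree `N e` with an irregular binary column. -/
noncomputable def irregular (l e : ℕ) (N : ℕ → ℕ) : Submodule (ZMod 2) (P l) :=
  Submodule.span (ZMod 2)
    {x | ∃ c : Fin l →₀ ℕ, c.degree = N e ∧ (∃ b < e, col c b ≠ l) ∧ x = monomial c 1}

theorem irregular_le_hit (hN : DegreeSeq l N) (e : ℕ) : irregular l e N ≤ hit l := by
  refine Submodule.span_le.2 ?_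
  rintro _ ⟨c, hc, ⟨b, hb, hcol⟩, rfl⟩
  exact monomial_mem_hit_of_col hN (Nat.le_succ l) hb hc hcol

theorem exists_kapU_sub_mem (hN : DegreeSeq l N) (e : ℕ) {w : P l} (hw : w.IsHomogeneous (N e)) :
    ∃ y : P l, y.IsHomogeneous (N 0) ∧ w - kapU l e y ∈ irregular l e N := by
  have h : w ∈ (homogeneousSubmodule (Fin l) (ZMod 2) (N 0)).map (kapU l e) ⊔
      irregular l e N := by
    refine mem_of_isHomogeneous (fun c hc => ?_) hw
    rcases col_ne_or_eq_kapU hN e hc with h | ⟨c', hc', -, h⟩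
    · exact Submodule.mem_sup_right (Submodule.subset_span ⟨c, hc, h, rfl⟩)
    · exact Submodule.mem_sup_left ⟨_, isHomogeneous_monomial _ hc', h.symm⟩
  obtain ⟨_, ⟨y, hy, rfl⟩, z, hz, rfl⟩ := Submodule.mem_sup.1 h
  exact ⟨y, hy, by rwa [add_sub_cancel_left]⟩

/-! ### The maps $\phi_{(i;I)}$ on exponents -/

theorem phi_monomial (p : Idx (l + 1)) (a : Fin l →₀ ℕ) :
    phi p (monomial a 1) = phiMonomial p a := by
  rw [phi, ← congrFun (coe_basisMonomials (Fin l) (ZMod 2)) a, Module.Basis.constr_basis]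

theorem phi_of_empty {p : Idx (l + 1)} (hp : p.I = ∅) (w : P l) : phi p w = f p.i w := by
  have : w ∈ LinearMap.eqLocus (phi p) (f p.i).toLinearMap :=
    mem_of_monomials (fun a => by
      rw [LinearMap.mem_eqLocus, phi_monomial, phiMonomial, if_pos hp]; rfl) w
  exact this

theorem phi_monomial_of_compatible {p : Idx (l + 1)} (hp : p.I ≠ ∅) {a : Fin l →₀ ℕ}
    {u : Fin p.r} (hu : Compatible p a u) : phi p (monomial a 1) =
      (X p.i ^ (2 ^ p.r - 1) * f p.i (monomial a 1)).divMonomial (divisorExp p u) := by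
  have h : ∃ u, Compatible p a u := ⟨u, hu⟩
  rw [phi_monomial, phiMonomial, if_neg hp, dif_pos h, h.choose_spec.unique hu]

theorem phi_monomial_of_not_compatible {p : Idx (l + 1)} (hp : p.I ≠ ∅) {a : Fin l →₀ ℕ}
    (h : ¬ ∃ u, Compatible p a u) : phi p (monomial a 1) = 0 := by
  rw [phi_monomial, phiMonomial, if_neg hp, dif_neg h]

/-- The variable whose digit in position `b` is removed by `φ_{(i;I)}` on `u`-compatible
monomials. -/
def removed (p : Idx (l + 1)) (u b : Fin p.r) : Fin (l + 1) := p.entry (max u b.rev)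

/-- Reindexed by the binary position $b=r-1-t$: each position below $r$ loses one digit, taken from
$i_t$, or from $i_u$ when $t\le u$; this is the source of the maximum. -/
theorem divisorExp_eq (p : Idx (l + 1)) (u : Fin p.r) :
    divisorExp p u = ∑ b : Fin p.r, Finsupp.single (removed p u b) (2 ^ (b : ℕ)) := by
  rw [← Equiv.sum_comp Fin.revPerm]
  have h : ∀ t : Fin p.r, Finsupp.single (removed p u (Fin.revPerm t))
      (2 ^ ((Fin.revPerm t : Fin p.r) : ℕ)) =
      Finsupp.single (p.entry (max u t)) (2 ^ (p.r - 1 - (t : ℕ))) := by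
    intro t
    rw [Fin.revPerm_apply, removed, Fin.rev_rev, Fin.val_rev]
    congr 2
    omega
  rw [Finset.sum_congr rfl fun t _ => h t, divisorExp]
  have hu : (Finset.univ : Finset (Fin p.r)) = Finset.Iic u ∪ Finset.Ioi u := by
    ext t
    simp only [Finset.mem_univ, Finset.mem_union, Finset.mem_Iic, Finset.mem_Ioi, true_iff]
    exact le_or_gt t u
  have hd : Disjoint (Finset.Iic u) (Finset.Ioi u) := by
    rw [Finset.disjoint_left]
    intro t h1 h2
    exact (Finset.mem_Iic.1 h1).not_gt (Finset.mem_Ioi.1 h2)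
  rw [hu, Finset.sum_union hd, Finsupp.single_finsetSum]
  congr 1
  · refine Finset.sum_congr rfl fun t ht => ?_
    rw [max_eq_left (Finset.mem_Iic.1 ht)]
  · refine Finset.sum_congr rfl fun t ht => ?_
    rw [max_eq_right (Finset.mem_Ioi.1 ht).le]

theorem entry_mem (p : Idx (l + 1)) (t : Fin p.r) : p.entry t ∈ p.I :=
  Finset.orderEmbOfFin_mem p.I rfl t

theorem succAbove_entryPred (p : Idx (l + 1)) (t : Fin p.r) :
    p.i.succAbove (p.entryPred t) = p.entry t :=
  Fin.succAbove_pred_of_lt _ _ (p.lt _ (entry_mem p t))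

theorem testBit_removed {p : Idx (l + 1)} {a : Fin l →₀ ℕ} {u : Fin p.r}
    (hu : Compatible p a u) (b : Fin p.r) :
    (a (p.entryPred (max u b.rev))).testBit b = true := by
  have hb : p.r - 1 - (b.rev : ℕ) = b := by
    rw [Fin.val_rev]; omega
  rcases le_or_gt b.rev u with h | h
  · have := hu.digit_at _ h
    rwa [hb, ← max_eq_left h] at this
  · have := hu.digit_of_gt _ h
    rwa [hb, ← max_eq_right h.le] at this

/-- The exponents of `x_i^{2^r - 1} f_i(x)`. -/
noncomputable def numeratorExp (p : Idx (l + 1)) (a : Fin l →₀ ℕ) : Fin (l + 1) →₀ ℕ :=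
  Finsupp.single p.i (2 ^ p.r - 1) + a.mapDomain p.i.succAbove

theorem numeratorExp_self (p : Idx (l + 1)) (a : Fin l →₀ ℕ) :
    numeratorExp p a p.i = 2 ^ p.r - 1 := by
  rw [numeratorExp, Finsupp.add_apply, Finsupp.single_eq_same, Finsupp.mapDomain_of_notMem_range,
    add_zero]
  simp

theorem numeratorExp_succAbove (p : Idx (l + 1)) (a : Fin l →₀ ℕ) (s : Fin l) :
    numeratorExp p a (p.i.succAbove s) = a s := by
  rw [numeratorExp, Finsupp.add_apply, Finsupp.single_eq_of_ne (Fin.succAbove_ne _ _),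
    Finsupp.mapDomain_apply Fin.succAbove_right_injective, zero_add]

theorem numerator_eq (p : Idx (l + 1)) (a : Fin l →₀ ℕ) :
    (X p.i ^ (2 ^ p.r - 1) * f p.i (monomial a 1) : P (l + 1)) = monomial (numeratorExp p a) 1 := by
  rw [f, rename_monomial, X_pow_eq_monomial, monomial_mul, one_mul, numeratorExp]

theorem testBit_sum_two_pow (s : Finset ℕ) (b : ℕ) :
    (∑ i ∈ s, 2 ^ i).testBit b = true ↔ b ∈ s := by
  rw [← Nat.mem_bitIndices, ← List.mem_toFinset, Finset.toFinset_bitIndices_sum_two_pow]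

theorem testBit_numeratorExp_self (p : Idx (l + 1)) (a : Fin l →₀ ℕ) (b : ℕ) :
    (numeratorExp p a p.i).testBit b = true ↔ b < p.r := by
  rw [numeratorExp_self, Nat.testBit_two_pow_sub_one, decide_eq_true_iff]

/-- The bits removed from the exponent of `x_j`. -/
def removedBits (p : Idx (l + 1)) (u : Fin p.r) (j : Fin (l + 1)) : Finset ℕ :=
  ({b | removed p u b = j} : Finset (Fin p.r)).map Fin.valEmbedding

theorem mem_removedBits {p : Idx (l + 1)} {u : Fin p.r} {j : Fin (l + 1)} {b : ℕ} :
    b ∈ removedBits p u j ↔ ∃ h : b < p.r, removed p u ⟨b, h⟩ = j := by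
  simp only [removedBits, Finset.mem_map, Finset.mem_filter, Finset.mem_univ, true_and,
    Fin.valEmbedding_apply]
  constructor
  · rintro ⟨b, hb, rfl⟩; exact ⟨b.2, hb⟩
  · rintro ⟨h, hb⟩; exact ⟨⟨b, h⟩, hb, rfl⟩

theorem divisorExp_apply (p : Idx (l + 1)) (u : Fin p.r) (j : Fin (l + 1)) :
    divisorExp p u j = ∑ b ∈ removedBits p u j, 2 ^ b := by
  rw [divisorExp_eq, Finsupp.finsetSum_apply, removedBits, Finset.sum_map, Finset.sum_filter]
  simp only [Finsupp.single_apply, Fin.valEmbedding_apply]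

/-- The exponents of `φ_{(i;I)}` of a compatible monomial. -/
noncomputable def phiExp (p : Idx (l + 1)) (a : Fin l →₀ ℕ) (u : Fin p.r) : Fin (l + 1) →₀ ℕ :=
  Finsupp.equivFunOnFinite.symm fun j =>
    ∑ b ∈ (numeratorExp p a j).bitIndices.toFinset \ removedBits p u j, 2 ^ b

theorem removedBits_subset {p : Idx (l + 1)} {a : Fin l →₀ ℕ} {u : Fin p.r}
    (hu : Compatible p a u) (j : Fin (l + 1)) :
    removedBits p u j ⊆ (numeratorExp p a j).bitIndices.toFinset := by
  intro b hb
  obtain ⟨h, rfl⟩ := mem_removedBits.1 hb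
  rw [List.mem_toFinset, Nat.mem_bitIndices, removed, ← succAbove_entryPred,
    numeratorExp_succAbove]
  exact testBit_removed hu ⟨b, h⟩

theorem phiExp_add_divisorExp {p : Idx (l + 1)} {a : Fin l →₀ ℕ} {u : Fin p.r}
    (hu : Compatible p a u) : phiExp p a u + divisorExp p u = numeratorExp p a := by
  ext j
  rw [Finsupp.add_apply, divisorExp_apply, phiExp, Finsupp.equivFunOnFinite_symm_apply_apply,
    Finset.sum_sdiff (removedBits_subset hu j), Finset.sum_toFinset_bitIndices_two_pow]

theorem phi_monomial_eq {p : Idx (l + 1)} (hp : p.I ≠ ∅) {a : Fin l →₀ ℕ}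
    {u : Fin p.r} (hu : Compatible p a u) :
    phi p (monomial a 1) = monomial (phiExp p a u) 1 := by
  rw [phi_monomial_of_compatible hp hu, numerator_eq, ← phiExp_add_divisorExp hu,
    ← one_mul (1 : ZMod 2),
    ← monomial_mul, divMonomial_mul_monomial, one_mul]

theorem degree_phiExp {p : Idx (l + 1)} {a : Fin l →₀ ℕ} {u : Fin p.r}
    (hu : Compatible p a u) : (phiExp p a u).degree = a.degree := by
  have h := congrArg Finsupp.degree (phiExp_add_divisorExp hu)
  have h1 : (divisorExp p u).degree = 2 ^ p.r - 1 := by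
    rw [divisorExp_eq, map_sum]
    simp only [Finsupp.degree_single]
    rw [Fin.sum_univ_eq_sum_range (fun b => 2 ^ b), Nat.geomSum_eq le_rfl]
    simp
  have h2 : (numeratorExp p a).degree = 2 ^ p.r - 1 + a.degree := by
    rw [numeratorExp, map_add, Finsupp.degree_single, Finsupp.degree_mapDomain]
  rw [map_add, h1, h2] at h
  omega

theorem card_filter_succAbove (i : Fin (l + 1)) (Q : Fin (l + 1) → Prop) [DecidablePred Q] :
    ({j | Q j} : Finset (Fin (l + 1))).card =
      (if Q i then 1 else 0) + ({s | Q (i.succAbove s)} : Finset (Fin l)).card := by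
  rw [Finset.card_filter, Fin.sum_univ_succAbove _ i, Finset.card_filter]

/-- In each position below $r$ the variable $x_i$ gains a digit and one existing digit is removed;
other positions are untouched. Consequently irregular monomials go to zero or to irregular, hence
hit, ones. -/
theorem col_phiExp {p : Idx (l + 1)} {a : Fin l →₀ ℕ} {u : Fin p.r}
    (hu : Compatible p a u) (b : ℕ) : col (phiExp p a u) b = col a b := by
  have h1 : ({j | (phiExp p a u j).testBit b} : Finset (Fin (l + 1))) =
      ({j | (numeratorExp p a j).testBit b} : Finset (Fin (l + 1))) \
        ({j | b ∈ removedBits p u j} : Finset (Fin (l + 1))) := by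
    ext j
    rw [Finset.mem_sdiff, Finset.mem_filter, Finset.mem_filter, Finset.mem_filter, phiExp,
      Finsupp.equivFunOnFinite_symm_apply_apply, testBit_sum_two_pow, Finset.mem_sdiff,
      List.mem_toFinset, Nat.mem_bitIndices]
    simp
  have h2 : ({j | b ∈ removedBits p u j} : Finset (Fin (l + 1))) ⊆
      ({j | (numeratorExp p a j).testBit b} : Finset (Fin (l + 1))) := by
    intro j hj
    rw [Finset.mem_filter] at hj ⊢
    have := removedBits_subset hu j hj.2
    rw [List.mem_toFinset, Nat.mem_bitIndices] at this
    exact ⟨hj.1, this⟩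
  have h3 : ({j | b ∈ removedBits p u j} : Finset (Fin (l + 1))).card =
      if b < p.r then 1 else 0 := by
    split_ifs with h
    · rw [Finset.card_eq_one]
      refine ⟨removed p u ⟨b, h⟩, ?_⟩
      ext j
      rw [Finset.mem_filter, mem_removedBits, Finset.mem_singleton]
      simp [h, eq_comm]
    · rw [Finset.card_eq_zero, Finset.filter_eq_empty_iff]
      intro j _ hj
      exact h (mem_removedBits.1 hj).1
  have h4 := card_filter_succAbove p.i fun j => (numeratorExp p a j).testBit b = true
  simp only [testBit_numeratorExp_self, numeratorExp_succAbove] at h4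
  change Finset.card _ = Finset.card _
  rw [h1, Finset.card_sdiff_of_subset h2, h3, h4]
  omega

theorem phi_monomial_cases (p : Idx (l + 1)) (a : Fin l →₀ ℕ) : phi p (monomial a 1) = 0 ∨
    ∃ c : Fin (l + 1) →₀ ℕ, phi p (monomial a 1) = monomial c 1 ∧ c.degree = a.degree ∧
      ∀ b, col c b = col a b := by
  by_cases hp : p.I = ∅
  · refine Or.inr ⟨numeratorExp p a, ?_, ?_, fun b => ?_⟩
    · rw [phi_of_empty hp, ← numerator_eq, Idx.r, hp]; simp
    · rw [numeratorExp, map_add, Finsupp.degree_single, Finsupp.degree_mapDomain, Idx.r, hp]; simp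
    · have h4 := card_filter_succAbove p.i fun j => (numeratorExp p a j).testBit b = true
      simp only [testBit_numeratorExp_self, numeratorExp_succAbove] at h4
      have hr : ¬ b < p.r := by rw [Idx.r, hp]; simp
      rw [if_neg hr, zero_add] at h4
      exact h4
  · by_cases h : ∃ u, Compatible p a u
    · obtain ⟨u, hu⟩ := h
      exact Or.inr ⟨_, phi_monomial_eq hp hu, degree_phiExp hu, col_phiExp hu⟩
    · exact Or.inl (phi_monomial_of_not_compatible hp h)

theorem phi_isHomogeneous (p : Idx (l + 1)) {n : ℕ} {w : P l} (hw : w.IsHomogeneous n) :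
    (phi p w).IsHomogeneous n := by
  refine mem_of_isHomogeneous
    (V := (homogeneousSubmodule (Fin (l + 1)) (ZMod 2) n).comap (phi p)) (fun a ha => ?_) hw
  rw [Submodule.mem_comap]
  rcases phi_monomial_cases p a with h | ⟨c, h, hc, -⟩
  · rw [h]; exact zero_mem _
  · rw [h]; exact isHomogeneous_monomial _ (hc.trans ha)

theorem phi_irregular_mem_hit (hN : DegreeSeq l N) (p : Idx (l + 1)) {e : ℕ} {w : P l}
    (hw : w ∈ irregular l e N) : phi p w ∈ hit (l + 1) := by
  have : irregular l e N ≤ (hit (l + 1)).comap (phi p) := by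
    refine Submodule.span_le.2 ?_
    rintro _ ⟨a, ha, ⟨b, hb, hcol⟩, rfl⟩
    rcases phi_monomial_cases p a with h | ⟨c, h, hc, hc'⟩
    · rw [SetLike.mem_coe, Submodule.mem_comap, h]; exact zero_mem _
    · rw [SetLike.mem_coe, Submodule.mem_comap, h]
      exact monomial_mem_hit_of_col hN le_rfl hb (hc.trans ha) (by rwa [hc'])
  exact this hw

/-! ### The maps $\phi_{(i;I)}$ as words -/

/-- The monomial of the letters of a word, the letter in position `a` with exponent `2^a`. -/
noncomputable def wordMon : List (Fin (l + 1)) → P (l + 1)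
  | [] => 1
  | z :: L => X z * wordMon L ^ 2

/-- A letter is the variable missing from its column, so multiplying by `wordMon` fills the lowest
columns completely. -/
theorem op_mul_wordMon (L : List (Fin (l + 1))) (y : P (l + 1)) :
    op L y * wordMon L = mon Finset.univ ^ (2 ^ L.length - 1) * y ^ 2 ^ L.length := by
  induction L with
  | nil => simp [wordMon]
  | cons z L ih =>
    rw [op_cons, kap_apply, wordMon]
    have h : mon (Finset.univ.erase z) * op L y ^ 2 * (X z * wordMon L ^ 2) =
        X z * mon (Finset.univ.erase z) * (op L y * wordMon L) ^ 2 := by ring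
    have h1 : 2 ^ (L.length + 1) - 1 = 1 + (2 ^ L.length - 1) * 2 := by
      have := Nat.one_le_two_pow (n := L.length)
      rw [pow_succ]; omega
    rw [h, X_mul_mon_erase (Finset.mem_univ z), ih, List.length_cons, h1, pow_add, pow_one, pow_mul,
      pow_succ 2 L.length, pow_mul y]
    ring

theorem wordMon_map_range (d : ℕ) (g : ℕ → Fin (l + 1)) :
    wordMon ((List.range d).map g) = ∏ a ∈ Finset.range d, X (g a) ^ 2 ^ a := by
  induction d generalizing g with
  | zero => simp [wordMon]
  | succ d ih =>
    rw [List.range_succ_eq_map, List.map_cons, List.map_map, wordMon, ih,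
      Finset.prod_range_succ', ← Finset.prod_pow]
    rw [pow_zero, pow_one, mul_comm]
    congr 1
    refine Finset.prod_congr rfl fun a _ => ?_
    rw [← pow_mul, ← pow_succ]
    rfl

theorem kapU_eq (d : ℕ) (y : P l) :
    kapU l d y = mon Finset.univ ^ (2 ^ d - 1) * y ^ 2 ^ d := by
  induction d with
  | zero => simp
  | succ d ih =>
    have h1 : 2 ^ (d + 1) - 1 = 1 + (2 ^ d - 1) * 2 := by
      have := Nat.one_le_two_pow (n := d)
      rw [pow_succ]; omega
    rw [kapU_succ, kap_apply, ih, h1, pow_add, pow_one, pow_mul, pow_succ 2 d, pow_mul y]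
    ring

theorem prod_range_pow_two_pow {R : Type*} [CommMonoid R] (x : R) (d : ℕ) :
    ∏ a ∈ Finset.range d, x ^ 2 ^ a = x ^ (2 ^ d - 1) := by
  rw [Finset.prod_pow_eq_pow_sum, Nat.geomSum_eq le_rfl]
  simp

/-- The word which describes `φ_{(i;I)}` on `u`-compatible monomials whose exponents end in `d`
ones. -/
def phiWord (d : ℕ) (p : Idx (l + 1)) (u : Fin p.r) : List (Fin (l + 1)) :=
  (List.range d).map fun a => if h : a < p.r then removed p u ⟨a, h⟩ else p.i

theorem length_phiWord (d : ℕ) (p : Idx (l + 1)) (u : Fin p.r) : (phiWord d p u).length = d := by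
  simp [phiWord]

theorem wordMon_phiWord {d : ℕ} (p : Idx (l + 1)) (u : Fin p.r) (hd : p.r ≤ d) :
    wordMon (phiWord d p u) =
      monomial (divisorExp p u) 1 * ∏ a ∈ Finset.Ico p.r d, X p.i ^ 2 ^ a := by
  rw [phiWord, wordMon_map_range, ← Finset.prod_range_mul_prod_Ico _ hd, divisorExp_eq,
    monomial_sum_one, Finset.prod_range]
  congr 1
  · refine Finset.prod_congr rfl fun b _ => ?_
    rw [dif_pos b.2, X_pow_eq_monomial]
  · refine Finset.prod_congr rfl fun a ha => ?_
    rw [dif_neg (Finset.mem_Ico.1 ha).1.not_gt]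

/-- Both sides agree after the missing digits are put back: the divisor supplies positions below
$r$, and powers of $x_i$ supply positions from $r$ to $d-1$. Cancellation in the domain $P_k$
concludes. -/
theorem phi_kapU_monomial {d : ℕ} {p : Idx (l + 1)} (hp : p.I ≠ ∅) (hd : p.r ≤ d)
    {a b : Fin l →₀ ℕ} (hab : (monomial a 1 : P l) = kapU l d (monomial b 1)) {u : Fin p.r}
    (hu : Compatible p a u) :
    phi p (monomial a 1) = op (phiWord d p u) (f p.i (monomial b 1)) := by
  rw [phi_monomial_of_compatible hp hu]
  suffices h : (X p.i ^ (2 ^ p.r - 1) * f p.i (monomial a 1) : P (l + 1)) =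
      op (phiWord d p u) (f p.i (monomial b 1)) * monomial (divisorExp p u) 1 by
    rw [h, divMonomial_mul_monomial]
  have hZ : (∏ a ∈ Finset.Ico p.r d, X p.i ^ 2 ^ a : P (l + 1)) ≠ 0 :=
    Finset.prod_ne_zero_iff.2 fun a _ => pow_ne_zero _ (X_ne_zero _)
  refine mul_right_cancel₀ hZ ?_
  rw [mul_assoc (op _ _), ← wordMon_phiWord p u hd, op_mul_wordMon, length_phiWord, mul_right_comm,
    ← prod_range_pow_two_pow, Finset.prod_range_mul_prod_Ico _ hd, prod_range_pow_two_pow, hab,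
    kapU_eq, map_mul, map_pow, map_pow, f_mon_univ, ← mul_assoc, ← mul_pow,
    X_mul_mon_erase (Finset.mem_univ _)]

theorem testBit_of_regular {d x y b : ℕ} (h : x = 2 ^ d * y + (2 ^ d - 1)) (hb : b < d) :
    x.testBit b = true := by
  have := Nat.one_le_two_pow (n := d)
  rw [h, Nat.testBit_two_pow_mul_add _ (by omega), if_pos hb, Nat.testBit_two_pow_sub_one]
  simpa using hb

/-- The exponent $2^db_j+2^d-1$ exceeds $2^r-1$ unless $r=d$ and $b_j=0$, and its lowest $d$ digits
are all 1. -/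
theorem compatible_of_regular {d : ℕ} {p : Idx (l + 1)} (hd : p.r ≤ d) {a b : Fin l →₀ ℕ}
    (hab : ∀ j, a j = 2 ^ d * b j + (2 ^ d - 1)) {u : Fin p.r}
    (hlt : ∀ t, t < u → p.r = d ∧ b (p.entryPred t) = 0)
    (hu : p.r < d ∨ 0 < b (p.entryPred u)) : Compatible p a u := by
  have hpow := Nat.one_le_two_pow (n := d)
  have hpow' := Nat.one_le_two_pow (n := p.r)
  refine ⟨fun t ht => ?_, ?_, fun t _ => testBit_of_regular (hab _) (by omega),
    fun t _ => testBit_of_regular (hab _) (by omega)⟩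
  · rw [hab, (hlt t ht).1, (hlt t ht).2, mul_zero, zero_add]
  · rw [hab]
    rcases hu with h | h
    · have := Nat.pow_lt_pow_right (a := 2) (by norm_num) h
      omega
    · have h1 : 2 ^ d ≤ 2 ^ d * b (p.entryPred u) := Nat.le_mul_of_pos_right _ h
      have h2 : 2 ^ p.r ≤ 2 ^ d := Nat.pow_le_pow_right two_pos hd
      omega

theorem exists_kapU_monomial (d : ℕ) (b : Fin l →₀ ℕ) : ∃ a : Fin l →₀ ℕ,
    (∀ j, a j = 2 ^ d * b j + (2 ^ d - 1)) ∧ (monomial a 1 : P l) = kapU l d (monomial b 1) := by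
  refine ⟨2 ^ d • b + ∑ j, Finsupp.single j (2 ^ d - 1), fun j => ?_, ?_⟩
  · simp only [Finsupp.add_apply, Finsupp.smul_apply, Finsupp.finsetSum_apply,
      Finsupp.single_apply, Finset.sum_ite_eq', Finset.mem_univ, if_true, smul_eq_mul]
  · rw [kapU_eq, mon_eq_monomial, monomial_pow, monomial_pow, one_pow, one_pow, monomial_mul,
      one_mul, add_comm, Finset.smul_sum]
    simp

theorem exists_entry_eq {p : Idx (l + 1)} {j : Fin (l + 1)} (hj : j ∈ p.I) :
    ∃ t, p.entry t = j := by
  have := Finset.range_orderEmbOfFin p.I rfl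
  have h : j ∈ Set.range (p.I.orderEmbOfFin rfl) := by rw [this]; exact hj
  exact h

/-- For `ℓ(I) < d` the map `φ_{(i;I)}` is given by a word with set of letters `{i} ∪ I` on the
polynomials whose exponents end in `d` ones. -/
theorem exists_word_of_lt {d : ℕ} (p : Idx (l + 1)) (hd : p.r < d) :
    ∃ L : List (Fin (l + 1)), L.length = d ∧ L.toFinset = p.supp ∧
      ∀ y, phi p (kapU l d y) = op L (f p.i y) := by
  by_cases hp : p.I = ∅
  · refine ⟨List.replicate d p.i, by simp, ?_, fun y => ?_⟩
    · rw [List.toFinset_replicate_of_ne_zero (by omega), Idx.supp, hp]; rfl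
    · rw [phi_of_empty hp]
      clear hd
      induction d with
      | zero => rfl
      | succ d ih =>
        rw [List.replicate_succ, op_cons, ← ih, kapU_succ, kap_apply, kap_apply, map_mul, map_pow,
          f_mon_univ]
  · have hr : 0 < p.r := Finset.card_pos.2 (Finset.nonempty_iff_ne_empty.2 hp)
    -- As $r<d$, every exponent exceeds $2^r-1$, so the first entry of $I$ is the compatible one and
    -- no entry is skipped; position $r$ of the word supplies the letter $i$.
    refine ⟨phiWord d p ⟨0, hr⟩, length_phiWord _ _ _, ?_, fun y => ?_⟩
    · have h0 : ∀ b, removed p ⟨0, hr⟩ b = p.entry b.rev := fun b => by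
        rw [removed, max_eq_right (Fin.mk_le_of_le_val (Nat.zero_le _))]
      ext j
      simp only [phiWord, List.mem_toFinset, List.mem_map, List.mem_range, Idx.supp,
        Finset.mem_insert, h0]
      constructor
      · rintro ⟨a, -, rfl⟩
        split_ifs with h
        · exact Or.inr (entry_mem p _)
        · exact Or.inl rfl
      · rintro (rfl | hj)
        · exact ⟨p.r, hd, dif_neg (lt_irrefl _)⟩
        · obtain ⟨t, rfl⟩ := exists_entry_eq hj
          refine ⟨t.rev, t.rev.2.trans hd, ?_⟩
          rw [dif_pos t.rev.2, Fin.eta, Fin.rev_rev]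
    · have : y ∈ LinearMap.eqLocus ((phi p).comp (kapU l d))
          ((op (phiWord d p ⟨0, hr⟩)).comp (f p.i).toLinearMap) := by
        refine mem_of_monomials (fun b => ?_) y
        obtain ⟨a, ha, hab⟩ := exists_kapU_monomial d b
        rw [LinearMap.mem_eqLocus, LinearMap.comp_apply, ← hab]
        exact phi_kapU_monomial hp hd.le hab (compatible_of_regular hd.le ha
          (fun t ht => absurd ht (by simp [Fin.lt_def])) (Or.inl hd))
      exact this

theorem Idx.r_le (p : Idx (l + 1)) : p.r ≤ l := by
  have h : p.I ⊆ Finset.univ.erase p.i := fun j hj =>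
    Finset.mem_erase.2 ⟨(p.lt j hj).ne', Finset.mem_univ j⟩
  exact (Finset.card_le_card h).trans_eq (card_univ_erase p.i)

theorem Idx.eq_of_r_eq {p : Idx (l + 1)} (hp : p.r = l) :
    p.i = 0 ∧ p.I = Finset.univ.erase 0 := by
  have h : p.I ⊆ Finset.univ.erase p.i := fun j hj =>
    Finset.mem_erase.2 ⟨(p.lt j hj).ne', Finset.mem_univ j⟩
  have h1 := Finset.eq_of_subset_of_card_le h (by rw [card_univ_erase]; exact hp.ge)
  have hi : p.i = 0 := by
    by_contra h0
    have : (0 : Fin (l + 1)) ∈ p.I := by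
      rw [h1, Finset.mem_erase]
      exact ⟨Ne.symm h0, Finset.mem_univ _⟩
    exact absurd (p.lt _ this) (Fin.not_lt_zero _)
  exact ⟨hi, by rw [h1, hi]⟩

theorem Idx.supp_eq_univ {p : Idx (l + 1)} (hp : p.r = l) : p.supp = Finset.univ := by
  rw [Idx.supp, (Idx.eq_of_r_eq hp).1, (Idx.eq_of_r_eq hp).2,
    Finset.insert_erase (Finset.mem_univ _)]

theorem val_entry {p : Idx (l + 1)} (hp : p.r = l) (t : Fin p.r) :
    (p.entry t : ℕ) = (t : ℕ) + 1 := by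
  have h : (fun t : Fin p.r => (⟨t + 1, by omega⟩ : Fin (l + 1))) = p.I.orderEmbOfFin rfl := by
    refine Finset.orderEmbOfFin_unique rfl (fun t => ?_) fun s t h => ?_
    · rw [(Idx.eq_of_r_eq hp).2, Finset.mem_erase]
      exact ⟨Fin.ne_of_val_ne (by simp), Finset.mem_univ _⟩
    · rw [Fin.lt_def]
      exact Nat.succ_lt_succ h
  have := congrFun h t
  rw [Idx.entry, ← this]

theorem val_entryPred {p : Idx (l + 1)} (hp : p.r = l) (t : Fin p.r) :
    (p.entryPred t : ℕ) = t := by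
  rw [Idx.entryPred, Fin.val_pred, val_entry hp]; rfl

/-- For `ℓ(I) = d = l` the map `φ_{(i;I)}` is given by words which depend on the first variable
which occurs. -/
theorem exists_word_of_eq {p : Idx (l + 1)} (hp : p.r = l) (hl : 0 < l) (u : Fin l) :
    ∃ L : List (Fin (l + 1)), L.length = l ∧
      L.toFinset = ({j | (u : ℕ) < j} : Finset (Fin (l + 1))) ∧
      ∀ b : Fin l →₀ ℕ, 0 < b u → (∀ t, t < u → b t = 0) →
        phi p (kapU l l (monomial b 1)) = op L (f p.i (monomial b 1)) := by
  have hI : p.I ≠ ∅ := by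
    rintro hI
    rw [Idx.r, hI, Finset.card_empty] at hp
    omega
  set u' : Fin p.r := ⟨u, by omega⟩ with hu'
  have hval : ∀ b, (removed p u' b : ℕ) = max (u : ℕ) (b.rev : ℕ) + 1 := fun b => by
    rw [removed, val_entry hp, Fin.coe_max]
  -- With $r=l$ every position carries an entry of $I$, so the letter $i$ is absent, and entries
  -- before $i_u$ are replaced by $i_u$.
  refine ⟨phiWord l p u', length_phiWord _ _ _, ?_, fun b hb0 hb => ?_⟩
  · ext j
    simp only [phiWord, List.mem_toFinset, List.mem_map, List.mem_range, Finset.mem_filter,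
      Finset.mem_univ, true_and]
    constructor
    · rintro ⟨a, ha, rfl⟩
      rw [dif_pos (hp.symm ▸ ha), hval]; omega
    · intro hj
      have ht : (j : ℕ) - 1 < p.r := by omega
      refine ⟨(⟨j - 1, ht⟩ : Fin p.r).rev, (Fin.is_lt _).trans_eq hp, ?_⟩
      rw [dif_pos (Fin.is_lt _), Fin.eta]
      apply Fin.ext
      rw [hval, Fin.rev_rev]
      simp only
      omega
  · obtain ⟨a, ha, hab⟩ := exists_kapU_monomial l b
    rw [← hab]
    have hpred : ∀ t : Fin p.r, p.entryPred t = ⟨t, t.2.trans_eq hp⟩ := fun t =>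
      Fin.ext (val_entryPred hp t)
    refine phi_kapU_monomial hI hp.le hab (compatible_of_regular hp.le ha (fun t ht => ⟨hp, ?_⟩)
      (Or.inr ?_))
    · rw [hpred]; exact hb _ ht
    · rw [hpred]; exact hb0

/-! ### The maps $\phi_{(i;I)}$ preserve hits in degree $N_d$ -/

/-- The substitution which annihilates the variables before `x_u`. -/
noncomputable def killBefore (l u : ℕ) : P l →ₐ[ZMod 2] P l :=
  aeval fun j : Fin l => if u ≤ j then X j else 0

theorem killBefore_linear (u : ℕ) (j : Fin l) :
    ∃ A : Finset (Fin l), killBefore l u (X j) = ∑ s ∈ A, X s := by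
  rw [killBefore, aeval_X]
  split_ifs
  · exact ⟨{j}, by simp⟩
  · exact ⟨∅, by simp⟩

theorem killBefore_monomial (u : ℕ) (b : Fin l →₀ ℕ) [Decidable (∀ j, b j ≠ 0 → u ≤ (j : ℕ))] :
    killBefore l u (monomial b 1) = if ∀ j, b j ≠ 0 → u ≤ (j : ℕ) then monomial b 1 else 0 := by
  rw [killBefore, aeval_monomial, map_one, one_mul]
  split_ifs with h
  · rw [monomial_eq, C_1, one_mul]
    refine Finsupp.prod_congr fun j hj => ?_
    rw [if_pos (h j (Finsupp.mem_support_iff.1 hj))]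
  · push Not at h
    obtain ⟨j, hj, hu⟩ := h
    refine Finset.prod_eq_zero (Finsupp.mem_support_iff.2 hj) ?_
    simp only
    rw [if_neg hu.not_ge, zero_pow hj]

/-- A hit polynomial of degree `N d` is mapped to a hit polynomial by `φ_{(i;I)}`. -/
theorem phi_mem_hit (hN : DegreeSeq l N) (hN0 : 0 < N 0) (hl : 0 < l) {d : ℕ} (hd : l ≤ d)
    (p : Idx (l + 1)) {w : P l} (hw : w ∈ hit l) (hwd : w.IsHomogeneous (N d)) :
    phi p w ∈ hit (l + 1) := by
  obtain ⟨y, hy, hwy⟩ := exists_kapU_sub_mem hN d hwd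
  have h1 : kapU l d y ∈ hit l := by
    have := sub_mem hw (irregular_le_hit hN d hwy)
    rwa [sub_sub_cancel] at this
  have hy0 := mem_hit_of_kapU h1
  suffices h : phi p (kapU l d y) ∈ hit (l + 1) by
    have := add_mem (phi_irregular_mem_hit hN p hwy) h
    rwa [map_sub, sub_add_cancel] at this
  rcases p.r_le.lt_or_eq with h | h
  · obtain ⟨L, -, -, hL⟩ := exists_word_of_lt p (h.trans_le hd)
    rw [hL]
    exact op_mem_hit hN L (hit_of_linear _ (f_linear p.i) hy0)
      (isHomogeneous_of_linear _ (f_linear p.i) hy)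
  rcases hd.lt_or_eq with h' | rfl
  · obtain ⟨L, -, -, hL⟩ := exists_word_of_lt p (h.trans_lt h')
    rw [hL]
    exact op_mem_hit hN L (hit_of_linear _ (f_linear p.i) hy0)
      (isHomogeneous_of_linear _ (f_linear p.i) hy)
  choose L hL1 hL2 hL3 using exists_word_of_eq h hl
  -- The difference of two consecutive `killBefore` maps selects the monomials whose first variable
  -- has index $u$; both maps are linear substitutions, so they preserve hits. Since $N_0>0$, each
  -- monomial has a first variable.
  have key : phi p (kapU l l y) =
      ∑ u : Fin l, op (L u) (f p.i (killBefore l u y - killBefore l (u + 1) y)) := by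
    have : y ∈ LinearMap.eqLocus ((phi p).comp (kapU l l))
        (∑ u : Fin l, (op (L u)).comp ((f p.i).toLinearMap.comp
          ((killBefore l u).toLinearMap - (killBefore l (u + 1)).toLinearMap))) := by
      refine mem_of_isHomogeneous (fun b hb => ?_) hy
      classical
      have hb0 : b ≠ 0 := by
        rintro rfl
        simp at hb; omega
      have hex : b.support.Nonempty := Finsupp.support_nonempty_iff.2 hb0
      set u := b.support.min' hex
      have hu : b u ≠ 0 := Finsupp.mem_support_iff.1 (Finset.min'_mem _ hex)
      have hmin : ∀ j, b j ≠ 0 → u ≤ j := fun j hj =>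
        Finset.min'_le _ _ (Finsupp.mem_support_iff.2 hj)
      have hiff : ∀ v : ℕ, (∀ j, b j ≠ 0 → v ≤ (j : ℕ)) ↔ v ≤ u :=
        fun v => ⟨fun h => h u hu, fun h j hj => h.trans (hmin j hj)⟩
      rw [LinearMap.mem_eqLocus, LinearMap.sum_apply, Finset.sum_eq_single u]
      · simp only [LinearMap.comp_apply, LinearMap.sub_apply, AlgHom.toLinearMap_apply,
          killBefore_monomial, hiff]
        rw [if_pos le_rfl, if_neg (by omega), sub_zero]
        refine hL3 u b (Nat.pos_of_ne_zero hu) fun t ht => ?_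
        by_contra h0
        exact ht.not_ge (hmin t h0)
      · intro v _ hv
        simp only [LinearMap.comp_apply, LinearMap.sub_apply, AlgHom.toLinearMap_apply,
          killBefore_monomial, hiff]
        have hv' : (v : ℕ) ≠ u := fun h => hv (Fin.ext h)
        by_cases hvu : (v : ℕ) ≤ u
        · rw [if_pos hvu, if_pos (by omega), sub_self, map_zero, map_zero]
        · rw [if_neg hvu, if_neg (by omega), sub_self, map_zero, map_zero]
      · intro h; exact absurd (Finset.mem_univ _) h
    have h2 := LinearMap.mem_eqLocus.1 this
    rw [LinearMap.sum_apply] at h2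
    exact h2
  rw [key]
  refine Submodule.sum_mem _ fun u _ => ?_
  have hk : ∀ v, killBefore l v y ∈ hit l ∧ (killBefore l v y).IsHomogeneous (N 0) := fun v =>
    ⟨hit_of_linear _ (killBefore_linear v) hy0, isHomogeneous_of_linear _ (killBefore_linear v) hy⟩
  exact op_mem_hit hN _ (hit_of_linear _ (f_linear p.i) (sub_mem (hk _).1 (hk _).1))
    (isHomogeneous_of_linear _ (f_linear p.i) ((hk _).2.sub (hk _).2))

/-! ### Eliminating the variable $x_i$ -/

theorem exists_idx_supp_eq {T : Finset (Fin (l + 1))} (hT : T.Nonempty) :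
    ∃ p : Idx (l + 1), p.supp = T ∧ p.i = T.min' hT := by
  refine ⟨⟨T.min' hT, T.erase (T.min' hT), fun j hj => ?_⟩, ?_, rfl⟩
  · exact lt_of_le_of_ne (Finset.min'_le _ _ (Finset.mem_of_mem_erase hj))
      (Finset.ne_of_mem_erase hj).symm
  · exact Finset.insert_erase (Finset.min'_mem T hT)

theorem f_range_of_supported {i : Fin (l + 1)} {s : Set (Fin (l + 1))} (hi : i ∉ s)
    {y : P (l + 1)} (hy : y ∈ supported (ZMod 2) s) : ∃ y', f i y' = y := by
  have : supported (ZMod 2) s ≤ (f i).range := by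
    refine Algebra.adjoin_le ?_
    rintro _ ⟨j, hj, rfl⟩
    rcases Fin.eq_self_or_eq_succAbove i j with rfl | ⟨t, rfl⟩
    · exact absurd hj hi
    · exact ⟨X t, f_X i t⟩
  exact this hy

theorem f_mem_supported {i : Fin (l + 1)} {s : Set (Fin (l + 1))}
    (hi : ∀ t, i.succAbove t ∈ s) (y : P l) : f i y ∈ supported (ZMod 2) s := by
  induction y using MvPolynomial.induction_on with
  | C a => rw [f, rename_C]; exact Subalgebra.algebraMap_mem _ a
  | add y z hy hz => rw [map_add]; exact add_mem hy hz
  | mul_X y t hy => rw [map_mul, f_X]; exact mul_mem hy (X_mem_supported.2 (hi t))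

theorem f_proj_X_self (p : Idx (l + 1)) : f p.i (proj p (X p.i)) = ∑ j ∈ p.I, X j := by
  rw [proj_X_self, map_sum]
  simp only [f_X]
  have h : p.I = ({s | p.i.succAbove s ∈ p.I} : Finset (Fin l)).map p.i.succAboveEmb := by
    ext j
    simp only [Finset.mem_map, Finset.mem_filter, Finset.mem_univ, true_and]
    constructor
    · intro hj
      rcases Fin.eq_self_or_eq_succAbove p.i j with rfl | ⟨t, rfl⟩
      · exact absurd (p.lt _ hj) (lt_irrefl _)
      · exact ⟨t, hj, rfl⟩
    · rintro ⟨t, ht, rfl⟩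
      exact ht
  conv_rhs => rw [h, Finset.sum_map]
  rfl

theorem f_proj_X_succAbove (p : Idx (l + 1)) (s : Fin l) :
    f p.i (proj p (X (p.i.succAbove s))) = X (p.i.succAbove s) := by
  rw [proj_X_succAbove, f_X]

theorem sum_supp (p : Idx (l + 1)) :
    (∑ j ∈ p.supp, X j : P (l + 1)) = X p.i + ∑ j ∈ p.I, X j :=
  Finset.sum_insert fun h => lt_irrefl _ (p.lt _ h)

/-- Modulo $\sum_{j\in\{i\}\cup I}x_j$ one has $x_i=\sum_{j\in I}x_j$, which is what $f_i$ after
`proj p` substitutes. -/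
theorem exists_eq_f_proj_add (p : Idx (l + 1)) (y : P (l + 1)) :
    ∃ w, y = f p.i (proj p y) + (∑ j ∈ p.supp, X j) * w := by
  set J : Ideal (P (l + 1)) := Ideal.span {∑ j ∈ p.supp, X j}
  have : Ideal.Quotient.mkₐ (ZMod 2) J =
      (Ideal.Quotient.mkₐ (ZMod 2) J).comp ((f p.i).comp (proj p)) := by
    ext1 j
    rw [AlgHom.comp_apply, AlgHom.comp_apply]
    rcases Fin.eq_self_or_eq_succAbove p.i j with rfl | ⟨t, rfl⟩
    · rw [f_proj_X_self]
      refine Ideal.Quotient.eq.2 (Ideal.mem_span_singleton.2 ?_)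
      rw [sum_supp, CharTwo.sub_eq_add]
    · rw [f_proj_X_succAbove]
  have h := Ideal.Quotient.eq.1 (DFunLike.congr_fun this y)
  obtain ⟨w, hw⟩ := Ideal.mem_span_singleton.1 h
  refine ⟨w, ?_⟩
  rw [← hw]
  simp

theorem f_proj_mem_supported {p : Idx (l + 1)} {s : Set (Fin (l + 1))}
    (hs : ∀ j, j ∈ p.supp → j ∈ s) {y : P (l + 1)} (hy : y ∈ supported (ZMod 2) s) :
    f p.i (proj p y) ∈ supported (ZMod 2) (s \ {p.i}) := by
  have : supported (ZMod 2) s ≤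
      (supported (ZMod 2) (s \ {p.i})).comap ((f p.i).comp (proj p)) := by
    refine Algebra.adjoin_le ?_
    rintro _ ⟨j, hj, rfl⟩
    change f p.i (proj p (X j)) ∈ supported (ZMod 2) (s \ {p.i})
    rcases Fin.eq_self_or_eq_succAbove p.i j with rfl | ⟨t, rfl⟩
    · rw [f_proj_X_self]
      refine sum_mem fun t ht => X_mem_supported.2 ⟨hs t (Finset.mem_insert_of_mem ht), ?_⟩
      exact (p.lt t ht).ne'
    · rw [f_proj_X_succAbove]
      exact X_mem_supported.2 ⟨hj, Fin.succAbove_ne _ _⟩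
  exact this hy

/-! ### Families of maps with $\sum_jD_{S\cup j}(x_jw)=0$ -/

section Family

variable {M : Type*} [AddCommGroup M] [Module (ZMod 2) M]

theorem ZModModule_add_self (a : M) : a + a = 0 := by
  rw [← two_smul (ZMod 2) a, show (2 : ZMod 2) = 0 from rfl, zero_smul]

/-- The sets $S$ and $S\cup j$ give equal terms and cancel in pairs. -/
theorem sum_insert_eq_zero {ι : Type*} [Fintype ι] [DecidableEq ι] {T : Finset ι} {j : ι}
    (hj : j ∉ T) (F : Finset ι → M) : ∑ S with T ⊆ S, F (insert j S) = 0 := by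
  refine Finset.sum_involution (fun S _ => if j ∈ S then S.erase j else insert j S) ?_ ?_ ?_ ?_
  · intro S _
    split_ifs with h
    · rw [Finset.insert_erase h, Finset.insert_eq_of_mem h, ZModModule_add_self]
    · rw [Finset.insert_idem, ZModModule_add_self]
  · intro S _ _
    split_ifs with h
    · exact fun h' => Finset.notMem_erase j S (h'.symm ▸ h)
    · exact fun h' => h (h' ▸ Finset.mem_insert_self j S)
  · intro S hS
    rw [Finset.mem_filter] at hS ⊢
    refine ⟨Finset.mem_univ _, ?_⟩
    split_ifs with h
    · exact Finset.subset_erase.2 ⟨hS.2, hj⟩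
    · exact hS.2.trans (Finset.subset_insert _ _)
  · intro S _
    by_cases h : j ∈ S
    · simp only [if_pos h, Finset.notMem_erase, if_false, Finset.insert_erase h]
    · simp only [if_neg h, Finset.mem_insert_self, if_true, Finset.erase_insert h]

variable {D : Finset (Fin (l + 1)) → P (l + 1) →ₗ[ZMod 2] M}

/-- If the relation holds for all proper subsets then it holds for the full set of variables. -/
theorem relation_univ
    (hD : ∀ S, S ≠ Finset.univ → ∀ w, ∑ j, D (insert j S) (X j * w) = 0) (S : Finset (Fin (l + 1)))
    (w : P (l + 1)) : ∑ j, D (insert j S) (X j * w) = 0 := by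
  rcases ne_or_eq S Finset.univ with h | rfl
  · exact hD S h w
  -- Summed over all $S$, the relations cancel identically, so one of them follows from the others.
  have h : ∑ S with ∅ ⊆ S, ∑ j, D (insert j S) (X j * w) = 0 := by
    rw [Finset.sum_comm]
    exact Finset.sum_eq_zero fun j _ =>
      sum_insert_eq_zero (Finset.notMem_empty j) fun S => D S (X j * w)
  rw [← h]
  symm
  refine Finset.sum_eq_single _ (fun S _ hS => hD S hS w) fun h => ?_
  simp at h

/-- Add the relations over $S\supseteq T$: indices $j\notin T$ cancel in pairs, and for $j\in T$ the
set $S\cup j$ is $S$. -/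
theorem sum_superset_eq_zero (hD : ∀ S w, ∑ j, D (insert j S) (X j * w) = 0)
    (T : Finset (Fin (l + 1))) (w : P (l + 1)) :
    ∑ S with T ⊆ S, D S ((∑ j ∈ T, X j) * w) = 0 := by
  have h : ∑ S with T ⊆ S, ∑ j, D (insert j S) (X j * w) = 0 :=
    Finset.sum_eq_zero fun S _ => hD S w
  rw [Finset.sum_comm, ← Finset.sum_subset (Finset.subset_univ T)] at h
  · rw [← h]
    simp only [Finset.sum_mul, map_sum]
    rw [Finset.sum_comm]
    refine Finset.sum_congr rfl fun j hj => Finset.sum_congr rfl fun S hS => ?_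
    rw [Finset.insert_eq_of_mem ((Finset.mem_filter.1 hS).2 hj)]
  · exact fun j _ hj => sum_insert_eq_zero hj fun S => D S (X j * w)

theorem sum_superset_eq (hD : ∀ S w, ∑ j, D (insert j S) (X j * w) = 0)
    (p : Idx (l + 1)) (y : P (l + 1)) :
    ∑ S with p.supp ⊆ S, D S y = ∑ S with p.supp ⊆ S, D S (f p.i (proj p y)) := by
  obtain ⟨w, hw⟩ := exists_eq_f_proj_add p y
  conv_lhs => rw [hw]
  simp only [map_add, Finset.sum_add_distrib]
  rw [sum_superset_eq_zero hD, add_zero]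

/-- A family which satisfies the relations is generated by its values on `f_i(y)`, `i = min T`. -/
theorem mem_of_family (hD : ∀ S w, ∑ j, D (insert j S) (X j * w) = 0) {V : Submodule (ZMod 2) M}
    (hV : ∀ (p : Idx (l + 1)) (y : P l), D p.supp (f p.i y) ∈ V) {T : Finset (Fin (l + 1))}
    (hT : T.Nonempty) (y : P (l + 1)) : D T y ∈ V := by
  induction hn : Tᶜ.card using Nat.strong_induction_on generalizing T y with
  | _ n ih =>
    subst hn
    obtain ⟨p, rfl, -⟩ := exists_idx_supp_eq hT
    have hmem : p.supp ∈ ({S | p.supp ⊆ S} : Finset (Finset (Fin (l + 1)))) := by simp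
    -- All terms with $S\supsetneq T$ lie in $V$ by induction, which leaves $D_T(y)$ against its
    -- value on the image of $f_i$.
    have h := sum_superset_eq hD p y
    rw [← Finset.add_sum_erase _ _ hmem, ← Finset.add_sum_erase _ _ hmem] at h
    have hrest : ∀ y, ∑ S ∈ ({S | p.supp ⊆ S} : Finset (Finset (Fin (l + 1)))).erase p.supp,
        D S y ∈ V := by
      intro y
      refine Submodule.sum_mem _ fun S hS => ?_
      simp only [Finset.mem_erase, Finset.mem_filter, Finset.mem_univ, true_and] at hS
      refine ih _ ?_ (hT.mono hS.2) y rfl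
      exact Finset.card_lt_card (Finset.compl_ssubset_compl.2 (hS.2.ssubset_of_ne hS.1.symm))
    rw [← eq_sub_iff_add_eq] at h
    rw [h]
    exact sub_mem (add_mem (hV _ _) (hrest _)) (hrest _)

theorem monomial_mem_supported {s : Set (Fin (l + 1))} {c : Fin (l + 1) →₀ ℕ}
    (hc : ∀ j, c j ≠ 0 → j ∈ s) : (monomial c 1 : P (l + 1)) ∈ supported (ZMod 2) s := by
  rw [mem_supported, vars_monomial one_ne_zero]
  exact fun j hj => hc j (Finsupp.mem_support_iff.1 hj)

theorem mem_of_supported {s : Set (Fin (l + 1))} {V : Submodule (ZMod 2) (P (l + 1))}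
    (h : ∀ c : Fin (l + 1) →₀ ℕ, (∀ j, c j ≠ 0 → j ∈ s) → monomial c 1 ∈ V) {y : P (l + 1)}
    (hy : y ∈ supported (ZMod 2) s) : y ∈ V := by
  rw [y.as_sum]
  refine V.sum_mem fun a ha => ?_
  have h1 : monomial a (coeff a y) = (coeff a y) • (monomial a 1 : P (l + 1)) := by
    rw [smul_monomial, smul_eq_mul, mul_one]
  rw [h1]
  refine V.smul_mem _ (h a fun j hj => mem_supported.1 hy ?_)
  exact (mem_vars_iff_mem_support j).2 ⟨a, ha, Finsupp.mem_support_iff.2 hj⟩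

/-- The set of the variables after the `u`-th one. -/
def tail (l u : ℕ) : Finset (Fin (l + 1)) := {j | u < (j : ℕ)}

theorem mem_tail {u : ℕ} {j : Fin (l + 1)} : j ∈ tail l u ↔ u < (j : ℕ) := by simp [tail]

/-- The values on the full set of variables can be replaced by the values on the sets of the last
variables. -/
theorem mem_of_tails (hD : ∀ S w, ∑ j, D (insert j S) (X j * w) = 0) {V : Submodule (ZMod 2) M}
    (hV : ∀ (p : Idx (l + 1)) (y : P l), p.supp ≠ Finset.univ → D p.supp (f p.i y) ∈ V)
    (h1 : D Finset.univ 1 = 0)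
    (htail : ∀ (u : Fin l) (c : Fin (l + 1) →₀ ℕ), (∀ j, c j ≠ 0 → j ∈ tail l u) →
      c u.succ ≠ 0 → D (tail l u) (monomial c 1) ∈ V)
    {T : Finset (Fin (l + 1))} (hT : T.Nonempty) (y : P (l + 1)) : D T y ∈ V := by
  -- Induction on the number of available variables: each step eliminates the first variable of the
  -- tail, until only the constant 1 is left.
  have key : ∀ v u, u + v = l → ∀ y ∈ supported (ZMod 2) (tail l u : Set (Fin (l + 1))),
      D Finset.univ y ∈ V := by
    intro v
    induction v with
    | zero =>
      intro u hu y hy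
      refine mem_of_supported (V := V.comap (D Finset.univ)) (fun c hc => ?_) hy
      have hc0 : c = 0 := by
        ext j
        by_contra h
        have := mem_tail.1 (hc j h)
        omega
      rw [Submodule.mem_comap, hc0]
      have : (monomial 0 1 : P (l + 1)) = 1 := rfl
      rw [this, h1]
      exact zero_mem _
    | succ v ih =>
      intro u hu y hy
      refine mem_of_supported (V := V.comap (D Finset.univ)) (fun c hc => ?_) hy
      rw [Submodule.mem_comap]
      have hu' : u < l := by omega
      have hy := monomial_mem_supported hc
      have hne : (tail l u).Nonempty := ⟨(⟨u, hu'⟩ : Fin l).succ, mem_tail.2 (by simp)⟩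
      obtain ⟨p, hp, hpi⟩ := exists_idx_supp_eq hne
      have hpi' : p.i = (⟨u, hu'⟩ : Fin l).succ := by
        rw [hpi]
        refine le_antisymm (Finset.min'_le _ _ (mem_tail.2 (by simp))) ?_
        have := mem_tail.1 (Finset.min'_mem _ hne)
        rw [Fin.le_def, Fin.val_succ]
        exact this
      have hT0 : tail l u ≠ Finset.univ := fun h => by
        have := h ▸ Finset.mem_univ (0 : Fin (l + 1))
        rw [mem_tail] at this
        simp at this
      -- If the first variable of the tail is absent, the monomial lies in the image of $f_i$; if it
      -- is present, the hypothesis on tails applies.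
      have hT1 : D (tail l u) (monomial c 1) ∈ V := by
        by_cases hcu : c p.i = 0
        · have h2 : (monomial c 1 : P (l + 1)) ∈ supported (ZMod 2) {j | j ≠ p.i} :=
            monomial_mem_supported fun j hj hji => hj (hji ▸ hcu)
          obtain ⟨y', hy'⟩ := f_range_of_supported (i := p.i) (by simp) h2
          rw [← hy', ← hp]
          exact hV p y' (hp ▸ hT0)
        · exact htail ⟨u, hu'⟩ c hc (hpi' ▸ hcu)
      have h := sum_superset_eq hD p (monomial c 1)
      rw [hp] at h
      set y' := f p.i (proj p (monomial c 1))
      have hy1 : y' ∈ supported (ZMod 2) ((tail l u : Set (Fin (l + 1))) \ {p.i}) :=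
        f_proj_mem_supported (fun j hj => by rwa [hp] at hj) hy
      have hy2 : y' ∈ supported (ZMod 2) (tail l (u + 1) : Set (Fin (l + 1))) := by
        refine supported_mono ?_ hy1
        rintro j ⟨hj, hji⟩
        rw [Finset.mem_coe, mem_tail] at hj ⊢
        have : (j : ℕ) ≠ u + 1 := fun h => hji (by
          rw [Set.mem_singleton_iff, hpi']; exact Fin.ext (by simpa using h))
        omega
      have hy3 : y' ∈ supported (ZMod 2) (tail l u : Set (Fin (l + 1))) :=
        supported_mono Set.sdiff_subset hy1
      -- A proper superset of the tail has its minimum outside the tail, so a polynomial in the tail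
      -- variables is already in the image of the corresponding $f_i$.
      have hrest : ∀ y ∈ supported (ZMod 2) (tail l u : Set (Fin (l + 1))),
          D (tail l u) y ∈ V → ∑ S ∈ ({S | tail l u ⊆ S} :
            Finset (Finset (Fin (l + 1)))).erase Finset.univ, D S y ∈ V := by
        intro y hy hyT
        refine Submodule.sum_mem _ fun S hS => ?_
        simp only [Finset.mem_erase, Finset.mem_filter, Finset.mem_univ, true_and] at hS
        by_cases hST : S = tail l u
        · rwa [hST]
        obtain ⟨q, rfl, hqi⟩ := exists_idx_supp_eq (hne.mono hS.2)
        obtain ⟨j, hj, hjT⟩ := Finset.exists_of_ssubset (hS.2.ssubset_of_ne (Ne.symm hST))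
        have hq : q.i ∉ (tail l u : Set (Fin (l + 1))) := by
          rw [Finset.mem_coe, mem_tail]
          rw [mem_tail] at hjT
          have : q.i ≤ j := hqi ▸ Finset.min'_le _ _ hj
          rw [Fin.le_def] at this
          omega
        obtain ⟨z, rfl⟩ := f_range_of_supported hq hy
        exact hV q z hS.1
      have hmem : Finset.univ ∈ ({S | tail l u ⊆ S} : Finset (Finset (Fin (l + 1)))) := by simp
      rw [← Finset.add_sum_erase _ _ hmem, ← Finset.add_sum_erase _ _ hmem,
        ← eq_sub_iff_add_eq] at h
      rw [h]
      refine sub_mem (add_mem (ih (u + 1) (by omega) y' hy2) (hrest y' hy3 ?_)) (hrest _ hy hT1)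
      have := hV p (proj p (monomial c 1)) (hp ▸ hT0)
      rwa [hp] at this
  refine mem_of_family hD (fun p y => ?_) hT y
  by_cases hp : p.supp = Finset.univ
  · rw [hp]
    refine key l 0 (by omega) _ ?_
    have hpi : p.i = 0 := by
      have h0 : (0 : Fin (l + 1)) ∈ p.supp := hp ▸ Finset.mem_univ _
      rcases Finset.mem_insert.1 h0 with h | h
      · exact h.symm
      · exact absurd (p.lt _ h) (Fin.not_lt_zero _)
    exact f_mem_supported (fun t => by rw [Finset.mem_coe, mem_tail, hpi]; simp) y
  · exact hV p y hp

end Family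

/-! ### The family of word classes and its formal extension for $d=l$ -/

theorem exists_word {d : ℕ} {S : Finset (Fin (l + 1))} (hS : S.Nonempty) (hd : S.card ≤ d) :
    ∃ L : List (Fin (l + 1)), L.length = d ∧ L.toFinset = S := by
  obtain ⟨i, hi⟩ := hS
  refine ⟨List.replicate (d - S.card) i ++ S.toList, by simp; omega, ?_⟩
  ext j
  simp only [List.mem_toFinset, List.mem_append, List.mem_replicate, Finset.mem_toList]
  refine ⟨?_, Or.inr⟩
  rintro (⟨-, rfl⟩ | h)
  · exact hi
  · exact h

open Classical in
/-- The class of `op L y`, where `L` is a word of length `d` with set of letters `S` and `y` is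
replaced by its component of degree `m`. -/
noncomputable def wordClass (l d m : ℕ) (S : Finset (Fin (l + 1))) :
    P (l + 1) →ₗ[ZMod 2] P (l + 1) ⧸ hit (l + 1) :=
  if h : ∃ L : List (Fin (l + 1)), L.length = d ∧ L.toFinset = S then
    (mk (l + 1)).comp ((op h.choose).comp (homogeneousComponent m))
  else 0

theorem wordClass_toFinset (hN : DegreeSeq l N) (hl : 2 ≤ l) (L : List (Fin (l + 1)))
    (y : P (l + 1)) : wordClass l L.length (N 0) L.toFinset y =
      mk _ (op L (homogeneousComponent (N 0) y)) := by
  have h : ∃ L' : List (Fin (l + 1)), L'.length = L.length ∧ L'.toFinset = L.toFinset :=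
    ⟨L, rfl, rfl⟩
  rw [wordClass, dif_pos h]
  exact op_eq_of_toFinset hN hl h.choose_spec.1 h.choose_spec.2
    (homogeneousComponent_isHomogeneous _ _)

theorem wordClass_eq_zero_of_component {d m : ℕ} (S : Finset (Fin (l + 1))) {y : P (l + 1)}
    (hy : homogeneousComponent m y = 0) : wordClass l d m S y = 0 := by
  rw [wordClass]
  split_ifs
  · rw [LinearMap.comp_apply, LinearMap.comp_apply, hy, map_zero, map_zero]
  · rfl

theorem wordClass_eq_zero_of_hit (hN : DegreeSeq l N) {d : ℕ} (S : Finset (Fin (l + 1)))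
    {y : P (l + 1)} (hy : y ∈ hit (l + 1)) : wordClass l d (N 0) S y = 0 := by
  rw [wordClass]
  split_ifs
  · rw [LinearMap.comp_apply, LinearMap.comp_apply, mk_eq_zero]
    exact op_mem_hit hN _ (homogeneousComponent_mem_hit hy) (homogeneousComponent_isHomogeneous _ _)
  · rfl

/-- For $S\ne\emptyset$ apply a word of length $d-1$ with letters $S$ to the hit element $\sum_j$
`kapE j` $(x_jv)$. For $S=\emptyset$ use the relation for the words $j\cdots j$. -/
theorem wordClass_relation (hN : DegreeSeq l N) (hl : 2 ≤ l) (hN0 : 0 < N 0) {d : ℕ}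
    {S : Finset (Fin (l + 1))} (hS : S.card < d) (w : P (l + 1)) :
    ∑ j, wordClass l d (N 0) (insert j S) (X j * w) = 0 := by
  obtain ⟨m, hm⟩ : ∃ m, N 0 = m + 1 := ⟨N 0 - 1, by omega⟩
  obtain ⟨d, rfl⟩ : ∃ d', d = d' + 1 := ⟨d - 1, by omega⟩
  set v := homogeneousComponent m w
  have hv : v.IsHomogeneous m := homogeneousComponent_isHomogeneous _ _
  have hXv : ∀ j, (X j * v).IsHomogeneous (N 0) := fun j => by
    have := (isHomogeneous_X (ZMod 2) j).mul hv
    rwa [add_comm 1 m, ← hm] at this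
  rcases S.eq_empty_or_nonempty with rfl | hne
  · have h : ∀ j, wordClass l (d + 1) (N 0) (insert j ∅) (X j * w) =
        mk _ (op (List.replicate (d + 1) j) (X j * v)) := by
      intro j
      have := wordClass_toFinset hN hl (List.replicate (d + 1) j) (X j * w)
      rwa [List.length_replicate, List.toFinset_replicate_of_ne_zero (by omega), hm,
        homogeneousComponent_X_mul, ← hm] at this
    rw [Finset.sum_congr rfl fun j _ => h j, ← map_sum, mk_eq_zero]
    exact sum_op_replicate_mem_hit d v
  · obtain ⟨L, hL, hLS⟩ := exists_word hne (Nat.lt_succ_iff.1 hS)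
    have h : ∀ j, wordClass l (d + 1) (N 0) (insert j S) (X j * w) =
        mk _ (op L (kapE j (X j * v))) := by
      intro j
      have := wordClass_toFinset hN hl (L ++ [j]) (X j * w)
      rw [List.length_append, List.length_singleton, hL, List.toFinset_append, hLS, hm,
        homogeneousComponent_X_mul, ← hm, op_append, op_cons, op_nil, Finset.union_comm] at this
      exact this
    rw [Finset.sum_congr rfl fun j _ => h j, ← map_sum, ← map_sum, mk_eq_zero]
    exact op_mem_hit (e := 1) hN L (sum_kapE_X_mul_mem_hit v) (IsHomogeneous.sum _ _ _ fun j _ =>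
      kap_isHomogeneous_succ hN (card_univ_erase j) (hXv j))

/-- The prospective value of the class for the full set of variables at `x_q w`, when there is no
word with all the variables. -/
noncomputable def virtualClass (l d m : ℕ) (q : Fin (l + 1)) :
    P (l + 1) →ₗ[ZMod 2] P (l + 1) ⧸ hit (l + 1) :=
  (wordClass l d m (Finset.univ.erase q)).comp
    (LinearMap.mulLeft (ZMod 2) (∑ j ∈ Finset.univ.erase q, X j))

theorem virtualClass_apply (d m : ℕ) (q : Fin (l + 1)) (w : P (l + 1)) :
    virtualClass l d m q w =
      wordClass l d m (Finset.univ.erase q) ((∑ j ∈ Finset.univ.erase q, X j) * w) := rfl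

theorem Sq_one_sum_X {k : ℕ} (A : Finset (Fin k)) :
    Sq k 1 (∑ j ∈ A, X j) = (∑ j ∈ A, X j) ^ 2 := by
  rw [Sq_apply, totalSq_sum_X, Polynomial.coeff_add, Polynomial.coeff_C_succ,
    Polynomial.coeff_C_mul, Polynomial.coeff_X_one, zero_add, mul_one]

/-- This is the consistency needed to define a value on $x_px_qw$ through either variable. It comes
from the relation for the complement $T$ of $\{p,q\}$ at a suitable $v$. -/
theorem virtualClass_symm (hN : DegreeSeq l N) (hl : 2 ≤ l) (hN0 : 0 < N 0) (p q : Fin (l + 1))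
    (w : P (l + 1)) :
    virtualClass l l (N 0) q (X p * w) = virtualClass l l (N 0) p (X q * w) := by
  rcases eq_or_ne p q with rfl | hpq
  · rfl
  set T : Finset (Fin (l + 1)) := (Finset.univ.erase q).erase p with hT
  have hp : p ∈ (Finset.univ.erase q : Finset (Fin (l + 1))) := by simp [hpq]
  have hq : q ∈ (Finset.univ.erase p : Finset (Fin (l + 1))) := by simp [hpq.symm]
  have hT' : T = (Finset.univ.erase p).erase q := Finset.erase_right_comm
  have hTcard : T.card = l - 1 := by
    rw [hT, Finset.card_erase_of_mem hp, card_univ_erase]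
  set σ : P (l + 1) := ∑ j ∈ T, X j
  have hσq : (∑ j ∈ Finset.univ.erase q, X j : P (l + 1)) = X p + σ :=
    (Finset.add_sum_erase _ _ hp).symm
  have hσp : (∑ j ∈ Finset.univ.erase p, X j : P (l + 1)) = X q + σ := by
    rw [← Finset.add_sum_erase _ _ hq, ← hT']
  have hSqX : ∀ j, Sq (l + 1) 1 (X j) = X j ^ 2 := fun j => by rw [Sq_X]; simp
  -- Chosen so that $\sigma v=Sq^1(\sigma w)$ is hit, while $x_pv=(x_p+\sigma)x_pw+Sq^1(x_pw)$, and
  -- likewise for $q$.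
  set v : P (l + 1) := σ * w + Sq (l + 1) 1 w
  have h := wordClass_relation (d := l) hN hl hN0 (S := T) (by omega) v
  rw [← Finset.sum_erase_add _ _ (Finset.mem_univ q), ← Finset.sum_erase_add _ _ hp, ← hT] at h
  have h1 : ∑ j ∈ T, wordClass l l (N 0) (insert j T) (X j * v) = 0 := by
    have h2 : ∀ j ∈ T, wordClass l l (N 0) (insert j T) (X j * v) =
        wordClass l l (N 0) T (X j * v) := fun j hj => by rw [Finset.insert_eq_of_mem hj]
    rw [Finset.sum_congr rfl h2, ← map_sum, ← Finset.sum_mul]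
    have h3 : (∑ j ∈ T, X j) * v = Sq (l + 1) 1 (σ * w) := by
      rw [Sq_one_mul, Sq_one_sum_X]; ring
    rw [h3]
    exact wordClass_eq_zero_of_hit hN T (Sq_mem_hit one_pos _)
  have h4 : insert p T = Finset.univ.erase q := Finset.insert_erase hp
  have h5 : insert q T = Finset.univ.erase p := by rw [hT']; exact Finset.insert_erase hq
  have key : ∀ j i : Fin (l + 1), (∑ s ∈ Finset.univ.erase i, X s : P (l + 1)) = X j + σ →
      wordClass l l (N 0) (Finset.univ.erase i) (X j * v) =
        virtualClass l l (N 0) i (X j * w) := by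
    intro j i hji
    have h6 : X j * v = (X j + σ) * (X j * w) + Sq (l + 1) 1 (X j * w) := by
      rw [Sq_one_mul, hSqX]
      linear_combination (-X j ^ 2 * w) * (CharTwo.two_eq_zero : (2 : P (l + 1)) = 0)
    rw [h6, map_add, wordClass_eq_zero_of_hit hN _ (Sq_mem_hit one_pos _), add_zero,
      virtualClass_apply, hji]
  rw [h1, zero_add, h4, h5, key p q hσq, key q p hσp] at h
  exact ZModModule_eq_of_add_eq_zero h

open Classical in
/-- The value for the full set of variables when there is no word with all the variables. -/
noncomputable def fullClass (l m : ℕ) : P (l + 1) →ₗ[ZMod 2] P (l + 1) ⧸ hit (l + 1) :=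
  (basisMonomials (Fin (l + 1)) (ZMod 2)).constr (ZMod 2) fun c =>
    if h : c.support.Nonempty then
      virtualClass l l m (c.support.min' h) (monomial (c - Finsupp.single (c.support.min' h) 1) 1)
    else 0

theorem fullClass_one (m : ℕ) : fullClass l m 1 = 0 := by
  have : (1 : P (l + 1)) = basisMonomials (Fin (l + 1)) (ZMod 2) 0 := by
    rw [coe_basisMonomials]; rfl
  rw [fullClass, this, Module.Basis.constr_basis, dif_neg (by simp)]

/-- By `virtualClass_symm` the choice of the first variable in the definition is immaterial. -/
theorem fullClass_X_mul (hN : DegreeSeq l N) (hl : 2 ≤ l) (hN0 : 0 < N 0) (q : Fin (l + 1))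
    (w : P (l + 1)) : fullClass l (N 0) (X q * w) = virtualClass l l (N 0) q w := by
  have : w ∈ LinearMap.eqLocus ((fullClass l (N 0)).comp (LinearMap.mulLeft (ZMod 2) (X q)))
      (virtualClass l l (N 0) q) := by
    refine mem_of_monomials (fun a => ?_) w
    have hX : ∀ (j : Fin (l + 1)) (c : Fin (l + 1) →₀ ℕ),
        (X j * monomial c 1 : P (l + 1)) = monomial (Finsupp.single j 1 + c) 1 := fun j c => by
      rw [X, monomial_mul, one_mul]
    rw [LinearMap.mem_eqLocus, LinearMap.comp_apply, LinearMap.mulLeft_apply, hX, fullClass,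
      ← congrFun (coe_basisMonomials (Fin (l + 1)) (ZMod 2)) (Finsupp.single q 1 + a),
      Module.Basis.constr_basis]
    set c := Finsupp.single q 1 + a with hc
    have hne : c.support.Nonempty := ⟨q, by simp [hc]⟩
    rw [dif_pos hne]
    set i := c.support.min' hne
    have hi : c i ≠ 0 := Finsupp.mem_support_iff.1 (Finset.min'_mem _ hne)
    rcases eq_or_ne i q with h | h
    · rw [h, hc, add_tsub_cancel_left]
    · have hai : a i ≠ 0 := by
        rwa [hc, Finsupp.add_apply, Finsupp.single_eq_of_ne h, zero_add] at hi
      have h1 : a = Finsupp.single i 1 + (a - Finsupp.single i 1) := by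
        rw [add_tsub_cancel_of_le]
        rw [Finsupp.single_le_iff]; omega
      have h2 : c - Finsupp.single i 1 = Finsupp.single q 1 + (a - Finsupp.single i 1) := by
        rw [hc]
        conv_lhs => rw [h1]
        rw [← add_assoc, add_comm (Finsupp.single q 1), add_assoc, add_tsub_cancel_left]
      rw [h2, ← hX, virtualClass_symm hN hl hN0, hX, ← h1]
  exact this

/-- A family which satisfies all the relations and is given by the words of length `d`. -/
theorem exists_family (hN : DegreeSeq l N) (hl : 2 ≤ l) (hN0 : 0 < N 0) {d : ℕ} (hd : l ≤ d) :
    ∃ D : Finset (Fin (l + 1)) → P (l + 1) →ₗ[ZMod 2] P (l + 1) ⧸ hit (l + 1),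
      (∀ S w, ∑ j, D (insert j S) (X j * w) = 0) ∧ D Finset.univ 1 = 0 ∧
        ∀ (L : List (Fin (l + 1))) (y : P (l + 1)), L.length = d →
          D L.toFinset y = mk _ (op L (homogeneousComponent (N 0) y)) := by
  rcases hd.lt_or_eq with hd | rfl
  · refine ⟨wordClass l d (N 0), ?_, wordClass_eq_zero_of_component _ ?_, ?_⟩
    · refine relation_univ fun S hS w => wordClass_relation hN hl hN0 ?_ w
      have h1 : S.card < l + 1 := by
        simpa using Finset.card_lt_card (Finset.ssubset_univ_iff.2 hS)
      omega
    · have h1 : (1 : P (l + 1)) = monomial 0 1 := rfl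
      rw [h1, homogeneousComponent_monomial, if_neg]
      simp; omega
    · rintro L y rfl
      exact wordClass_toFinset hN hl L y
  · have hne : ∀ {S : Finset (Fin (l + 1))}, S ≠ Finset.univ →
        Function.update (wordClass l l (N 0)) Finset.univ (fullClass l (N 0)) S =
          wordClass l l (N 0) S := fun h => Function.update_of_ne h _ _
    refine ⟨Function.update (wordClass l l (N 0)) Finset.univ (fullClass l (N 0)), ?_, ?_, ?_⟩
    · refine relation_univ fun S hS w => ?_
      have h1 : S.card < l + 1 := by
        simpa using Finset.card_lt_card (Finset.ssubset_univ_iff.2 hS)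
      rcases (Nat.lt_succ_iff.1 h1).lt_or_eq with h | h
      · rw [← wordClass_relation hN hl hN0 h w]
        refine Finset.sum_congr rfl fun j _ => ?_
        rw [hne]
        intro h2
        have h3 := Finset.card_insert_le j S
        rw [h2, Finset.card_univ, Fintype.card_fin] at h3
        omega
      -- For $S$ missing only $q$, the relation is exactly what defines the full class on $x_qw$.
      · have h2 : Sᶜ.card = 1 := by rw [Finset.card_compl, Fintype.card_fin]; omega
        obtain ⟨q, hq⟩ := Finset.card_eq_one.1 h2
        have hSq : S = Finset.univ.erase q := by
          rw [← compl_compl S, hq, Finset.compl_singleton]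
        subst hSq
        rw [← Finset.sum_erase_add _ _ (Finset.mem_univ q), Finset.insert_erase (Finset.mem_univ q),
          Function.update_self, fullClass_X_mul hN hl hN0, virtualClass_apply, Finset.sum_mul,
          map_sum]
        have h3 : ∀ j ∈ (Finset.univ.erase q : Finset (Fin (l + 1))),
            Function.update (wordClass l l (N 0)) Finset.univ (fullClass l (N 0))
              (insert j (Finset.univ.erase q)) (X j * w) =
            wordClass l l (N 0) (Finset.univ.erase q) (X j * w) := fun j hj => by
          rw [Finset.insert_eq_of_mem hj, hne hS]
        rw [Finset.sum_congr rfl h3, ZModModule_add_self]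
    · rw [Function.update_self, fullClass_one]
    · intro L y hL
      rw [hne]
      · have := wordClass_toFinset hN hl L y
        rwa [hL] at this
      · intro h
        have := L.toFinset_card_le
        rw [h, Finset.card_univ, Fintype.card_fin] at this
        omega

/-! ### Spanning by the values of $\phi$ -/

theorem f_homogeneousComponent (i : Fin (l + 1)) (m : ℕ) (y : P l) :
    f i (homogeneousComponent m y) = homogeneousComponent m (f i y) :=
  rename_homogeneousComponent m y

theorem exists_f_eq_monomial {i : Fin (l + 1)} {c : Fin (l + 1) →₀ ℕ} (hc : c i = 0) :
    ∃ b : Fin l →₀ ℕ, f i (monomial b 1) = monomial c 1 ∧ b.degree = c.degree ∧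
      ∀ s, b s = c (i.succAbove s) := by
  set b : Fin l →₀ ℕ := Finsupp.equivFunOnFinite.symm fun s => c (i.succAbove s)
  have hb : b.mapDomain i.succAbove = c := by
    ext j
    rcases Fin.eq_self_or_eq_succAbove i j with rfl | ⟨t, rfl⟩
    · rw [hc, Finsupp.mapDomain_of_notMem_range]
      simp
    · rw [Finsupp.mapDomain_apply Fin.succAbove_right_injective]
      rfl
  refine ⟨b, ?_, ?_, fun s => rfl⟩
  · rw [f, rename_monomial, hb]
  · rw [← hb, Finsupp.degree_mapDomain]

/-- The classes in degree `N d` are spanned by the images under the maps `φ_{(i;I)}` of the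
polynomials whose exponents end in `d` ones. -/
theorem mk_mem_of_phi_mem (hN : DegreeSeq l N) (hl : 2 ≤ l) (hN0 : 0 < N 0) {d : ℕ} (hd : l ≤ d)
    {V : Submodule (ZMod 2) (P (l + 1) ⧸ hit (l + 1))}
    (hV : ∀ (p : Idx (l + 1)) (y : P l), y.IsHomogeneous (N 0) →
      mk _ (phi p (kapU l d y)) ∈ V) {w : P (l + 1)} (hw : w.IsHomogeneous (N d)) :
    mk _ w ∈ V := by
  obtain ⟨D, hD, hD1, hDop⟩ := exists_family hN hl hN0 hd
  have hlt : ∀ (p : Idx (l + 1)) (y : P l), p.r < d → D p.supp (f p.i y) ∈ V := by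
    intro p y hp
    obtain ⟨L, hL, hLp, hLphi⟩ := exists_word_of_lt p hp
    rw [← hLp, hDop L _ hL, ← f_homogeneousComponent, ← hLphi]
    exact hV p _ (homogeneousComponent_isHomogeneous _ _)
  have hDV : ∀ {T : Finset (Fin (l + 1))} (_ : T.Nonempty) (y : P (l + 1)), D T y ∈ V := by
    intro T hT y
    rcases hd.lt_or_eq with hd | rfl
    · exact mem_of_family hD (fun p y => hlt p y (p.r_le.trans_lt hd)) hT y
    · refine mem_of_tails hD (fun p y hp => hlt p y ?_) hD1 (fun u c hc hcu => ?_) hT y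
      · exact p.r_le.lt_of_ne fun h => hp (Idx.supp_eq_univ h)
      -- The values on tails come from the single index with $\ell(I)=l$, whose words have the
      -- variables after the $u$-th as letters.
      · let p : Idx (l + 1) := ⟨0, Finset.univ.erase 0, fun j hj =>
          Fin.pos_of_ne_zero (Finset.ne_of_mem_erase hj)⟩
        have hp : p.r = l := card_univ_erase 0
        obtain ⟨L, hL, hLu, hLphi⟩ := exists_word_of_eq hp (by omega) u
        have h0 : c 0 = 0 := by
          by_contra h
          have := mem_tail.1 (hc 0 h)
          simp at this
        obtain ⟨b, hb, hbdeg, hbc⟩ := exists_f_eq_monomial h0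
        have hLt : L.toFinset = tail l u := hLu
        rw [← hLt, hDop L _ hL, homogeneousComponent_monomial]
        split_ifs with hdeg
        · rw [← hb]
          change mk _ (op L (f p.i (monomial b 1))) ∈ V
          rw [← hLphi b]
          · exact hV p _ (isHomogeneous_monomial _ (hbdeg.trans hdeg))
          · rw [hbc, Fin.succAbove_zero]; exact Nat.pos_of_ne_zero hcu
          · intro t ht
            rw [hbc, Fin.succAbove_zero]
            by_contra h
            have := mem_tail.1 (hc _ h)
            rw [Fin.val_succ] at this
            rw [Fin.lt_def] at ht
            omega
        · rw [map_zero, map_zero]; exact zero_mem _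
  refine mem_of_isHomogeneous (V := V.comap (mk _)) (fun c hc => ?_) hw
  rw [Submodule.mem_comap]
  rcases col_ne_or_eq_op hN d hc with ⟨b, hb, hcol⟩ | ⟨L, c', hL, hc', h⟩
  · rw [mk_eq_zero.2 (monomial_mem_hit_of_col hN le_rfl hb hc hcol)]
    exact zero_mem _
  · have h1 := hDop L (monomial c' 1) hL
    rw [homogeneousComponent_monomial, if_pos hc', ← h] at h1
    rw [← h1]
    refine hDV ?_ _
    rw [List.toFinset_nonempty_iff]
    rintro rfl
    simp at hL
    omega

/-! ### Counting indices and the evaluation map -/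

theorem Idx.supp_injective :
    Function.Injective (Idx.supp : Idx (l + 1) → Finset (Fin (l + 1))) := by
  have hmin : ∀ (p : Idx (l + 1)) (j : Fin (l + 1)), j ∈ p.supp → p.i ≤ j := by
    intro p j hj
    rcases Finset.mem_insert.1 hj with rfl | h
    · exact le_rfl
    · exact (p.lt j h).le
  have hI : ∀ p : Idx (l + 1), p.I = p.supp.erase p.i := fun p => by
    rw [Idx.supp, Finset.erase_insert fun h => lt_irrefl _ (p.lt _ h)]
  intro p q h
  have hi : p.i = q.i := le_antisymm
    (hmin p _ (h ▸ Finset.mem_insert_self _ _)) (hmin q _ (h ▸ Finset.mem_insert_self _ _))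
  exact Idx.ext hi (by rw [hI p, hI q, h, hi])

instance : Finite (Idx (l + 1)) := Finite.of_injective _ Idx.supp_injective

/-- A pair $(i;I)$ is a nonempty set of variables with its minimum singled out. -/
theorem card_idx : Nat.card (Idx (l + 1)) = 2 ^ (l + 1) - 1 := by
  have e : Idx (l + 1) ≃ {T : Finset (Fin (l + 1)) // T ≠ ∅} :=
    Equiv.ofBijective (fun p => ⟨p.supp, Finset.insert_ne_empty _ _⟩)
      ⟨fun p q h => Idx.supp_injective (congrArg Subtype.val h), fun T => by
        obtain ⟨p, hp, -⟩ := exists_idx_supp_eq (Finset.nonempty_iff_ne_empty.2 T.2)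
        exact ⟨p, Subtype.ext hp⟩⟩
  rw [Nat.card_congr e, Nat.card_eq_fintype_card, Fintype.card_subtype_compl]
  simp

theorem proj_sum_supp (p : Idx (l + 1)) : proj p (∑ j ∈ p.supp, X j) = 0 := by
  rw [← proj_f p (proj p (∑ j ∈ p.supp, X j)), sum_supp, map_add, map_add, f_proj_X_self, map_sum,
    map_sum]
  have h : ∀ j ∈ p.I, f p.i (proj p (X j)) = X j := by
    intro j hj
    rcases Fin.eq_self_or_eq_succAbove p.i j with rfl | ⟨t, rfl⟩
    · exact absurd (p.lt _ hj) (lt_irrefl _)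
    · exact f_proj_X_succAbove p t
  rw [Finset.sum_congr rfl h, CharTwo.add_self_eq_zero, map_zero]

/-- The map to the product of the `(QP_{k-1})_n` given by all the substitutions `proj p`. -/
noncomputable def evalMap (l : ℕ) :
    P (l + 1) ⧸ hit (l + 1) →ₗ[ZMod 2] (Idx (l + 1) → P l ⧸ hit l) :=
  (hit (l + 1)).liftQ (LinearMap.pi fun p => (mk l).comp (proj p).toLinearMap) fun w hw => by
    rw [LinearMap.mem_ker]
    ext1 p
    exact mk_eq_zero.2 (hit_of_linear _ (proj_linear p) hw)

theorem evalMap_mk (w : P (l + 1)) (p : Idx (l + 1)) :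
    evalMap l (mk _ w) p = mk l (proj p w) := rfl

theorem evalMap_op (hN : DegreeSeq l N) (hl : 2 ≤ l) (L : List (Fin (l + 1))) {w : P (l + 1)}
    (hw : w.IsHomogeneous (N 0)) (p : Idx (l + 1)) : evalMap l (mk _ (op L w)) p =
      if L.toFinset ⊆ p.supp then mk l (kapU l L.length (proj p w)) else 0 := by
  rw [evalMap_mk, mk_proj_op hN hl p L hw]

-- Descending induction on $\{i\}\cup I$: a word with exactly these letters evaluates to the desired
-- coordinate plus coordinates at strictly larger sets.
open Classical in
theorem single_mem_map_evalMap (hN : DegreeSeq l N) (hl : 2 ≤ l) (hN0 : 0 < N 0) {d : ℕ}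
    (hd : l ≤ d) (p : Idx (l + 1)) {y : P l} (hy : y.IsHomogeneous (N 0)) :
    Pi.single p (mk l (kapU l d y)) ∈
      ((homogeneousSubmodule (Fin (l + 1)) (ZMod 2) (N d)).map (mk (l + 1))).map (evalMap l) := by
  set H := ((homogeneousSubmodule (Fin (l + 1)) (ZMod 2) (N d)).map (mk (l + 1))).map (evalMap l)
  have hop : ∀ (L : List (Fin (l + 1))) {w : P (l + 1)}, L.length = d → w.IsHomogeneous (N 0) →
      evalMap l (mk _ (op L w)) ∈ H := by
    intro L w hL hw
    have := op_isHomogeneous hN L hw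
    rw [zero_add, hL] at this
    exact ⟨_, ⟨_, this, rfl⟩, rfl⟩
  induction hn : p.suppᶜ.card using Nat.strong_induction_on generalizing p y with
  | _ n ih =>
    subst hn
    by_cases hp : p.supp = Finset.univ
    · obtain ⟨m, hm⟩ : ∃ m, N 0 = m + 1 := ⟨N 0 - 1, by omega⟩
      refine mem_of_isHomogeneous (V := H.comap
        ((LinearMap.single (ZMod 2) (fun _ : Idx (l + 1) => P l ⧸ hit l) p).comp
          ((mk l).comp (kapU l d)))) (fun b hb => ?_) hy
      change Pi.single p (mk l (kapU l d (monomial b 1))) ∈ H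
      have hb0 : b ≠ 0 := by
        rintro rfl
        simp at hb; omega
      obtain ⟨s, hs⟩ := Finsupp.support_nonempty_iff.2 hb0
      rw [Finsupp.mem_support_iff] at hs
      have hbs : b = Finsupp.single s 1 + (b - Finsupp.single s 1) := by
        rw [add_tsub_cancel_of_le]
        rw [Finsupp.single_le_iff]; omega
      set w : P l := monomial (b - Finsupp.single s 1) 1
      have hbw : monomial b 1 = X s * w := by
        rw [X, monomial_mul, one_mul, ← hbs]
      have hw : w.IsHomogeneous m := by
        refine isHomogeneous_monomial _ ?_
        have := congrArg Finsupp.degree hbs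
        rw [map_add, Finsupp.degree_single, hb, hm] at this
        omega
      set q := p.i.succAbove s
      have hne : (Finset.univ.erase q : Finset (Fin (l + 1))).Nonempty := by
        rw [← Finset.card_pos, card_univ_erase]; exact s.pos
      obtain ⟨L, hL, hLq⟩ := exists_word (d := d) hne (by rw [card_univ_erase]; exact hd)
      -- A word with all $l+1$ letters does not exist when $d=l$, so a word omitting $q$ is used.
      -- The factor $\sum_{j\ne q}x_j$ is killed by the substitution for the complement of $q$, and
      -- for the full set it has the same image $x_s$ as $x_q$.
      have hz : ((∑ j ∈ Finset.univ.erase q, X j) * f p.i w : P (l + 1)).IsHomogeneous (N 0) := by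
        have := (IsHomogeneous.sum (Finset.univ.erase q) _ 1 fun j _ =>
          isHomogeneous_X (ZMod 2) j).mul (isHomogeneous_of_linear _ (f_linear p.i) hw)
        rwa [add_comm 1 m, ← hm] at this
      convert hop L hL hz using 1
      ext1 p'
      rw [evalMap_op hN hl L hz, hLq, hL]
      rcases eq_or_ne p' p with rfl | hp'
      · rw [Pi.single_eq_same, hp, if_pos (Finset.subset_univ _), map_mul, proj_f, hbw]
        have h1 := proj_sum_supp p'
        rw [hp, ← Finset.add_sum_erase _ _ (Finset.mem_univ q), map_add, proj_X_succAbove] at h1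
        rw [ZModModule_eq_of_add_eq_zero h1]
      · rw [Pi.single_eq_of_ne hp']
        split_ifs with h
        · have h1 : p'.supp = Finset.univ.erase q := by
            refine (Finset.eq_of_subset_of_card_le h ?_).symm
            rw [card_univ_erase]
            have h2 : p'.supp ≠ Finset.univ := fun h => hp' (Idx.supp_injective (h.trans hp.symm))
            have := Finset.card_lt_card (Finset.ssubset_univ_iff.2 h2)
            rw [Finset.card_univ, Fintype.card_fin] at this
            omega
          rw [map_mul, ← h1, proj_sum_supp, zero_mul, map_zero, map_zero]
        · rfl
    · have hcard : p.supp.card ≤ d := by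
        have := Finset.card_lt_card (Finset.ssubset_univ_iff.2 hp)
        rw [Finset.card_univ, Fintype.card_fin] at this
        omega
      obtain ⟨L, hL, hLp⟩ := exists_word (Finset.insert_nonempty _ _) hcard
      have hfy := isHomogeneous_of_linear _ (f_linear p.i) hy
      have h1 := hop L hL hfy
      have := Fintype.ofFinite (Idx (l + 1))
      have hLp' : L.toFinset = p.supp := hLp
      have h2 := Finset.univ_sum_single (evalMap l (mk _ (op L (f p.i y))))
      rw [← Finset.add_sum_erase _ _ (Finset.mem_univ p), evalMap_op hN hl L hfy, hLp', hL,
        if_pos (Finset.Subset.refl _), proj_f] at h2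
      rw [← eq_sub_iff_add_eq] at h2
      rw [h2]
      refine sub_mem h1 (Submodule.sum_mem _ fun q hq => ?_)
      rw [evalMap_op hN hl L hfy, hLp', hL]
      split_ifs with h
      · refine ih _ ?_ q (isHomogeneous_of_linear _ (proj_linear q) hfy) rfl
        refine Finset.card_lt_card (Finset.compl_ssubset_compl.2 (h.ssubset_of_ne fun h' => ?_))
        exact (Finset.mem_erase.1 hq).1 (Idx.supp_injective h').symm
      · rw [Pi.single_zero]; exact zero_mem _

/-! ### Minimal generating sets and the conclusion -/

theorem isGeneratingSet_iff {k n : ℕ} {S : Set (P k)} : IsGeneratingSet k n S ↔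
    S ⊆ homogeneousSubmodule (Fin k) (ZMod 2) n ∧
      (homogeneousSubmodule (Fin k) (ZMod 2) n).map (mk k) ≤
        Submodule.span (ZMod 2) (mk k '' S) := by
  rw [IsGeneratingSet, ← Submodule.map_span, Submodule.map_le_iff_le_comap,
    Submodule.comap_map_eq, Submodule.ker_mkQ]

theorem linearIndependent_of_isMinimalGeneratingSet {k n : ℕ} {S : Set (P k)}
    (hS : IsMinimalGeneratingSet k n S) :
    LinearIndependent (ZMod 2) fun s : S => mk k s := by
  rw [linearIndependent_iff_notMem_span]
  intro s hs
  have himage : (fun s : S => mk k s) '' (Set.univ \ {s}) = mk k '' (S \ {s.1}) := by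
    ext x
    constructor
    · rintro ⟨t, ⟨-, ht⟩, rfl⟩
      exact ⟨t, ⟨t.2, fun h => ht (Subtype.ext h)⟩, rfl⟩
    · rintro ⟨t, ⟨ht, hts⟩, rfl⟩
      exact ⟨⟨t, ht⟩, ⟨Set.mem_univ _, fun h => hts (congrArg Subtype.val h)⟩, rfl⟩
  rw [himage] at hs
  obtain ⟨hSn, hSspan⟩ := isGeneratingSet_iff.1 hS.prop
  have hgen : IsGeneratingSet k n (S \ {s.1}) := by
    refine isGeneratingSet_iff.2 ⟨Set.sdiff_subset.trans hSn, hSspan.trans ?_⟩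
    rw [Submodule.span_le]
    rintro _ ⟨t, ht, rfl⟩
    by_cases hts : t = s.1
    · rw [hts]; exact hs
    · exact Submodule.subset_span ⟨t, ⟨ht, hts⟩, rfl⟩
  exact (hS.le_of_le hgen Set.sdiff_subset s.2).2 rfl

theorem isMinimalGeneratingSet_of_linearIndependent {k n : ℕ} {S : Set (P k)}
    (hS : IsGeneratingSet k n S) (hli : LinearIndependent (ZMod 2) fun s : S => mk k s) :
    IsMinimalGeneratingSet k n S := by
  refine ⟨hS, fun T hT hTS s hs => ?_⟩
  by_contra hsT
  have hmem : mk k s ∈ Submodule.span (ZMod 2) (mk k '' T) :=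
    (isGeneratingSet_iff.1 hT).2 ⟨s, (isGeneratingSet_iff.1 hS).1 hs, rfl⟩
  refine hli.notMem_span_image (s := {t | t.1 ∈ T}) (x := ⟨s, hs⟩) hsT ?_
  convert hmem using 2
  ext x
  constructor
  · rintro ⟨t, ht, rfl⟩; exact ⟨t, ht, rfl⟩
  · rintro ⟨t, ht, rfl⟩; exact ⟨⟨t, hTS ht⟩, ht, rfl⟩

theorem finite_of_linearIndependent {k n : ℕ} {S : Set (P k)}
    (hS : S ⊆ homogeneousSubmodule (Fin k) (ZMod 2) n)
    (hli : LinearIndependent (ZMod 2) fun s : S => mk k s) : Finite S := by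
  set W := (homogeneousSubmodule (Fin k) (ZMod 2) n).map (mk k)
  have : Module.Finite (ZMod 2) W :=
    Module.Finite.iff_fg.2 ((homogeneousSubmodule_fg _ _ n).map (mk k))
  let v : S → W := fun s => ⟨mk k s, s, hS s.2, rfl⟩
  have hv : LinearIndependent (ZMod 2) v := LinearIndependent.of_comp W.subtype hli
  exact hv.finite

theorem exists_span_sub_mem_hit {k n : ℕ} {S : Set (P k)} (hS : IsGeneratingSet k n S) {w : P k}
    (hw : w.IsHomogeneous n) : ∃ s ∈ Submodule.span (ZMod 2) S,
      w - s ∈ hit k ∧ (w - s).IsHomogeneous n := by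
  obtain ⟨s, hs, h, hh, rfl⟩ := Submodule.mem_sup.1 (hS.2 hw)
  refine ⟨s, hs, by rwa [add_sub_cancel_left], ?_⟩
  exact (homogeneousSubmodule (Fin k) (ZMod 2) n).sub_mem hw (Submodule.span_le.2 hS.1 hs)

/-- By `phi_mem_hit`, $\phi_{(i;I)}$ descends to classes in degree $N_d$, so the values on $B$
suffice. -/
theorem mk_phi_mem_span (hN : DegreeSeq l N) (hl : 2 ≤ l) (hN0 : 0 < N 0) {d : ℕ} (hd : l ≤ d)
    {B : Set (P l)} (hB : IsGeneratingSet l (N d) B) (p : Idx (l + 1)) {y : P l}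
    (hy : y.IsHomogeneous (N d)) :
    mk _ (phi p y) ∈ Submodule.span (ZMod 2) (Set.range fun b : B => mk _ (phi p b)) := by
  obtain ⟨s, hs, hsy, hsy'⟩ := exists_span_sub_mem_hit hB hy
  have h : mk _ (phi p y) = mk _ (phi p s) := by
    rw [mk_eq_mk, ← map_sub]
    exact phi_mem_hit hN hN0 (by omega) hd p hsy hsy'
  rw [h]
  have hle : Submodule.span (ZMod 2) B ≤ (Submodule.span (ZMod 2)
      (Set.range fun b : B => mk _ (phi p b))).comap ((mk _).comp (phi p)) :=
    Submodule.span_le.2 fun b hb => Submodule.subset_span ⟨⟨b, hb⟩, rfl⟩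
  exact hle hs

theorem map_mk_le_span_phi (hN : DegreeSeq l N) (hl : 2 ≤ l) (hN0 : 0 < N 0) {d : ℕ}
    (hd : l ≤ d) {B : Set (P l)} (hB : IsGeneratingSet l (N d) B) :
    (homogeneousSubmodule (Fin (l + 1)) (ZMod 2) (N d)).map (mk _) ≤
      Submodule.span (ZMod 2)
        (Set.range fun x : Σ _ : Idx (l + 1), B => mk _ (phi x.1 x.2)) := by
  rintro _ ⟨w, hw, rfl⟩
  refine mk_mem_of_phi_mem hN hl hN0 hd (fun p y hy => ?_) hw
  refine Submodule.span_mono ?_ (mk_phi_mem_span hN hl hN0 hd hB p (kapU_isHomogeneous hN d hy))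
  rintro _ ⟨b, rfl⟩
  exact ⟨⟨p, b⟩, rfl⟩

/-- The coordinate vectors with entries from $B$ are independent, lie in the span of the evaluated
classes $\phi_{(i;I)}(b)$, and have the same finite index set; comparing dimensions makes the latter
independent. -/
theorem linearIndependent_mk_phi (hN : DegreeSeq l N) (hl : 2 ≤ l) (hN0 : 0 < N 0) {d : ℕ}
    (hd : l ≤ d) {B : Set (P l)} (hB : IsMinimalGeneratingSet l (N d) B) :
    LinearIndependent (ZMod 2)
      fun x : Σ _ : Idx (l + 1), B => mk _ (phi x.1 x.2) := by
  classical
  have hli := linearIndependent_of_isMinimalGeneratingSet hB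
  have : Finite B := finite_of_linearIndependent hB.prop.1 hli
  have := Fintype.ofFinite (Σ _ : Idx (l + 1), B)
  have hsingle := Pi.linearIndependent_single (η := Idx (l + 1)) (fun _ (b : B) => mk l b)
    fun _ => hli
  refine LinearIndependent.of_comp (evalMap l) ?_
  rw [linearIndependent_iff_card_le_finrank_span, ← finrank_span_eq_card hsingle]
  have := FiniteDimensional.span_of_finite (ZMod 2) (Set.finite_range
    (evalMap l ∘ fun x : Σ _ : Idx (l + 1), B => mk _ (phi x.1 x.2)))
  refine Submodule.finrank_mono (Submodule.span_le.2 ?_)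
  rintro _ ⟨⟨p, b⟩, rfl⟩
  obtain ⟨y, hy, hby⟩ := exists_kapU_sub_mem hN d (hB.prop.1 b.2)
  have hb : mk l b = mk l (kapU l d y) := mk_eq_mk.2 (irregular_le_hit hN d hby)
  have := Submodule.map_mono (f := evalMap l) (map_mk_le_span_phi hN hl hN0 hd hB.prop)
    (single_mem_map_evalMap hN hl hN0 hd p hy)
  rw [Submodule.map_span, ← Set.range_comp, ← hb] at this
  exact this

/-- A monomial without $x_j$ is in the image of $f_j$, so the classes from $P_k^0$ in degree $N_d$
are spanned by those of the $f_j(b)$, from which $\phi_{(i;I)}(b)$ with $I\ne\emptyset$ is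
independent. -/
theorem phi_notMem_PZero (hN : DegreeSeq l N) (hl : 2 ≤ l) (hN0 : 0 < N 0) {d : ℕ}
    (hd : l ≤ d) {B : Set (P l)} (hB : IsMinimalGeneratingSet l (N d) B) {p : Idx (l + 1)}
    (hp : p.I ≠ ∅) {b : P l} (hb : b ∈ B) : phi p b ∉ PZero (l + 1) := by
  intro h
  have hli := linearIndependent_mk_phi hN hl hN0 hd hB
  have hnot := hli.notMem_span_image (s := {x | x.1.I = ∅}) (x := ⟨p, ⟨b, hb⟩⟩) hp
  set V := Submodule.span (ZMod 2)
    ((fun x : Σ _ : Idx (l + 1), B => mk _ (phi x.1 x.2)) '' {x | x.1.I = ∅})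
  have hle : PZero (l + 1) ≤
      V.comap ((mk _).comp (homogeneousComponent (N d))) := by
    refine Submodule.span_le.2 ?_
    rintro _ ⟨c, ⟨j, hj⟩, rfl⟩
    obtain ⟨c', hc', hdeg, -⟩ := exists_f_eq_monomial hj
    rw [SetLike.mem_coe, Submodule.mem_comap, LinearMap.comp_apply, homogeneousComponent_monomial]
    split_ifs with hc
    · let q : Idx (l + 1) := ⟨j, ∅, fun _ h => absurd h (Finset.notMem_empty _)⟩
      have h1 : phi q (monomial c' 1) = monomial c 1 := (phi_of_empty rfl _).trans hc'
      rw [← h1]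
      refine Submodule.span_mono ?_ (mk_phi_mem_span hN hl hN0 hd hB.prop q
        (isHomogeneous_monomial _ (hdeg.trans hc)))
      rintro _ ⟨b, rfl⟩
      exact ⟨⟨q, b⟩, rfl, rfl⟩
    · rw [map_zero]; exact zero_mem _
  have hmem := hle h
  rw [Submodule.mem_comap, LinearMap.comp_apply,
    homogeneousComponent_of_mem (phi_isHomogeneous p (hB.prop.1 hb)), if_pos rfl] at hmem
  exact hnot hmem

theorem Phi_eq_iUnion {B : Set (P l)}
    (hB : ∀ p : Idx (l + 1), p.I ≠ ∅ → ∀ b ∈ B, phi p b ∉ PZero (l + 1)) :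
    Phi B = ⋃ p : Idx (l + 1), phi p '' B := by
  ext x
  rw [Set.mem_iUnion]
  constructor
  · rintro (h | h)
    · obtain ⟨i, b, hb, rfl⟩ := Set.mem_iUnion.1 h
      exact ⟨⟨i, ∅, fun _ h => absurd h (Finset.notMem_empty _)⟩, b, hb, phi_of_empty rfl _⟩
    · obtain ⟨p, hp⟩ := Set.mem_iUnion.1 h.1
      obtain ⟨-, hp⟩ := Set.mem_iUnion.1 hp
      exact ⟨p, hp⟩
  · rintro ⟨p, b, hb, rfl⟩
    by_cases hp : p.I = ∅
    · exact Or.inl (Set.mem_iUnion.2 ⟨p.i, b, hb, (phi_of_empty hp b).symm⟩)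
    · refine Or.inr ⟨Set.mem_iUnion.2 ⟨p, Set.mem_iUnion.2 ⟨?_, b, hb, rfl⟩⟩, hB p hp b hb⟩
      exact Finset.card_pos.2 (Finset.nonempty_iff_ne_empty.2 hp)

theorem isMinimalGeneratingSet_iUnion_phi (hN : DegreeSeq l N) (hl : 2 ≤ l) (hN0 : 0 < N 0)
    {d : ℕ} (hd : l ≤ d) {B : Set (P l)} (hB : IsMinimalGeneratingSet l (N d) B) :
    IsMinimalGeneratingSet (l + 1) (N d) (⋃ p : Idx (l + 1), phi p '' B) := by
  have hli := linearIndependent_mk_phi hN hl hN0 hd hB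
  have hrange : (⋃ p : Idx (l + 1), phi p '' B) =
      Set.range fun x : Σ _ : Idx (l + 1), B => phi x.1 x.2 := by
    ext x
    rw [Set.mem_iUnion]
    constructor
    · rintro ⟨p, b, hb, rfl⟩; exact ⟨⟨p, b, hb⟩, rfl⟩
    · rintro ⟨⟨p, b⟩, rfl⟩; exact ⟨p, b, b.2, rfl⟩
  rw [hrange]
  refine isMinimalGeneratingSet_of_linearIndependent (isGeneratingSet_iff.2 ⟨?_, ?_⟩) ?_
  · rintro _ ⟨⟨p, b⟩, rfl⟩
    exact phi_isHomogeneous p (hB.prop.1 b.2)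
  · refine (map_mk_le_span_phi hN hl hN0 hd hB.prop).trans (Submodule.span_mono ?_)
    rintro _ ⟨x, rfl⟩
    exact ⟨_, ⟨x, rfl⟩, rfl⟩
  · let e := Equiv.ofInjective (fun x : Σ _ : Idx (l + 1), B => phi x.1 x.2.1)
      fun x y h => hli.injective (congrArg (mk _) h)
    exact (linearIndependent_equiv' e rfl).1 hli

theorem phi_image_disjoint_and_encard (hN : DegreeSeq l N) (hl : 2 ≤ l) (hN0 : 0 < N 0)
    {d : ℕ} (hd : l ≤ d) {B : Set (P l)} (hB : IsMinimalGeneratingSet l (N d) B) :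
    (∀ p q : Idx (l + 1), p ≠ q → Disjoint (phi p '' B) (phi q '' B)) ∧
      ∀ p : Idx (l + 1), (phi p '' B).encard = B.encard := by
  have hinj := (linearIndependent_mk_phi hN hl hN0 hd hB).injective
  have h : ∀ {p q : Idx (l + 1)} {b c : P l} (hb : b ∈ B) (hc : c ∈ B), phi p b = phi q c →
      (⟨p, b, hb⟩ : Σ _ : Idx (l + 1), B) = ⟨q, c, hc⟩ :=
    fun hb hc h => hinj (congrArg (mk _) h)
  refine ⟨fun p q hpq => Set.disjoint_left.2 ?_, fun p => Set.InjOn.encard_image ?_⟩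
  · rintro _ ⟨b, hb, rfl⟩ ⟨c, hc, hbc⟩
    exact hpq (congrArg Sigma.fst (h hb hc hbc.symm))
  · intro b hb c hc hbc
    have := h hb hc hbc
    simpa using this

end HitProblem

open HitProblem

theorem proposition3p1 (l : ℕ) (hl : 3 ≤ l) (d : ℕ → ℕ)
    (hdec : ∀ i, 1 ≤ i → i + 1 ≤ l - 1 → d (i + 1) < d i)
    (hlast : d l ≤ d (l - 1)) (hmin : l ≤ d l)
    (n : ℕ) (hn : n = ∑ i ∈ Finset.Icc 1 l, (2 ^ d i - 1))
    (B : Set (P l)) (hB : IsMinimalGeneratingSet l n B) :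
    IsMinimalGeneratingSet (l + 1) n (Phi B) ∧
      Phi B = ⋃ p : Idx (l + 1), phi p '' B ∧
      (∀ p q : Idx (l + 1), p ≠ q → Disjoint (phi p '' B) (phi q '' B)) ∧
      (∀ p : Idx (l + 1), (phi p '' B).encard = B.encard) ∧
      Nat.card (Idx (l + 1)) = 2 ^ (l + 1) - 1 := by
  have hN := degreeSeq_of_exponents hl hdec hlast
  have hle : ∀ j, j ≤ l - 2 → d (l - 1) ≤ d (l - 1 - j) := by
    intro j
    induction j with
    | zero => simp
    | succ j ih =>
      intro hj
      have h1 := hdec (l - 1 - (j + 1)) (by omega) (by omega)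
      rw [show l - 1 - (j + 1) + 1 = l - 1 - j by omega] at h1
      exact (ih (by omega)).trans h1.le
  have hdl : ∀ i ∈ Finset.Icc 1 l, d l ≤ d i := by
    intro i hi
    rw [Finset.mem_Icc] at hi
    rcases hi.2.lt_or_eq with h | rfl
    · have := hle (l - 1 - i) (by omega)
      rw [show l - 1 - (l - 1 - i) = i by omega] at this
      exact hlast.trans this
    · exact le_rfl
  set N : ℕ → ℕ := fun e => ∑ i ∈ Finset.Icc 1 l, (2 ^ (d i - d l + e) - 1)
  have hnN : n = N (d l) := by
    rw [hn]
    exact Finset.sum_congr rfl fun i hi => by rw [Nat.sub_add_cancel (hdl i hi)]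
  -- As $l\ge3$, $d_1>d_2\ge d_l$, so the first summand is positive.
  have hN0 : 0 < N 0 := by
    refine Finset.sum_pos' (fun _ _ => Nat.zero_le _) ⟨1, Finset.mem_Icc.2 ⟨le_rfl, by omega⟩, ?_⟩
    have h1 : d 2 < d 1 := hdec 1 le_rfl (by omega)
    have h2 := hdl 2 (Finset.mem_Icc.2 ⟨by omega, by omega⟩)
    exact Nat.sub_pos_of_lt (Nat.one_lt_two_pow (by omega))
  rw [hnN] at hB ⊢
  have hPhi := Phi_eq_iUnion fun p hp b hb =>
    phi_notMem_PZero hN (by omega) hN0 hmin hB (p := p) hp hb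
  obtain ⟨hdisj, hcard⟩ := phi_image_disjoint_and_encard hN (by omega) hN0 hmin hB
  exact ⟨hPhi ▸ isMinimalGeneratingSet_iUnion_phi hN (by omega) hN0 hmin hB, hPhi, hdisj, hcard,
    card_idx⟩
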